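/- Let $\mathbb H^2$ be the hyperbolic plane of curvature $-1$ with origin $0$, Riemannian area $d\Omega$, distance $d$ and Laplace–Beltrami operator $\Delta$. For $\Omega\in\mathbb H^2$ write $r=d(0,\Omega)$, and for $r>0$ let $$\widetilde w_2(r)=\Big(\frac{\sinh r}{r(1+r)}\Big)^{1/2},\qquad \widetilde w_2(0)=1.$$ For $\phi\in L^1(\mathbb H^2)$, let $e^{it\Delta}\phi$ denote the value at time $t$ of the solution of $i\partial_t u+\Delta u=0$, $u|_{t=0}=\phi$: for $\phi\in L^1\cap L^2$ this is the solution $u\in C(\mathbb R;L^2(\mathbb H^2))$ in the sense of distributions, and for $\phi\in L^1$ it is the limit, in the sense of distributions, of $e^{it\Delta}\phi_n$ for $\phi_n\in L^1\cap L^2$ with $\phi_n\to\phi$ in $L^1$. Let $\varepsilon\in\,]0,1[$. There exists $C_\varepsilon>0$ such that for all $t\in\mathbb R$, $t\neq 0$, and all radial $\phi\in L^1(\mathbb H^2)$ (that is, $\phi(\Omega)$ depends only on $r$), $e^{it\Delta}\phi$ exists, is unique up to almost everywhere equality, is represented by a continuous function on $\mathbb H^2$, and this representative satisfies, for every $\Omega\in\mathbb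 H^2$, $$\widetilde w_2(r)^{1-\varepsilon}\,\big|e^{it\Delta}\phi(\Omega)\big|\ \le\ \frac{C_\varepsilon}{|t|^{3/2}}\int_{\mathbb H^2}|\phi(\Omega')|\,\frac{d\Omega'}{\widetilde w_2(r')^{1-\varepsilon}},$$ where $r=d(0,\Omega)$ and $r'=d(0,\Omega')$. -/

import Mathlib

open MeasureTheory Filter Topology UpperHalfPlane
open scoped ContDiff

namespace HypSchrodinger

/-- The weight `w(r) = (sinh r / (r (1 + r)))^{1/2}`, with its limit value `1` at `r = 0`. -/
noncomputable def weight (r : ℝ) : ℝ :=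
  if r = 0 then 1 else (Real.sinh r / (r * (1 + r))) ^ (1 / 2 : ℝ)

/-- The distance of a point of the hyperbolic plane to the origin. The hyperbolic plane is the upper
half-plane `ℍ` with Mathlib's hyperbolic metric (curvature `-1`) and its Riemannian area
`volume = dx dy / y ^ 2`; the origin is the point `i`. -/
noncomputable def radius (z : ℍ) : ℝ := dist I z

/-- `φ` is (almost everywhere equal to) a function of the distance to the origin. -/
def IsRadial (φ : ℍ → ℂ) : Prop :=
  ∃ f : ℝ → ℂ, φ =ᵐ[volume] fun z => f (radius z)

/-- The complex valued test functions of class `C_c^∞` on the hyperbolic plane, seen as smooth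
functions on `ℂ` whose support is a compact subset of the open upper half-plane. -/
structure IsTestFunction (ψ : ℂ → ℂ) : Prop where
  smooth : ContDiff ℝ ∞ ψ
  compact : HasCompactSupport ψ
  support_subset : tsupport ψ ⊆ {z : ℂ | 0 < z.im}

/-- The Laplace-Beltrami operator `y ^ 2 (∂_x ^ 2 + ∂_y ^ 2)` of the hyperbolic plane. -/
noncomputable def hypLaplacian (ψ : ℂ → ℂ) (z : ℍ) : ℂ :=
  ((z.im ^ 2 : ℝ) : ℂ) * Laplacian.laplacian ψ (z : ℂ)

/-- `u ∈ C(ℝ; L²)` is a solution of the free Schrödinger equation `i ∂_t u + Δ u = 0`, tested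
against `C_c^∞` functions; that is, `u(t) = e^{itΔ} u(0)` for all times `t`. -/
structure IsL2Solution (u : ℝ → Lp ℂ 2 (volume : Measure ℍ)) : Prop where
  continuous : Continuous u
  weak_eq : ∀ ψ : ℂ → ℂ, IsTestFunction ψ → ∀ t : ℝ,
    HasDerivAt (fun s : ℝ => ∫ z : ℍ, u s z * ψ z)
      (Complex.I * ∫ z : ℍ, u t z * hypLaplacian ψ z) t

/-- `v = e^{itΔ} φ` for an integrable `φ`: the propagator on `L¹ ∩ L²` extended by continuity.
There are solutions `u n ∈ C(ℝ; L²)` whose data at time `0` tend to `φ` in `L¹`, and whose values at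
time `t` tend to the locally integrable function `v` in the sense of distributions. -/
def IsFreeEvolution (t : ℝ) (φ v : ℍ → ℂ) : Prop :=
  LocallyIntegrable v volume ∧
  ∃ u : ℕ → ℝ → Lp ℂ 2 (volume : Measure ℍ),
    (∀ n, IsL2Solution (u n)) ∧
    Tendsto (fun n => eLpNorm (fun z => u n 0 z - φ z) 1 volume) atTop (𝓝 0) ∧
    ∀ ψ : ℂ → ℂ, IsTestFunction ψ →
      Tendsto (fun n => ∫ z : ℍ, u n t z * ψ z) atTop (𝓝 (∫ z : ℍ, v z * ψ z))

end HypSchrodinger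

namespace HypSchrodinger

/-! Put `δ = 1 - ε` and `ρ = cosh d`. The propagator is convolution with the heat kernel of the
plane at the imaginary time `τ = i t`. Descent from hyperbolic three-space writes this kernel as
`heatK τ ρ = heatC τ * ∫ heatQ τ (ρ + x ^ 2) dx`, where `heatQ τ σ = E(σ) exp(-arccosh(σ)^2 / (4
τ))`, `E(σ) = arccosh σ / √(σ ^ 2 - 1)` and `|heatC τ| ≤ |τ|^(-3/2)`.

Size of the kernel. When `Re τ ≥ 0` and `σ ≥ 1` the exponential has modulus at most one, so no
oscillation has to be exploited. Since `E(σ) = O(σ^(-θ))` for every `θ < 1`, the choice `θ = (3 + δ)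
/ 4` leaves an integrable power of `x` and a factor `ρ^(-δ/2)`. This is `heatK_dispersive`: the
kernel is at most `C |τ|^(-3/2) cosh(d)^(-δ/2)`, up to the imaginary axis.

Radial data. A radial `φ` may be averaged over rotations. By the hyperbolic law of cosines, the
hyperbolic cosine of the distance from `z` to the rotated `w` is `X - q cos(θ - γ)` with `X = cosh r
cosh r'` and `0 ≤ q ≤ X`. With the angle recentred this is at least `X θ^2 / π^2`, and `|θ|^(-δ)` is
integrable because `δ < 1`. Hence the average of `cosh(d)^(-δ/2)` is at most a constant times `(cosh
r)^(-δ/2) (cosh r')^(-δ/2)` (`exists_integral_radial_le`). As the weight is at most `(cosh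
r)^(1/2)`, the estimate follows (`exists_weight_mul_norm_conv_le`).

Existence. For `a > 0` the kernel at time `a + i s` decays fast, solves the equation and gives
solutions in `C(ℝ; L²)` (`isL2Solution_heatK`). As `a → 0` their data tend to `φ` in `L¹`, because
the heat kernel is an approximation of the identity, and their values at time `t` converge by
dominated convergence (`isFreeEvolution_conv`).

Uniqueness. Any solution `u` can be paired with the backward regularized flow of a test function
`ψ`, and the pairing is constant in time (`IsL2Solution.pairing_heatK_eq`). Letting `a → 0` bounds
`∫ u(t) ψ` by `C |t|^(-3/2) ‖ψ‖₁ ‖u(0)‖₁`. Two approximating sequences therefore have the same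
distributional limit (`IsFreeEvolution.ae_eq`). The flow of `ψ` is not compactly supported, so the
kernel is first cut off at large distance (`exists_truncation`). -/

/-! ### The functions `arccosh σ / √(σ ^ 2 - 1)` and `arccosh ^ 2` on `σ > 0`. -/

/-- The integrals `∫_0^∞ x ^ j / (1 + 2 σ x + x ^ 2) ^ (j + 1) dx`. -/
noncomputable def arcInt (j : ℕ) (σ : ℝ) : ℝ :=
  ∫ x in Set.Ioi (0 : ℝ), x ^ j / (1 + 2 * σ * x + x ^ 2) ^ (j + 1)

lemma arcInt_integrand_bound (j : ℕ) {σ x : ℝ} (hσ : 0 ≤ σ) (hx : 0 < x) :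
    x ^ j / (1 + 2 * σ * x + x ^ 2) ^ (j + 1) ≤ (1 + x ^ 2)⁻¹ := by
  have h1 : 0 ≤ σ * x := by positivity
  have h2 : x ≤ 1 + 2 * σ * x + x ^ 2 := by nlinarith [sq_nonneg (x - 1)]
  have h3 : 1 + x ^ 2 ≤ 1 + 2 * σ * x + x ^ 2 := by nlinarith
  have h4 : 0 < 1 + 2 * σ * x + x ^ 2 := by positivity
  rw [pow_succ, div_le_iff₀ (by positivity), inv_mul_eq_div, le_div_iff₀ (by positivity)]
  exact mul_le_mul (pow_le_pow_left₀ hx.le h2 j) h3 (by positivity) (by positivity)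

lemma integrable_arcInt_integrand (j : ℕ) {σ : ℝ} (hσ : 0 ≤ σ) :
    IntegrableOn (fun x : ℝ => x ^ j / (1 + 2 * σ * x + x ^ 2) ^ (j + 1)) (Set.Ioi 0) := by
  refine Integrable.mono' (integrable_inv_one_add_sq.integrableOn (s := Set.Ioi 0))
    (Measurable.aestronglyMeasurable (by fun_prop)) ?_
  filter_upwards [ae_restrict_mem measurableSet_Ioi] with x hx
  have hx : 0 < x := hx
  rw [Real.norm_of_nonneg (by positivity)]
  exact arcInt_integrand_bound j hσ hx

lemma arcInt_nonneg (j : ℕ) {σ : ℝ} (hσ : 0 ≤ σ) : 0 ≤ arcInt j σ := by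
  refine setIntegral_nonneg measurableSet_Ioi fun x hx => ?_
  have hx : 0 < x := hx
  positivity

lemma arcInt_le_two (j : ℕ) {σ : ℝ} (hσ : 0 ≤ σ) : arcInt j σ ≤ 2 := by
  have : arcInt j σ ≤ ∫ x in Set.Ioi (0 : ℝ), (1 + x ^ 2)⁻¹ :=
    setIntegral_mono_on (integrable_arcInt_integrand j hσ) integrable_inv_one_add_sq.integrableOn
      measurableSet_Ioi fun x hx => arcInt_integrand_bound j hσ hx
  rw [integral_Ioi_inv_one_add_sq] at this
  simp at this
  linarith [Real.pi_le_four]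

/-- Differentiation under the integral raises the index by one, so the family is closed under
derivatives and every member is smooth across `σ = 1`, where the closed formula with `arccosh`
degenerates. -/
lemma hasDerivAt_arcInt (j : ℕ) {σ : ℝ} (hσ : 0 < σ) :
    HasDerivAt (arcInt j) (-(2 * (j + 1)) * arcInt (j + 1) σ) σ := by
  have key := hasDerivAt_integral_of_dominated_loc_of_deriv_le
    (μ := volume.restrict (Set.Ioi (0 : ℝ)))
    (F := fun σ x => x ^ j / (1 + 2 * σ * x + x ^ 2) ^ (j + 1))
    (F' := fun σ x => -(2 * (j + 1)) * (x ^ (j + 1) / (1 + 2 * σ * x + x ^ 2) ^ (j + 1 + 1)))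
    (bound := fun x => (2 * (j + 1)) * (1 + x ^ 2)⁻¹) (x₀ := σ) (s := Set.Ioi 0)
    (Ioi_mem_nhds hσ) ?_ (integrable_arcInt_integrand j hσ.le) ?_ ?_ ?_ ?_
  · have := key.2
    rw [integral_const_mul] at this
    exact this
  · exact Eventually.of_forall fun x => Measurable.aestronglyMeasurable (by fun_prop)
  · exact Measurable.aestronglyMeasurable (by fun_prop)
  · filter_upwards [ae_restrict_mem measurableSet_Ioi] with x hx s hs
    have hx : 0 < x := hx
    have hs : 0 < s := hs
    have := arcInt_integrand_bound (j + 1) hs.le hx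
    rw [norm_mul, Real.norm_of_nonneg
      (show 0 ≤ x ^ (j + 1) / (1 + 2 * s * x + x ^ 2) ^ (j + 1 + 1) by positivity), norm_neg,
      Real.norm_of_nonneg (by positivity)]
    gcongr
  · exact (integrable_inv_one_add_sq.integrableOn).const_mul _
  · filter_upwards [ae_restrict_mem measurableSet_Ioi] with x hx s hs
    have hx : 0 < x := hx
    have hs : 0 < s := hs
    have h4 : 1 + 2 * s * x + x ^ 2 ≠ 0 := by positivity
    have hd : HasDerivAt (fun s : ℝ => 1 + 2 * s * x + x ^ 2) (2 * x) s := by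
      have := (((hasDerivAt_id s).const_mul 2).mul_const x).const_add 1 |>.add_const (x ^ 2)
      simpa using this
    have := (hasDerivAt_const s (x ^ j)).div (hd.pow (j + 1)) (pow_ne_zero _ h4)
    refine this.congr_deriv ?_
    simp only [Pi.pow_apply]
    push_cast
    field_simp
    ring

/-- `arccosh σ / √(σ ^ 2 - 1)`, extended smoothly across `σ = 1`. -/
noncomputable def arcE (σ : ℝ) : ℝ := arcInt 0 σ

/-- The first derivative of `arcE`. -/
noncomputable def arcE1 (σ : ℝ) : ℝ := -2 * arcInt 1 σ

/-- The second derivative of `arcE`. -/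
noncomputable def arcE2 (σ : ℝ) : ℝ := 8 * arcInt 2 σ

/-- The square of `arccosh`, extended smoothly across `σ = 1`. -/
noncomputable def arcF (σ : ℝ) : ℝ := (σ ^ 2 - 1) * arcE σ ^ 2

lemma hasDerivAt_arcE {σ : ℝ} (hσ : 0 < σ) : HasDerivAt arcE (arcE1 σ) σ := by
  refine (hasDerivAt_arcInt 0 hσ).congr_deriv ?_
  simp [arcE1]

lemma hasDerivAt_arcE1 {σ : ℝ} (hσ : 0 < σ) : HasDerivAt arcE1 (arcE2 σ) σ := by
  refine ((hasDerivAt_arcInt 1 hσ).const_mul (-2)).congr_deriv ?_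
  simp [arcE2]; ring

lemma continuousOn_arcE2 : ContinuousOn arcE2 (Set.Ioi 0) := fun _ hσ =>
  ((hasDerivAt_arcInt 2 hσ).const_mul 8).continuousAt.continuousWithinAt

lemma arcE_nonneg {σ : ℝ} (hσ : 0 ≤ σ) : 0 ≤ arcE σ := arcInt_nonneg 0 hσ
lemma arcE_le {σ : ℝ} (hσ : 0 ≤ σ) : arcE σ ≤ 2 := arcInt_le_two 0 hσ
lemma abs_arcE1_le {σ : ℝ} (hσ : 0 ≤ σ) : |arcE1 σ| ≤ 4 := by
  rw [arcE1, abs_mul, abs_of_nonneg (arcInt_nonneg 1 hσ)]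
  norm_num
  linarith [arcInt_le_two 1 hσ]
lemma abs_arcE2_le {σ : ℝ} (hσ : 0 ≤ σ) : |arcE2 σ| ≤ 16 := by
  rw [arcE2, abs_mul, abs_of_nonneg (arcInt_nonneg 2 hσ)]
  norm_num
  linarith [arcInt_le_two 2 hσ]

/-- The integrand of the left side has the primitive `-(1 + σ x) / (1 + 2 σ x + x ^ 2)`, which goes
from `-1` at `x = 0` to `0` at infinity. This first order equation is what identifies `arcE` with
`arccosh σ / √(σ ^ 2 - 1)`. -/
lemma arcE_ode {σ : ℝ} (hσ : 0 < σ) : (σ ^ 2 - 1) * arcE1 σ + σ * arcE σ = 1 := by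
  have hpos : ∀ x ∈ Set.Ici (0 : ℝ), 0 < 1 + 2 * σ * x + x ^ 2 := fun x hx => by
    have : 0 ≤ x := hx
    positivity
  have h0 := integrable_arcInt_integrand 0 hσ.le
  have h1 := integrable_arcInt_integrand 1 hσ.le
  have hlim : Tendsto (fun x : ℝ => -(1 + σ * x) / (1 + 2 * σ * x + x ^ 2)) atTop (𝓝 0) := by
    have hb : Tendsto (fun x : ℝ => (1 + σ) * x⁻¹) atTop (𝓝 0) := by
      simpa using tendsto_inv_atTop_zero.const_mul (1 + σ)
    refine squeeze_zero_norm' ?_ hb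
    filter_upwards [eventually_ge_atTop 1] with x hx
    have hD := hpos x (by simp; linarith)
    rw [norm_div, norm_neg, Real.norm_of_nonneg (by positivity), Real.norm_of_nonneg hD.le,
      ← div_eq_mul_inv, div_le_div_iff₀ hD (by positivity)]
    nlinarith [mul_nonneg hσ.le (by linarith : 0 ≤ x), mul_nonneg (mul_nonneg hσ.le hσ.le) (by linarith : 0 ≤ x)]
  have key := integral_Ioi_of_hasDerivAt_of_tendsto'
    (f := fun x : ℝ => -(1 + σ * x) / (1 + 2 * σ * x + x ^ 2))
    (f' := fun x => σ * (x ^ 0 / (1 + 2 * σ * x + x ^ 2) ^ (0 + 1))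
      - 2 * (σ ^ 2 - 1) * (x ^ 1 / (1 + 2 * σ * x + x ^ 2) ^ (1 + 1))) (a := 0) (m := 0)
    (fun x hx => ?_) (show Integrable _ _ from (h0.const_mul _).sub (h1.const_mul _)) hlim
  · rw [integral_sub (h0.const_mul _) (h1.const_mul _), integral_const_mul,
      integral_const_mul] at key
    simp only [arcE, arcE1, arcInt]
    norm_num at key ⊢
    linarith
  · have h4 := (hpos x hx).ne'
    have hd : HasDerivAt (fun x : ℝ => 1 + 2 * σ * x + x ^ 2) (2 * σ + 2 * x) x := by
      have := (((hasDerivAt_id x).const_mul (2 * σ)).const_add 1).fun_add (hasDerivAt_pow 2 x)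
      simpa using this
    have hn : HasDerivAt (fun x : ℝ => -(1 + σ * x)) (-σ) x := by
      have := (((hasDerivAt_id x).const_mul σ).const_add 1).fun_neg
      simpa only [id, mul_one] using this
    refine (hn.div hd h4).congr_deriv ?_
    generalize hD : 1 + 2 * σ * x + x ^ 2 = D at h4 ⊢
    field_simp
    rw [← hD]
    ring

lemma arcE_ode' {σ : ℝ} (hσ : 0 < σ) :
    (σ ^ 2 - 1) * arcE2 σ + 3 * σ * arcE1 σ + arcE σ = 0 := by
  have h1 : HasDerivAt (fun σ => (σ ^ 2 - 1) * arcE1 σ + σ * arcE σ)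
      ((2 * σ) * arcE1 σ + (σ ^ 2 - 1) * arcE2 σ + (1 * arcE σ + σ * arcE1 σ)) σ := by
    have hp : HasDerivAt (fun σ : ℝ => σ ^ 2 - 1) (2 * σ) σ := by
      simpa using (hasDerivAt_pow 2 σ).sub_const 1
    exact (hp.mul (hasDerivAt_arcE1 hσ)).add ((hasDerivAt_id σ).mul (hasDerivAt_arcE hσ))
  have h2 : HasDerivAt (fun σ => (σ ^ 2 - 1) * arcE1 σ + σ * arcE σ) 0 σ := by
    refine (hasDerivAt_const σ (1 : ℝ)).congr_of_eventuallyEq ?_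
    filter_upwards [Ioi_mem_nhds hσ] with s hs using arcE_ode hs
  have := h1.unique h2
  linarith

lemma hasDerivAt_arcF {σ : ℝ} (hσ : 0 < σ) : HasDerivAt arcF (2 * arcE σ) σ := by
  have hp : HasDerivAt (fun σ : ℝ => σ ^ 2 - 1) (2 * σ) σ := by
    simpa using (hasDerivAt_pow 2 σ).sub_const 1
  refine (hp.mul ((hasDerivAt_arcE hσ).pow 2)).congr_deriv ?_
  simp only [Pi.pow_apply]
  have := arcE_ode hσ
  push_cast
  linear_combination (2 * arcE σ) * this

/-- By `arcE_ode` the difference of the two sides has zero derivative, and it vanishes at `s = 0`.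
-/
lemma sinh_mul_arcE_cosh (s : ℝ) : Real.sinh s * arcE (Real.cosh s) = s := by
  have hd : ∀ s : ℝ, HasDerivAt (fun s => Real.sinh s * arcE (Real.cosh s) - s) 0 s := by
    intro s
    have := ((Real.hasDerivAt_sinh s).mul
      ((hasDerivAt_arcE (Real.cosh_pos s)).comp s (Real.hasDerivAt_cosh s))).sub (hasDerivAt_id s)
    refine this.congr_deriv ?_
    have h := arcE_ode (Real.cosh_pos s)
    have h2 := Real.cosh_sq s
    simp only [Function.comp]
    rw [h2] at h
    linear_combination h
  have := is_const_of_deriv_eq_zero (fun s => (hd s).differentiableAt) (fun s => (hd s).deriv) s 0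
  simp at this
  linarith

lemma arcF_cosh (s : ℝ) : arcF (Real.cosh s) = s ^ 2 := by
  have := sinh_mul_arcE_cosh s
  rw [arcF, Real.cosh_sq]
  calc _ = (Real.sinh s * arcE (Real.cosh s)) ^ 2 := by ring
    _ = _ := by rw [this]

lemma arcF_nonneg {σ : ℝ} (hσ : 1 ≤ σ) : 0 ≤ arcF σ :=
  mul_nonneg (by nlinarith) (sq_nonneg _)

lemma arcF_ge {σ : ℝ} (hσ : 0 ≤ σ) : -4 ≤ arcF σ := by
  have h1 := arcE_nonneg hσ
  have h2 := arcE_le hσ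
  rw [arcF]
  nlinarith [mul_nonneg (sq_nonneg σ) (sq_nonneg (arcE σ))]

lemma arcF_mono : MonotoneOn arcF (Set.Ioi 0) := by
  refine monotoneOn_of_deriv_nonneg (convex_Ioi 0)
    (fun σ hσ => (hasDerivAt_arcF hσ).continuousAt.continuousWithinAt) ?_ ?_
  · rw [interior_Ioi]
    exact fun σ hσ => (hasDerivAt_arcF hσ).differentiableAt.differentiableWithinAt
  · rw [interior_Ioi]
    intro σ hσ
    rw [(hasDerivAt_arcF hσ).deriv]
    linarith [arcE_nonneg (le_of_lt (show 0 < σ from hσ))]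

/-- Since `cosh s ≤ exp s` for `s ≥ 0`, `arccosh` dominates the logarithm. A Gaussian in `arccosh σ`
thus beats every power of `σ`. -/
lemma log_sq_le_arcF {σ : ℝ} (hσ : 1 ≤ σ) : Real.log σ ^ 2 ≤ arcF σ := by
  have h1 : σ ≤ Real.exp (Real.arcosh σ) := by
    have := Real.cosh_arcosh hσ
    have h2 := Real.cosh_eq (Real.arcosh σ)
    have h0 : 0 ≤ Real.arcosh σ := Real.arcosh_nonneg hσ
    have h3 : Real.exp (-Real.arcosh σ) ≤ Real.exp (Real.arcosh σ) := Real.exp_le_exp.2 (by linarith)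
    linarith
  have h2 : Real.log σ ≤ Real.arcosh σ := (Real.log_le_iff_le_exp (by linarith)).2 h1
  have h3 : arcF σ = Real.arcosh σ ^ 2 := by
    conv_lhs => rw [← Real.cosh_arcosh hσ]
    exact arcF_cosh _
  rw [h3]
  exact pow_le_pow_left₀ (Real.log_nonneg hσ) h2 2

/-- `exp (-c arcF)` decays faster than every power. -/
lemma exp_neg_arcF_le {c : ℝ} (hc : 0 < c) (N : ℝ) (hN : 0 ≤ N) : ∃ C, 0 < C ∧ ∀ σ : ℝ, 0 < σ →
    Real.exp (-c * arcF σ) ≤ C * (1 + σ) ^ (-N) := by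
  refine ⟨(Real.exp (4 * c) + Real.exp (N ^ 2 / (4 * c))) * 2 ^ N, by positivity, fun σ hσ => ?_⟩
  have key : Real.exp (-c * arcF σ) ≤
      (Real.exp (4 * c) + Real.exp (N ^ 2 / (4 * c))) * (max 1 σ) ^ (-N) := by
    rcases le_total 1 σ with h | h
    · rw [max_eq_right h, Real.rpow_def_of_pos hσ, add_mul]
      have : Real.exp (-c * arcF σ) ≤ Real.exp (N ^ 2 / (4 * c)) * Real.exp (Real.log σ * -N) := by
        rw [← Real.exp_add, Real.exp_le_exp]
        have h1 := log_sq_le_arcF h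
        -- Completing the square in `log σ` produces the constant `exp (N ^ 2 / (4 c))`. The other
        -- constant, `exp (4 c)`, covers `σ ≤ 1`, where `arcF ≥ -4`.
        have h2 : N ^ 2 / (4 * c) + Real.log σ * -N + c * Real.log σ ^ 2
            = c * (Real.log σ - N / (2 * c)) ^ 2 := by field_simp; ring
        nlinarith [mul_nonneg hc.le (sq_nonneg (Real.log σ - N / (2 * c)))]
      have h3 : 0 ≤ Real.exp (4 * c) * Real.exp (Real.log σ * -N) := by positivity
      linarith
    · rw [max_eq_left h, Real.one_rpow, mul_one]
      have : Real.exp (-c * arcF σ) ≤ Real.exp (4 * c) :=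
        Real.exp_le_exp.2 (by nlinarith [arcF_ge hσ.le])
      linarith [Real.exp_pos (N ^ 2 / (4 * c))]
  refine key.trans ?_
  rw [mul_assoc]
  refine mul_le_mul_of_nonneg_left ?_ (by positivity)
  have h1 : (1 + σ) / 2 ≤ max 1 σ := by
    have := le_max_left 1 σ; have := le_max_right 1 σ; linarith
  calc (max 1 σ) ^ (-N) ≤ ((1 + σ) / 2) ^ (-N) :=
        Real.rpow_le_rpow_of_nonpos (by positivity) h1 (by linarith)
    _ = 2 ^ N * (1 + σ) ^ (-N) := by
        rw [Real.div_rpow (by positivity) (by positivity), Real.rpow_neg (by norm_num : (0:ℝ) ≤ 2)]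
        field_simp

/-- Interpolation bound for `arcE`. -/
lemma arcE_le_rpow {θ : ℝ} (h0 : 0 < θ) (h1 : θ < 1) : ∃ C, 0 < C ∧ ∀ σ : ℝ, 1 ≤ σ →
    arcE σ ≤ C * σ ^ (-θ) := by
  have h1' : 0 < 1 - θ := by linarith
  refine ⟨2 * 2 ^ θ + 2 * 2 ^ (1 - θ) / (1 - θ), by positivity, fun σ hσ => ?_⟩
  have hσ0 : 0 < σ := by linarith
  rcases le_total σ 2 with h | h
  · have h2 : (1 : ℝ) ≤ 2 ^ θ * σ ^ (-θ) := by
      rw [Real.rpow_neg hσ0.le, ← div_eq_mul_inv, one_le_div (by positivity)]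
      exact Real.rpow_le_rpow hσ0.le h h0.le
    have h3 : 0 ≤ 2 * 2 ^ (1 - θ) / (1 - θ) * σ ^ (-θ) := by positivity
    nlinarith [arcE_le hσ0.le]
  -- For `σ ≥ 2`: `sinh (arcosh σ) ≥ σ / 2`, while `arcosh σ ≤ log (2 σ) ≤ (2 σ)^(1 - θ) / (1 - θ)`.
  -- The logarithm is why `θ = 1` is out of reach.
  · have hs := sinh_mul_arcE_cosh (Real.arcosh σ)
    rw [Real.cosh_arcosh hσ] at hs
    have hc := Real.cosh_arcosh hσ
    have hsq := Real.cosh_sq (Real.arcosh σ)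
    have ha0 : 0 ≤ Real.arcosh σ := Real.arcosh_nonneg hσ
    have hsinh0 : 0 ≤ Real.sinh (Real.arcosh σ) := Real.sinh_nonneg_iff.2 ha0
    have hsinh : σ / 2 ≤ Real.sinh (Real.arcosh σ) := by
      rw [hc] at hsq
      nlinarith
    have hlog : Real.arcosh σ ≤ Real.log (2 * σ) := by
      rw [Real.le_log_iff_exp_le (by positivity)]
      have h2 := Real.cosh_eq (Real.arcosh σ)
      have := Real.exp_pos (-Real.arcosh σ)
      linarith
    have hlog2 := Real.log_le_rpow_div (show 0 ≤ 2 * σ by positivity) h1'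
    have hE := arcE_nonneg hσ0.le
    have h4 : σ / 2 * arcE σ ≤ (2 * σ) ^ (1 - θ) / (1 - θ) :=
      (mul_le_mul_of_nonneg_right hsinh hE).trans (by linarith)
    have h5 : (2 * σ) ^ (1 - θ) = 2 ^ (1 - θ) * (σ * σ ^ (-θ)) := by
      rw [Real.mul_rpow (by norm_num) hσ0.le, sub_eq_add_neg 1 θ, Real.rpow_add hσ0,
        Real.rpow_one]
    rw [h5] at h4
    have h6 : arcE σ ≤ 2 * 2 ^ (1 - θ) / (1 - θ) * σ ^ (-θ) := by
      have : σ * arcE σ ≤ σ * (2 * 2 ^ (1 - θ) / (1 - θ) * σ ^ (-θ)) := by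
        calc σ * arcE σ = 2 * (σ / 2 * arcE σ) := by ring
          _ ≤ 2 * (2 ^ (1 - θ) * (σ * σ ^ (-θ)) / (1 - θ)) := by linarith
          _ = _ := by ring
      exact le_of_mul_le_mul_left this hσ0
    have h7 : 0 ≤ 2 * 2 ^ θ * σ ^ (-θ) := by positivity
    linarith

/-! ### The profile of the heat kernel of hyperbolic three-space at complex time. -/

/-- The Gaussian `exp (-arccosh(σ)^2 / (4 τ))` with complex time `τ`. -/
noncomputable def gauss (τ : ℂ) (σ : ℝ) : ℂ := Complex.exp (((-arcF σ / 4 : ℝ) : ℂ) * τ⁻¹)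

/-- Up to a factor depending on `τ`, the heat kernel of the three dimensional hyperbolic space, as
a function of `σ = cosh d`. -/
noncomputable def heatQ (τ : ℂ) (σ : ℝ) : ℂ := (arcE σ : ℂ) * gauss τ σ

/-- The first derivative of `heatQ τ`. -/
noncomputable def heatQ1 (τ : ℂ) (σ : ℝ) : ℂ :=
  ((arcE1 σ : ℂ) - (arcE σ : ℂ) ^ 2 / 2 * τ⁻¹) * gauss τ σ

/-- The second derivative of `heatQ τ`. -/
noncomputable def heatQ2 (τ : ℂ) (σ : ℝ) : ℂ :=
  ((arcE2 σ : ℂ) - 3 / 2 * (arcE σ : ℂ) * (arcE1 σ : ℂ) * τ⁻¹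
    + (arcE σ : ℂ) ^ 3 / 4 * (τ⁻¹) ^ 2) * gauss τ σ

lemma hasDerivAt_gauss (τ : ℂ) {σ : ℝ} (hσ : 0 < σ) :
    HasDerivAt (gauss τ) (-(arcE σ : ℂ) / 2 * τ⁻¹ * gauss τ σ) σ := by
  have h1 : HasDerivAt (fun σ => ((-arcF σ / 4 : ℝ) : ℂ) * τ⁻¹)
      (((-(2 * arcE σ) / 4 : ℝ) : ℂ) * τ⁻¹) σ :=
    (((hasDerivAt_arcF hσ).neg.div_const 4).ofReal_comp).mul_const _
  refine h1.cexp.congr_deriv ?_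
  rw [gauss]
  push_cast
  ring

lemma hasDerivAt_heatQ (τ : ℂ) {σ : ℝ} (hσ : 0 < σ) :
    HasDerivAt (heatQ τ) (heatQ1 τ σ) σ := by
  refine ((hasDerivAt_arcE hσ).ofReal_comp.mul (hasDerivAt_gauss τ hσ)).congr_deriv ?_
  rw [heatQ1]
  ring

lemma hasDerivAt_heatQ1 (τ : ℂ) {σ : ℝ} (hσ : 0 < σ) :
    HasDerivAt (heatQ1 τ) (heatQ2 τ σ) σ := by
  have hE := (hasDerivAt_arcE hσ).ofReal_comp
  have h := (((hasDerivAt_arcE1 hσ).ofReal_comp.fun_sub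
    (((hE.fun_pow 2).div_const 2).mul_const τ⁻¹))).mul (hasDerivAt_gauss τ hσ)
  refine h.congr_deriv ?_
  rw [heatQ2]
  push_cast
  ring

lemma continuousOn_gauss (τ : ℂ) : ContinuousOn (gauss τ) (Set.Ioi 0) := fun _ h =>
  (hasDerivAt_gauss τ h).continuousAt.continuousWithinAt

lemma continuousOn_heatQ (τ : ℂ) : ContinuousOn (heatQ τ) (Set.Ioi 0) := fun _ h =>
  (hasDerivAt_heatQ τ h).continuousAt.continuousWithinAt

lemma continuousOn_heatQ1 (τ : ℂ) : ContinuousOn (heatQ1 τ) (Set.Ioi 0) := fun _ h =>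
  (hasDerivAt_heatQ1 τ h).continuousAt.continuousWithinAt

lemma continuousOn_heatQ2 (τ : ℂ) : ContinuousOn (heatQ2 τ) (Set.Ioi 0) := by
  have h0 : ContinuousOn (fun σ => (arcE σ : ℂ)) (Set.Ioi 0) := fun _ h =>
    (hasDerivAt_arcE h).ofReal_comp.continuousAt.continuousWithinAt
  have h1 : ContinuousOn (fun σ => (arcE1 σ : ℂ)) (Set.Ioi 0) := fun _ h =>
    (hasDerivAt_arcE1 h).ofReal_comp.continuousAt.continuousWithinAt
  have h2 : ContinuousOn (fun σ => (arcE2 σ : ℂ)) (Set.Ioi 0) :=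
    Complex.continuous_ofReal.comp_continuousOn continuousOn_arcE2
  have hg := continuousOn_gauss τ
  unfold heatQ2
  fun_prop

/-- Pointwise heat equation for the one-dimensional profile. -/
lemma heatQ_identity (τ : ℂ) {σ : ℝ} (hσ : 0 < σ) :
    (((arcF σ / 4 : ℝ) : ℂ) * (τ⁻¹) ^ 2 - 3 / 2 * τ⁻¹ - 1 / 4) * heatQ τ σ =
      ((σ : ℂ) ^ 2 - 1) * heatQ2 τ σ + 3 * σ * heatQ1 τ σ + 3 / 4 * heatQ τ σ := by
  have h1 : ((σ : ℂ) ^ 2 - 1) * arcE1 σ + σ * arcE σ = 1 := by exact_mod_cast arcE_ode hσ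
  have h2 : ((σ : ℂ) ^ 2 - 1) * arcE2 σ + 3 * σ * arcE1 σ + arcE σ = 0 := by
    exact_mod_cast arcE_ode' hσ
  rw [heatQ, heatQ1, heatQ2, arcF]
  push_cast
  linear_combination (-gauss τ σ) * h2 + (3 / 2 * arcE σ * τ⁻¹ * gauss τ σ) * h1

lemma gauss_bound {τ₀ : ℂ} (h₀ : 0 < τ₀.re) (N : ℕ) : ∃ C : ℝ, 0 < C ∧ ∀ᶠ τ in 𝓝 τ₀,
    0 < τ.re ∧ ‖τ⁻¹‖ ≤ C ∧ ∀ σ : ℝ, 0 < σ → ‖gauss τ σ‖ ≤ C / (1 + σ) ^ N := by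
  have hne : τ₀ ≠ 0 := fun h => by simp [h] at h₀
  have hr0 : 0 < (τ₀⁻¹).re := by
    rw [Complex.inv_re]
    exact div_pos h₀ (Complex.normSq_pos.2 hne)
  set r := (τ₀⁻¹).re with hr
  obtain ⟨C, hC, hCb⟩ := exp_neg_arcF_le (show 0 < r / 8 by positivity) N (Nat.cast_nonneg N)
  refine ⟨Real.exp (2 * r) * C + (‖τ₀⁻¹‖ + 1), by positivity, ?_⟩
  have hcont : ContinuousAt (fun τ : ℂ => τ⁻¹) τ₀ := continuousAt_inv₀ hne
  have hre : ContinuousAt (fun τ : ℂ => (τ⁻¹).re) τ₀ :=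
    Complex.continuous_re.continuousAt.comp hcont
  have e1 : ∀ᶠ τ in 𝓝 τ₀, r / 2 < (τ⁻¹).re := hre.eventually_const_lt (by simp only; linarith)
  have e2 : ∀ᶠ τ in 𝓝 τ₀, (τ⁻¹).re < 2 * r := hre.eventually_lt_const (by simp only; linarith)
  have e3 : ∀ᶠ τ in 𝓝 τ₀, ‖τ⁻¹‖ < ‖τ₀⁻¹‖ + 1 := hcont.norm.eventually_lt_const (by simp)
  have e4 : ∀ᶠ τ : ℂ in 𝓝 τ₀, 0 < τ.re :=
    Complex.continuous_re.continuousAt.eventually_const_lt h₀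
  filter_upwards [e1, e2, e3, e4] with τ h1 h2 h3 h4
  refine ⟨h4, ?_, fun σ hσ => ?_⟩
  · have : 0 < Real.exp (2 * r) * C := by positivity
    linarith
  have hb := hCb σ hσ
  rw [Real.rpow_neg (by positivity), Real.rpow_natCast] at hb
  -- Where `arcF ≥ 0` the lower bound `r / 2` for `Re τ⁻¹` is used. Where `arcF < 0`, which forces
  -- `σ < 1`, the upper bound `2 r` and `arcF ≥ -4` cost at most `exp (2 r)`.
  have h5 : ‖gauss τ σ‖ ≤ Real.exp (2 * r) * Real.exp (-(r / 8) * arcF σ) := by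
    rw [gauss, Complex.norm_exp, ← Real.exp_add, Real.exp_le_exp, Complex.re_ofReal_mul]
    rcases le_total 0 (arcF σ) with h | h
    · nlinarith
    · nlinarith [arcF_ge hσ.le]
  calc ‖gauss τ σ‖ ≤ Real.exp (2 * r) * (C * ((1 + σ) ^ N)⁻¹) :=
        h5.trans (mul_le_mul_of_nonneg_left hb (Real.exp_pos _).le)
    _ = (Real.exp (2 * r) * C) / (1 + σ) ^ N := by rw [div_eq_mul_inv, mul_assoc]
    _ ≤ _ := by
        gcongr
        have : 0 ≤ ‖τ₀⁻¹‖ := norm_nonneg _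
        linarith

lemma abs_arcF_le {σ : ℝ} (hσ : 0 < σ) : |arcF σ| ≤ 4 * (1 + σ) ^ 2 := by
  have h1 := arcE_nonneg hσ.le
  have h2 := arcE_le hσ.le
  have h3 : arcE σ ^ 2 ≤ 4 := by nlinarith
  rw [arcF, abs_mul, abs_of_nonneg (sq_nonneg (arcE σ))]
  have h4 : |σ ^ 2 - 1| ≤ (1 + σ) ^ 2 := abs_le.2 ⟨by nlinarith, by nlinarith⟩
  calc _ ≤ (1 + σ) ^ 2 * 4 := mul_le_mul h4 h3 (sq_nonneg _) (sq_nonneg _)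
    _ = _ := by ring

/-- Rapid decay of the profile, its derivatives and its time derivative, locally uniformly. -/
lemma heatQ_bound {τ₀ : ℂ} (h₀ : 0 < τ₀.re) (N : ℕ) : ∃ C : ℝ, 0 < C ∧ ∀ᶠ τ in 𝓝 τ₀,
    0 < τ.re ∧ ∀ σ : ℝ, 0 < σ → ‖heatQ τ σ‖ ≤ C / (1 + σ) ^ N ∧ ‖heatQ1 τ σ‖ ≤ C / (1 + σ) ^ N ∧
      ‖heatQ2 τ σ‖ ≤ C / (1 + σ) ^ N ∧
      ‖((arcF σ / 4 : ℝ) : ℂ) * (τ⁻¹) ^ 2 * heatQ τ σ‖ ≤ C / (1 + σ) ^ N := by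
  -- Two spare powers absorb the factor `arcF = O((1 + σ) ^ 2)` of the time derivative.
  obtain ⟨C, hC, hCb⟩ := gauss_bound h₀ (N + 2)
  refine ⟨(16 + 24 * C + 2 * C ^ 2) * C, by positivity, ?_⟩
  filter_upwards [hCb] with τ hτ
  refine ⟨hτ.1, fun σ hσ => ?_⟩
  have hg := hτ.2.2 σ hσ
  have hi := hτ.2.1
  have hi2 : ‖τ⁻¹‖ ^ 2 ≤ C ^ 2 := pow_le_pow_left₀ (norm_nonneg _) hi 2
  have hE0 : ‖(arcE σ : ℂ)‖ ≤ 2 := by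
    rw [Complex.norm_real, Real.norm_of_nonneg (arcE_nonneg hσ.le)]; exact arcE_le hσ.le
  have hE1 : ‖(arcE1 σ : ℂ)‖ ≤ 4 := by
    rw [Complex.norm_real]; exact abs_arcE1_le hσ.le
  have hE2 : ‖(arcE2 σ : ℂ)‖ ≤ 16 := by
    rw [Complex.norm_real]; exact abs_arcE2_le hσ.le
  have hF : ‖((arcF σ / 4 : ℝ) : ℂ)‖ ≤ (1 + σ) ^ 2 := by
    rw [Complex.norm_real, norm_div, Real.norm_eq_abs]
    have := abs_arcF_le hσ
    norm_num
    linarith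
  have hE02 : ‖(arcE σ : ℂ)‖ ^ 2 ≤ 4 := by nlinarith [norm_nonneg (arcE σ : ℂ)]
  have hE03 : ‖(arcE σ : ℂ)‖ ^ 3 ≤ 8 := by
    calc _ ≤ (2 : ℝ) ^ 3 := pow_le_pow_left₀ (norm_nonneg _) hE0 3
      _ = 8 := by norm_num
  have hs : 1 ≤ (1 + σ) ^ 2 := by nlinarith
  have hsN : C / (1 + σ) ^ (N + 2) * (1 + σ) ^ 2 = C / (1 + σ) ^ N := by
    field_simp
    ring
  have hg' : ‖gauss τ σ‖ ≤ C / (1 + σ) ^ N := by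
    rw [← hsN]
    exact hg.trans (le_mul_of_one_le_right (by positivity) hs)
  have fin : ∀ z : ℂ, ‖z‖ ≤ 16 + 24 * C + 2 * C ^ 2 →
      ‖z * gauss τ σ‖ ≤ (16 + 24 * C + 2 * C ^ 2) * C / (1 + σ) ^ N := by
    intro z hz
    rw [norm_mul, mul_div_assoc]
    exact mul_le_mul hz hg' (norm_nonneg _) (by positivity)
  refine ⟨fin _ ?_, fin _ ?_, fin _ ?_, ?_⟩
  · nlinarith
  · refine (norm_sub_le _ _).trans ?_
    rw [norm_mul, norm_div, norm_pow, Complex.norm_ofNat]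
    have : ‖(arcE σ : ℂ)‖ ^ 2 / 2 * ‖τ⁻¹‖ ≤ 2 * C :=
      mul_le_mul (by linarith) hi (norm_nonneg _) (by norm_num)
    nlinarith
  · refine (norm_add_le _ _).trans ?_
    have a1 := norm_sub_le (arcE2 σ : ℂ) (3 / 2 * (arcE σ : ℂ) * (arcE1 σ : ℂ) * τ⁻¹)
    have a2 : ‖3 / 2 * (arcE σ : ℂ) * (arcE1 σ : ℂ) * τ⁻¹‖ ≤ 12 * C := by
      rw [norm_mul, norm_mul, norm_mul]
      have : ‖(3 / 2 : ℂ)‖ = 3 / 2 := by norm_num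
      rw [this]
      refine mul_le_mul ?_ hi (norm_nonneg _) (by norm_num)
      nlinarith [norm_nonneg (arcE σ : ℂ), norm_nonneg (arcE1 σ : ℂ)]
    have a3 : ‖(arcE σ : ℂ) ^ 3 / 4 * (τ⁻¹) ^ 2‖ ≤ 2 * C ^ 2 := by
      rw [norm_mul, norm_div, norm_pow, norm_pow, Complex.norm_ofNat]
      exact mul_le_mul (by linarith) hi2 (sq_nonneg _) (by norm_num)
    linarith
  · rw [heatQ]
    have : ‖((arcF σ / 4 : ℝ) : ℂ) * τ⁻¹ ^ 2 * ((arcE σ : ℂ) * gauss τ σ)‖ ≤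
        (1 + σ) ^ 2 * C ^ 2 * (2 * (C / (1 + σ) ^ (N + 2))) := by
      rw [norm_mul, norm_mul, norm_mul, norm_pow]
      exact mul_le_mul (mul_le_mul hF hi2 (sq_nonneg _) (sq_nonneg _))
        (mul_le_mul hE0 hg (norm_nonneg _) (by norm_num)) (by positivity) (by positivity)
    refine this.trans ?_
    calc _ = 2 * C ^ 2 * (C / (1 + σ) ^ (N + 2) * (1 + σ) ^ 2) := by ring
      _ = 2 * C ^ 2 * C / (1 + σ) ^ N := by rw [hsN]; ring
      _ ≤ _ := by gcongr; nlinarith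

/-! ### Descent integrals `∫ g (ρ + x ^ 2) dx`. -/

lemma continuous_comp_add_sq {g : ℝ → ℂ} (hg : ContinuousOn g (Set.Ioi 0)) {ρ : ℝ} (hρ : 0 < ρ) :
    Continuous fun x : ℝ => g (ρ + x ^ 2) :=
  hg.comp_continuous (by fun_prop) fun x => by
    have : 0 < ρ + x ^ 2 := by positivity
    exact this

lemma div_add_sq_pow_le {C ρ : ℝ} (hC : 0 ≤ C) (hρ : 0 < ρ) (N : ℕ) (x : ℝ) :
    C / (1 + (ρ + x ^ 2)) ^ (N + 1) ≤ C / (1 + ρ) ^ N * (1 + x ^ 2)⁻¹ := by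
  rw [← div_eq_mul_inv, div_div, pow_succ]
  gcongr <;> nlinarith

lemma integrable_comp_add_sq {g : ℝ → ℂ} (hg : ContinuousOn g (Set.Ioi 0)) {C : ℝ} (hC : 0 ≤ C)
    {N : ℕ} (hb : ∀ σ, 0 < σ → ‖g σ‖ ≤ C / (1 + σ) ^ (N + 1)) {ρ : ℝ} (hρ : 0 < ρ) :
    Integrable (fun x : ℝ => g (ρ + x ^ 2)) ∧
      ‖∫ x : ℝ, g (ρ + x ^ 2)‖ ≤ C * Real.pi / (1 + ρ) ^ N := by
  have hle : ∀ x : ℝ, ‖g (ρ + x ^ 2)‖ ≤ C / (1 + ρ) ^ N * (1 + x ^ 2)⁻¹ := fun x =>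
    (hb _ (by positivity)).trans (div_add_sq_pow_le hC hρ N x)
  have hi : Integrable fun x : ℝ => C / (1 + ρ) ^ N * (1 + x ^ 2)⁻¹ :=
    integrable_inv_one_add_sq.const_mul _
  refine ⟨hi.mono' (continuous_comp_add_sq hg hρ).aestronglyMeasurable (Eventually.of_forall hle),
    ?_⟩
  refine (norm_integral_le_of_norm_le hi (Eventually.of_forall hle)).trans_eq ?_
  rw [integral_const_mul, integral_univ_inv_one_add_sq]
  ring

lemma hasDerivAt_integral_comp_add_sq {g g' : ℝ → ℂ} (hg : ∀ σ, 0 < σ → HasDerivAt g (g' σ) σ)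
    (hg' : ContinuousOn g' (Set.Ioi 0)) {C : ℝ} (hC : 0 ≤ C)
    (hb : ∀ σ, 0 < σ → ‖g σ‖ ≤ C / (1 + σ) ^ (0 + 1))
    (hb' : ∀ σ, 0 < σ → ‖g' σ‖ ≤ C / (1 + σ) ^ (0 + 1)) {ρ : ℝ} (hρ : 0 < ρ) :
    HasDerivAt (fun ρ => ∫ x : ℝ, g (ρ + x ^ 2)) (∫ x : ℝ, g' (ρ + x ^ 2)) ρ := by
  have hgc : ContinuousOn g (Set.Ioi 0) := fun σ hσ => (hg σ hσ).continuousAt.continuousWithinAt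
  refine (hasDerivAt_integral_of_dominated_loc_of_deriv_le
    (F := fun ρ x => g (ρ + x ^ 2)) (F' := fun ρ x => g' (ρ + x ^ 2))
    (bound := fun x => C * (1 + x ^ 2)⁻¹) (Ioi_mem_nhds hρ) ?_
    (integrable_comp_add_sq hgc hC hb hρ).1 (continuous_comp_add_sq hg' hρ).aestronglyMeasurable
    ?_ (integrable_inv_one_add_sq.const_mul _) ?_).2
  · filter_upwards [Ioi_mem_nhds hρ] with r hr
    exact (continuous_comp_add_sq hgc hr).aestronglyMeasurable
  · refine Eventually.of_forall fun x r hr => ?_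
    have hr : 0 < r := hr
    refine (hb' _ (by positivity)).trans ((div_add_sq_pow_le hC hr 0 x).trans_eq ?_)
    simp
  · refine Eventually.of_forall fun x r hr => ?_
    have hr : 0 < r := hr
    exact (hg (r + x ^ 2) (by positivity)).comp_add_const r (x ^ 2)

lemma continuousOn_integral_comp_add_sq {g : ℝ → ℂ} (hg : ContinuousOn g (Set.Ioi 0)) {C : ℝ}
    (hC : 0 ≤ C) (hb : ∀ σ, 0 < σ → ‖g σ‖ ≤ C / (1 + σ) ^ (0 + 1)) :
    ContinuousOn (fun ρ => ∫ x : ℝ, g (ρ + x ^ 2)) (Set.Ioi 0) := by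
  refine continuousOn_of_dominated (bound := fun x => C * (1 + x ^ 2)⁻¹) (fun r hr =>
    (continuous_comp_add_sq hg hr).aestronglyMeasurable) (fun r hr => ?_)
    (integrable_inv_one_add_sq.const_mul _) (Eventually.of_forall fun x => ?_)
  · have hr : 0 < r := hr
    refine Eventually.of_forall fun x =>
      (hb _ (by positivity)).trans ((div_add_sq_pow_le hC hr 0 x).trans_eq ?_)
    simp
  · refine hg.comp (by fun_prop) fun r hr => ?_
    have hr : 0 < r := hr
    have : 0 < r + x ^ 2 := by positivity
    exact this

/-! ### The heat kernel of the hyperbolic plane at complex time. -/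

/-- The time dependent factor of the heat kernel of the hyperbolic plane. -/
noncomputable def heatC (τ : ℂ) : ℂ :=
  ((4 * √2 * Real.pi ^ (3 / 2 : ℝ) : ℝ) : ℂ)⁻¹ * (τ ^ (-(3 / 2 : ℝ) : ℂ) * Complex.exp (-τ / 4))

/-- The kernel of `exp (τ Δ)` on the hyperbolic plane, as a function of `ρ = cosh d`. -/
noncomputable def heatK (τ : ℂ) (ρ : ℝ) : ℂ := heatC τ * ∫ x : ℝ, heatQ τ (ρ + x ^ 2)

/-- The first derivative of `heatK τ`. -/
noncomputable def heatK1 (τ : ℂ) (ρ : ℝ) : ℂ := heatC τ * ∫ x : ℝ, heatQ1 τ (ρ + x ^ 2)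

/-- The second derivative of `heatK τ`. -/
noncomputable def heatK2 (τ : ℂ) (ρ : ℝ) : ℂ := heatC τ * ∫ x : ℝ, heatQ2 τ (ρ + x ^ 2)

/-- The Laplacian of `heatK τ`. -/
noncomputable def heatL (τ : ℂ) (ρ : ℝ) : ℂ :=
  ((ρ : ℂ) ^ 2 - 1) * heatK2 τ ρ + 2 * ρ * heatK1 τ ρ

lemma heatQ_bound_self {τ : ℂ} (h : 0 < τ.re) (N : ℕ) : ∃ C : ℝ, 0 ≤ C ∧ ∀ σ : ℝ, 0 < σ →
    ‖heatQ τ σ‖ ≤ C / (1 + σ) ^ N ∧ ‖heatQ1 τ σ‖ ≤ C / (1 + σ) ^ N ∧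
      ‖heatQ2 τ σ‖ ≤ C / (1 + σ) ^ N ∧
      ‖((arcF σ / 4 : ℝ) : ℂ) * (τ⁻¹) ^ 2 * heatQ τ σ‖ ≤ C / (1 + σ) ^ N := by
  obtain ⟨C, hC, hb⟩ := heatQ_bound h N
  exact ⟨C, hC.le, hb.self_of_nhds.2⟩

lemma hasDerivAt_heatK {τ : ℂ} (h : 0 < τ.re) {ρ : ℝ} (hρ : 0 < ρ) :
    HasDerivAt (heatK τ) (heatK1 τ ρ) ρ := by
  obtain ⟨C, hC, hb⟩ := heatQ_bound_self h 1
  exact (hasDerivAt_integral_comp_add_sq (fun σ => hasDerivAt_heatQ τ) (continuousOn_heatQ1 τ) hC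
    (fun σ hσ => (hb σ hσ).1) (fun σ hσ => (hb σ hσ).2.1) hρ).const_mul _

lemma hasDerivAt_heatK1 {τ : ℂ} (h : 0 < τ.re) {ρ : ℝ} (hρ : 0 < ρ) :
    HasDerivAt (heatK1 τ) (heatK2 τ ρ) ρ := by
  obtain ⟨C, hC, hb⟩ := heatQ_bound_self h 1
  exact (hasDerivAt_integral_comp_add_sq (fun σ => hasDerivAt_heatQ1 τ) (continuousOn_heatQ2 τ) hC
    (fun σ hσ => (hb σ hσ).2.1) (fun σ hσ => (hb σ hσ).2.2.1) hρ).const_mul _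

lemma continuousOn_heatK2 {τ : ℂ} (h : 0 < τ.re) : ContinuousOn (heatK2 τ) (Set.Ioi 0) := by
  obtain ⟨C, hC, hb⟩ := heatQ_bound_self h 1
  exact continuousOn_const.mul (continuousOn_integral_comp_add_sq (continuousOn_heatQ2 τ) hC
    (fun σ hσ => (hb σ hσ).2.2.1))

lemma continuousOn_heatK {τ : ℂ} (h : 0 < τ.re) : ContinuousOn (heatK τ) (Set.Ioi 0) :=
  fun _ hσ => (hasDerivAt_heatK h hσ).continuousAt.continuousWithinAt

lemma continuousOn_heatK1 {τ : ℂ} (h : 0 < τ.re) : ContinuousOn (heatK1 τ) (Set.Ioi 0) :=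
  fun _ hσ => (hasDerivAt_heatK1 h hσ).continuousAt.continuousWithinAt

lemma continuousOn_heatL {τ : ℂ} (h : 0 < τ.re) : ContinuousOn (heatL τ) (Set.Ioi 0) := by
  have h1 := continuousOn_heatK1 h
  have h2 := continuousOn_heatK2 h
  have h3 : Continuous fun ρ : ℝ => (ρ : ℂ) := Complex.continuous_ofReal
  unfold heatL
  fun_prop

lemma hasDerivAt_heatC {τ : ℂ} (h : 0 < τ.re) :
    HasDerivAt heatC ((-3 / 2 * τ⁻¹ - 1 / 4) * heatC τ) τ := by
  have hne : τ ≠ 0 := fun h' => by simp [h'] at h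
  have h1 : HasDerivAt (fun τ : ℂ => τ ^ (-(3 / 2 : ℝ) : ℂ))
      ((-(3 / 2 : ℝ) : ℂ) * τ ^ ((-(3 / 2 : ℝ) : ℂ) - 1) * 1) τ :=
    (hasDerivAt_id τ).cpow_const (Or.inl h)
  have h2 : HasDerivAt (fun τ : ℂ => Complex.exp (-τ / 4)) (Complex.exp (-τ / 4) * (-1 / 4)) τ :=
    ((hasDerivAt_id τ).neg.div_const 4).cexp
  refine ((h1.mul h2).const_mul _).congr_deriv ?_
  rw [heatC, Complex.cpow_sub _ _ hne, Complex.cpow_one]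
  push_cast
  field_simp
  ring

/-- The integrand is the `x`-derivative of `(2 ρ x + x ^ 3) / 2 * Q' + 3 / 4 * x * Q` evaluated at
`ρ + x ^ 2`. It is the difference between the operator `(σ ^ 2 - 1) Q'' + 3 σ Q' + 3 / 4 * Q` at `σ
= ρ + x ^ 2` and `(ρ ^ 2 - 1) Q'' + 2 ρ Q'`, so the descent turns the equation in dimension three
into the one in dimension two. -/
lemma integral_heat_defect {τ : ℂ} (h : 0 < τ.re) {ρ : ℝ} (hρ : 0 < ρ) :
    ∫ x : ℝ, ((2 * ρ * x ^ 2 + x ^ 4) * heatQ2 τ (ρ + x ^ 2)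
      + (ρ + 3 * x ^ 2) * heatQ1 τ (ρ + x ^ 2) + 3 / 4 * heatQ τ (ρ + x ^ 2) : ℂ) = 0 := by
  -- The polynomial coefficients are `O((1 + ρ + x ^ 2) ^ 2)`, so cubic decay leaves an integrable
  -- `(1 + x ^ 2)⁻¹`.
  obtain ⟨C, hC, hb⟩ := heatQ_bound_self h 3
  have hd : ∀ x : ℝ, HasDerivAt (fun x : ℝ => (((2 * ρ * x + x ^ 3) / 2 : ℝ) : ℂ)
      * heatQ1 τ (ρ + x ^ 2) + ((3 / 4 * x : ℝ) : ℂ) * heatQ τ (ρ + x ^ 2))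
      ((2 * ρ * x ^ 2 + x ^ 4) * heatQ2 τ (ρ + x ^ 2)
      + (ρ + 3 * x ^ 2) * heatQ1 τ (ρ + x ^ 2) + 3 / 4 * heatQ τ (ρ + x ^ 2) : ℂ) x := by
    intro x
    have hx : 0 < ρ + x ^ 2 := by positivity
    have hs : HasDerivAt (fun x : ℝ => ρ + x ^ 2) (2 * x) x := by
      simpa using (hasDerivAt_pow 2 x).const_add ρ
    have h1 := (hasDerivAt_heatQ τ hx).scomp x hs
    have h2 := (hasDerivAt_heatQ1 τ hx).scomp x hs
    have p1 : HasDerivAt (fun x : ℝ => (2 * ρ * x + x ^ 3) / 2) ((2 * ρ + 3 * x ^ 2) / 2) x := by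
      simpa using ((((hasDerivAt_id x).const_mul (2 * ρ)).fun_add (hasDerivAt_pow 3 x)).div_const 2)
    have p2 : HasDerivAt (fun x : ℝ => 3 / 4 * x) (3 / 4) x := by
      simpa using (hasDerivAt_id x).const_mul (3 / 4 : ℝ)
    refine ((p1.ofReal_comp.mul h2).add (p2.ofReal_comp.mul h1)).congr_deriv ?_
    simp only [Function.comp, Complex.real_smul]
    push_cast
    ring
  have hbd : ∀ (g : ℝ → ℂ) (p : ℝ → ℂ), ContinuousOn g (Set.Ioi 0) → Continuous p →
      (∀ σ, 0 < σ → ‖g σ‖ ≤ C / (1 + σ) ^ 3) → (∀ x : ℝ, ‖p x‖ ≤ 3 * (1 + (ρ + x ^ 2)) ^ 2) →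
      Integrable fun x : ℝ => p x * g (ρ + x ^ 2) := by
    intro g p hg hp hgb hpb
    refine (integrable_inv_one_add_sq.const_mul (3 * C)).mono'
      (hp.mul (continuous_comp_add_sq hg hρ)).aestronglyMeasurable (Eventually.of_forall fun x => ?_)
    have hx : 0 < ρ + x ^ 2 := by positivity
    rw [norm_mul]
    calc _ ≤ 3 * (1 + (ρ + x ^ 2)) ^ 2 * (C / (1 + (ρ + x ^ 2)) ^ 3) :=
          mul_le_mul (hpb x) (hgb _ hx) (norm_nonneg _) (by positivity)
      _ = 3 * C * (1 + (ρ + x ^ 2))⁻¹ := by field_simp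
      _ ≤ _ := by gcongr; nlinarith
  have hn : ∀ (r : ℝ) (z : ℂ), z = (r : ℂ) → ‖z‖ = |r| := fun r z hz => by
    rw [hz, Complex.norm_real, Real.norm_eq_abs]
  refine integral_eq_zero_of_hasDerivAt_of_integrable hd ?_ ?_
  · refine ((hbd _ (fun x : ℝ => ((2 * ρ * x ^ 2 + x ^ 4 : ℝ) : ℂ)) (continuousOn_heatQ2 τ)
      (by fun_prop) (fun σ hσ => (hb σ hσ).2.2.1) fun x => ?_).add
      (hbd _ (fun x : ℝ => ((ρ + 3 * x ^ 2 : ℝ) : ℂ)) (continuousOn_heatQ1 τ) (by fun_prop)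
        (fun σ hσ => (hb σ hσ).2.1) fun x => ?_)).add
      (hbd _ (fun x : ℝ => ((3 / 4 : ℝ) : ℂ)) (continuousOn_heatQ τ) (by fun_prop)
        (fun σ hσ => (hb σ hσ).1) fun x => ?_) |>.congr (Eventually.of_forall fun x => ?_)
    · rw [hn _ _ rfl, abs_of_nonneg (by positivity)]
      nlinarith [mul_nonneg hρ.le (sq_nonneg x), sq_nonneg (x ^ 2), sq_nonneg x]
    · rw [hn _ _ rfl, abs_of_nonneg (by positivity)]
      nlinarith [mul_nonneg hρ.le (sq_nonneg x), sq_nonneg (x ^ 2), sq_nonneg x]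
    · rw [hn _ _ rfl, abs_of_nonneg (by positivity)]
      nlinarith [mul_nonneg hρ.le (sq_nonneg x), sq_nonneg (x ^ 2), sq_nonneg x]
    · simp only [Pi.add_apply]
      push_cast
      ring
  · refine (hbd _ (fun x : ℝ => (((2 * ρ * x + x ^ 3) / 2 : ℝ) : ℂ)) (continuousOn_heatQ1 τ)
      (by fun_prop) (fun σ hσ => (hb σ hσ).2.1) fun x => ?_).add
      (hbd _ (fun x : ℝ => ((3 / 4 * x : ℝ) : ℂ)) (continuousOn_heatQ τ) (by fun_prop)
        (fun σ hσ => (hb σ hσ).1) fun x => ?_)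
    · rw [hn _ _ rfl, abs_le]
      constructor <;> nlinarith [mul_nonneg hρ.le (sq_nonneg (x - 1)), sq_nonneg (x ^ 2 - x),
        mul_nonneg hρ.le (sq_nonneg (x + 1)), sq_nonneg (x ^ 2 + x), sq_nonneg x, sq_nonneg (x ^ 2),
        mul_nonneg hρ.le (sq_nonneg x)]
    · rw [hn _ _ rfl, abs_le]
      constructor <;> nlinarith [mul_nonneg hρ.le (sq_nonneg x), sq_nonneg (x - 1),
        sq_nonneg (x + 1), sq_nonneg (x ^ 2)]

/-- `heatK` solves the heat equation, for complex times. -/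
lemma hasDerivAt_heatK_time {τ : ℂ} (h : 0 < τ.re) {ρ : ℝ} (hρ : 0 < ρ) :
    HasDerivAt (fun τ => heatK τ ρ) (heatL τ ρ) τ := by
  obtain ⟨C, hC, hb⟩ := heatQ_bound h 1
  obtain ⟨s, hs, hbs⟩ := hb.exists_mem
  have hself := hb.self_of_nhds
  have hint : ∀ (g : ℝ → ℂ), ContinuousOn g (Set.Ioi 0) →
      (∀ σ, 0 < σ → ‖g σ‖ ≤ C / (1 + σ) ^ 1) → Integrable fun x : ℝ => g (ρ + x ^ 2) :=
    fun g hg hgb => (integrable_comp_add_sq hg hC.le (N := 0) hgb hρ).1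
  have hFc : ContinuousOn (fun σ => ((arcF σ / 4 : ℝ) : ℂ) * (τ⁻¹) ^ 2 * heatQ τ σ)
      (Set.Ioi 0) := by
    have h1 : ContinuousOn (fun σ => ((arcF σ / 4 : ℝ) : ℂ)) (Set.Ioi 0) := fun _ h =>
      ((hasDerivAt_arcF h).div_const 4).ofReal_comp.continuousAt.continuousWithinAt
    have h2 := continuousOn_heatQ τ
    fun_prop
  have iF := hint _ hFc (fun σ hσ => (hself.2 σ hσ).2.2.2)
  have i0 := hint _ (continuousOn_heatQ τ) (fun σ hσ => (hself.2 σ hσ).1)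
  have i1 := hint _ (continuousOn_heatQ1 τ) (fun σ hσ => (hself.2 σ hσ).2.1)
  have i2 := hint _ (continuousOn_heatQ2 τ) (fun σ hσ => (hself.2 σ hσ).2.2.1)
  have hd := (hasDerivAt_integral_of_dominated_loc_of_deriv_le
    (F := fun τ x => heatQ τ (ρ + x ^ 2))
    (F' := fun τ (x : ℝ) => ((arcF (ρ + x ^ 2) / 4 : ℝ) : ℂ) * (τ⁻¹) ^ 2 * heatQ τ (ρ + x ^ 2))
    (bound := fun x => C * (1 + x ^ 2)⁻¹) hs
    (Eventually.of_forall fun τ' =>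
      (continuous_comp_add_sq (continuousOn_heatQ τ') hρ).aestronglyMeasurable)
    i0 iF.aestronglyMeasurable
    ?_ (integrable_inv_one_add_sq.const_mul _) ?_).2
  · refine ((hasDerivAt_heatC h).mul hd).congr_deriv ?_
    -- `heatQ_identity`, regrouped: the first term cancels the derivative of `heatC`, the second is
    -- the Laplacian in `ρ`, and the third integrates to zero by `integral_heat_defect`.
    have e1 : ∀ x : ℝ, ((arcF (ρ + x ^ 2) / 4 : ℝ) : ℂ) * (τ⁻¹) ^ 2 * heatQ τ (ρ + x ^ 2) =
        (3 / 2 * τ⁻¹ + 1 / 4) * heatQ τ (ρ + x ^ 2) + (((ρ : ℂ) ^ 2 - 1) * heatQ2 τ (ρ + x ^ 2)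
        + 2 * ρ * heatQ1 τ (ρ + x ^ 2)) + ((2 * ρ * x ^ 2 + x ^ 4) * heatQ2 τ (ρ + x ^ 2)
      + (ρ + 3 * x ^ 2) * heatQ1 τ (ρ + x ^ 2) + 3 / 4 * heatQ τ (ρ + x ^ 2) : ℂ) := by
      intro x
      have := heatQ_identity τ (show 0 < ρ + x ^ 2 by positivity)
      push_cast at this ⊢
      linear_combination this
    have j1 := i0.const_mul (3 / 2 * τ⁻¹ + 1 / 4)
    have j2 := i2.const_mul ((ρ : ℂ) ^ 2 - 1)
    have j3 := i1.const_mul (2 * ρ : ℂ)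
    have j23 : Integrable fun x : ℝ =>
        ((ρ : ℂ) ^ 2 - 1) * heatQ2 τ (ρ + x ^ 2) + 2 * ρ * heatQ1 τ (ρ + x ^ 2) := j2.add j3
    have j4 : Integrable fun x : ℝ => (3 / 2 * τ⁻¹ + 1 / 4) * heatQ τ (ρ + x ^ 2)
        + (((ρ : ℂ) ^ 2 - 1) * heatQ2 τ (ρ + x ^ 2) + 2 * ρ * heatQ1 τ (ρ + x ^ 2)) := j1.add j23
    have e2 : ∫ x : ℝ, ((arcF (ρ + x ^ 2) / 4 : ℝ) : ℂ) * (τ⁻¹) ^ 2 * heatQ τ (ρ + x ^ 2) =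
        (3 / 2 * τ⁻¹ + 1 / 4) * (∫ x : ℝ, heatQ τ (ρ + x ^ 2))
        + (((ρ : ℂ) ^ 2 - 1) * (∫ x : ℝ, heatQ2 τ (ρ + x ^ 2))
        + 2 * ρ * (∫ x : ℝ, heatQ1 τ (ρ + x ^ 2))) := by
      have j5 : Integrable fun x : ℝ => ((2 * ρ * x ^ 2 + x ^ 4) * heatQ2 τ (ρ + x ^ 2)
          + (ρ + 3 * x ^ 2) * heatQ1 τ (ρ + x ^ 2) + 3 / 4 * heatQ τ (ρ + x ^ 2) : ℂ) := by
        refine (iF.sub j4).congr (Eventually.of_forall fun x => ?_)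
        simp only [Pi.sub_apply, e1 x]
        ring
      simp_rw [e1]
      rw [integral_add j4 j5, integral_heat_defect h hρ, add_zero, integral_add j1 j23,
        integral_add j2 j3]
      simp only [integral_const_mul]
    rw [e2, heatL, heatK1, heatK2]
    ring
  · refine Eventually.of_forall fun x t ht => ?_
    refine (((hbs t ht).2 _ (by positivity)).2.2.2).trans ?_
    simpa using div_add_sq_pow_le hC.le hρ 0 x
  · refine Eventually.of_forall fun x t ht => ?_
    have htne : t ≠ 0 := fun h0 => by simpa [h0] using (hbs t ht).1
    have := ((hasDerivAt_inv htne).const_mul ((-arcF (ρ + x ^ 2) / 4 : ℝ) : ℂ)).cexp.const_mul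
      (arcE (ρ + x ^ 2) : ℂ)
    refine this.congr_deriv ?_
    rw [heatQ, gauss]
    push_cast
    field_simp

/-- Uniformity for `τ` near `τ₀` is the point: combined with holomorphy in `τ` it lets Cauchy
estimates control time derivatives with the same decay in `ρ`. -/
lemma heatK_bound {τ₀ : ℂ} (h : 0 < τ₀.re) (N : ℕ) : ∃ C : ℝ, 0 < C ∧ ∀ᶠ τ in 𝓝 τ₀, 0 < τ.re ∧
    ∀ ρ : ℝ, 1 ≤ ρ → ‖heatK τ ρ‖ ≤ C / ρ ^ N := by
  obtain ⟨C, hC, hb⟩ := heatQ_bound h (N + 1)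
  have hcont : ContinuousAt heatC τ₀ := (hasDerivAt_heatC h).continuousAt
  have e1 : ∀ᶠ τ in 𝓝 τ₀, ‖heatC τ‖ < ‖heatC τ₀‖ + 1 := hcont.norm.eventually_lt_const (by simp)
  refine ⟨(‖heatC τ₀‖ + 1) * (C * Real.pi), by positivity, ?_⟩
  filter_upwards [hb, e1] with τ h1 h2
  refine ⟨h1.1, fun ρ hρ => ?_⟩
  have := (integrable_comp_add_sq (continuousOn_heatQ τ) hC.le (fun σ hσ => (h1.2 σ hσ).1)
    (show 0 < ρ by linarith)).2
  rw [heatK, norm_mul, mul_div_assoc]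
  refine mul_le_mul h2.le (this.trans ?_) (norm_nonneg _) (by positivity)
  gcongr
  linarith

/-! ### Bounds and continuity up to purely imaginary times. -/

lemma norm_gauss (τ : ℂ) (σ : ℝ) : ‖gauss τ σ‖ = Real.exp (-arcF σ / 4 * (τ⁻¹).re) := by
  rw [gauss, Complex.norm_exp, Complex.re_ofReal_mul]

lemma norm_gauss_le_one {τ : ℂ} (h : 0 ≤ τ.re) {σ : ℝ} (hσ : 1 ≤ σ) : ‖gauss τ σ‖ ≤ 1 := by
  have h1 : 0 ≤ (τ⁻¹).re := by
    rw [Complex.inv_re]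
    exact div_nonneg h (Complex.normSq_nonneg _)
  rw [norm_gauss, Real.exp_le_one_iff]
  nlinarith [mul_nonneg (arcF_nonneg hσ) h1]

lemma norm_heatQ_le {τ : ℂ} (h : 0 ≤ τ.re) {σ : ℝ} (hσ : 1 ≤ σ) : ‖heatQ τ σ‖ ≤ arcE σ := by
  have hE := arcE_nonneg (show 0 ≤ σ by linarith)
  rw [heatQ, norm_mul, Complex.norm_real, Real.norm_of_nonneg hE]
  exact mul_le_of_le_one_right hE (norm_gauss_le_one h hσ)

lemma heat_const_pos : 1 ≤ 4 * √2 * Real.pi ^ (3 / 2 : ℝ) := by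
  have h1 : 1 ≤ √2 := by rw [Real.one_le_sqrt]; norm_num
  have h2 : 1 ≤ Real.pi ^ (3 / 2 : ℝ) :=
    Real.one_le_rpow (by linarith [Real.pi_gt_three]) (by norm_num)
  nlinarith

lemma norm_heatC_le {τ : ℂ} (h : 0 ≤ τ.re) (h0 : τ ≠ 0) : ‖heatC τ‖ ≤ ‖τ‖ ^ (-(3 / 2) : ℝ) := by
  have hc := heat_const_pos
  rw [heatC, norm_mul, norm_mul, norm_inv, Complex.norm_real, Real.norm_of_nonneg (by linarith),
    Complex.norm_exp]
  have h1 : ‖τ ^ (-(3 / 2 : ℝ) : ℂ)‖ = ‖τ‖ ^ (-(3 / 2) : ℝ) := by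
    rw [← Complex.ofReal_neg, Complex.norm_cpow_real]
  have h2 : Real.exp (-τ / 4).re ≤ 1 := by
    rw [Real.exp_le_one_iff]
    simp
    linarith
  rw [h1]
  calc _ ≤ 1 * (‖τ‖ ^ (-(3 / 2) : ℝ) * 1) := by
        gcongr
        exact inv_le_one_of_one_le₀ hc
    _ = _ := by ring

/-- The decay exponent `(3 + δ) / 4 < 1` is split as `δ / 2 + (3 - δ) / 4`. The first part is spent
on `ρ`; the second on `1 + x ^ 2`, where it is integrable because `(3 - δ) / 2 > 1`. -/
lemma arcE_add_sq_le {δ : ℝ} (h0 : 0 < δ) (h1 : δ < 1) : ∃ C, 0 < C ∧ ∀ ρ x : ℝ, 1 ≤ ρ →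
    arcE (ρ + x ^ 2) ≤ C * (ρ ^ (-(δ / 2)) * (1 + ‖x‖ ^ 2) ^ (-((3 - δ) / 2) / 2)) := by
  obtain ⟨C, hC, hb⟩ := arcE_le_rpow (θ := (3 + δ) / 4) (by linarith) (by linarith)
  refine ⟨C, hC, fun ρ x hρ => (hb _ (by nlinarith)).trans ?_⟩
  have h2 : 0 < ρ + x ^ 2 := by nlinarith
  rw [show -((3 + δ) / 4) = -(δ / 2) + -((3 - δ) / 2) / 2 by ring, Real.rpow_add h2]
  gcongr ?_ * (?_ * ?_)
  · exact Real.rpow_le_rpow_of_nonpos (by linarith) (by nlinarith) (by linarith)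
  · refine Real.rpow_le_rpow_of_nonpos (by positivity) ?_ (by linarith)
    rw [Real.norm_eq_abs, sq_abs]
    linarith

lemma integrable_add_sq_bound {δ : ℝ} (h1 : δ < 1) :
    Integrable fun x : ℝ => (1 + ‖x‖ ^ 2) ^ (-((3 - δ) / 2) / 2) :=
  integrable_rpow_neg_one_add_norm_sq (by simp; linarith)

/-- The dispersive bound on the kernel. -/
lemma heatK_dispersive {δ : ℝ} (h0 : 0 < δ) (h1 : δ < 1) : ∃ C, 0 < C ∧ ∀ τ : ℂ, 0 ≤ τ.re → τ ≠ 0 →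
    ∀ ρ : ℝ, 1 ≤ ρ → ‖heatK τ ρ‖ ≤ C * ‖τ‖ ^ (-(3 / 2) : ℝ) * ρ ^ (-(δ / 2)) := by
  obtain ⟨C, hC, hb⟩ := arcE_add_sq_le h0 h1
  refine ⟨C * ((∫ x : ℝ, (1 + ‖x‖ ^ 2) ^ (-((3 - δ) / 2) / 2)) + 1), ?_, fun τ h hne ρ hρ => ?_⟩
  · have : 0 ≤ ∫ x : ℝ, (1 + ‖x‖ ^ 2) ^ (-((3 - δ) / 2) / 2) :=
      integral_nonneg fun x => by positivity
    positivity
  have h2 : ‖∫ x : ℝ, heatQ τ (ρ + x ^ 2)‖ ≤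
      ∫ x : ℝ, C * (ρ ^ (-(δ / 2)) * (1 + ‖x‖ ^ 2) ^ (-((3 - δ) / 2) / 2)) :=
    norm_integral_le_of_norm_le (((integrable_add_sq_bound h1).const_mul _).const_mul _)
      (Eventually.of_forall fun x => (norm_heatQ_le h (by nlinarith)).trans (hb ρ x hρ))
  rw [integral_const_mul, integral_const_mul] at h2
  rw [heatK, norm_mul]
  have h3 : 0 ≤ ρ ^ (-(δ / 2)) := by positivity
  calc _ ≤ ‖τ‖ ^ (-(3 / 2) : ℝ) *
        (C * (ρ ^ (-(δ / 2)) * ∫ x : ℝ, (1 + ‖x‖ ^ 2) ^ (-((3 - δ) / 2) / 2))) := by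
        gcongr
        exact norm_heatC_le h hne
    _ ≤ ‖τ‖ ^ (-(3 / 2) : ℝ) *
        (C * (ρ ^ (-(δ / 2)) * ((∫ x : ℝ, (1 + ‖x‖ ^ 2) ^ (-((3 - δ) / 2) / 2)) + 1))) := by
        gcongr
        linarith
    _ = _ := by ring

/-- `heatK τ` is continuous, also for purely imaginary times. -/
lemma continuousOn_heatK_Ici {τ : ℂ} (h : 0 ≤ τ.re) : ContinuousOn (heatK τ) (Set.Ici 1) := by
  obtain ⟨C, hC, hb⟩ := arcE_add_sq_le (δ := 1 / 2) (by norm_num) (by norm_num)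
  refine continuousOn_const.mul (continuousOn_of_dominated
    (bound := fun x => C * (1 + ‖x‖ ^ 2) ^ (-((3 - 1 / 2) / 2) / 2 : ℝ))
    (fun r hr => ?_) (fun r hr => ?_)
    ((integrable_add_sq_bound (by norm_num)).const_mul _) (Eventually.of_forall fun x => ?_))
  · have hr : 1 ≤ r := hr
    exact (continuous_comp_add_sq (continuousOn_heatQ τ) (by linarith)).aestronglyMeasurable
  · have hr : 1 ≤ r := hr
    refine Eventually.of_forall fun x => (norm_heatQ_le h (by nlinarith)).trans
      ((hb r x hr).trans ?_)
    gcongr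
    exact mul_le_of_le_one_left (by positivity) (Real.rpow_le_one_of_one_le_of_nonpos hr (by norm_num))
  · refine (continuousOn_heatQ τ).comp (by fun_prop) fun r hr => ?_
    have hr : 1 ≤ r := hr
    have : 0 < r + x ^ 2 := by positivity
    exact this

/-- `heatK τ ρ` is continuous in the time `τ`, up to purely imaginary times. -/
lemma continuousWithinAt_heatK {τ : ℂ} (h : 0 ≤ τ.re) (h0 : τ ≠ 0) {ρ : ℝ} (hρ : 1 ≤ ρ) :
    ContinuousWithinAt (fun τ => heatK τ ρ) {τ | 0 ≤ τ.re} τ := by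
  obtain ⟨C, hC, hb⟩ := arcE_add_sq_le (δ := 1 / 2) (by norm_num) (by norm_num)
  -- A nonzero point of the closed right half-plane is off the branch cut of the complex power.
  have hslit : τ ∈ Complex.slitPlane := by
    rw [Complex.mem_slitPlane_iff]
    by_contra hcon
    push Not at hcon
    exact h0 (Complex.ext (le_antisymm hcon.1 h) hcon.2)
  refine ContinuousWithinAt.mul ?_ ?_
  · refine ContinuousAt.continuousWithinAt ?_
    unfold heatC
    have : ContinuousAt (fun τ : ℂ => τ ^ (-(3 / 2 : ℝ) : ℂ)) τ :=
      continuousAt_id.cpow continuousAt_const hslit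
    fun_prop
  · refine continuousWithinAt_of_dominated
      (bound := fun x => C * (1 + ‖x‖ ^ 2) ^ (-((3 - 1 / 2) / 2) / 2 : ℝ)) ?_ ?_
      ((integrable_add_sq_bound (by norm_num)).const_mul _) (Eventually.of_forall fun x => ?_)
    · exact Eventually.of_forall fun t =>
        (continuous_comp_add_sq (continuousOn_heatQ t) (by linarith)).aestronglyMeasurable
    · filter_upwards [self_mem_nhdsWithin] with t ht
      refine Eventually.of_forall fun x => (norm_heatQ_le ht (by nlinarith)).trans
        ((hb ρ x hρ).trans ?_)
      gcongr
      exact mul_le_of_le_one_left (by positivity)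
        (Real.rpow_le_one_of_one_le_of_nonpos hρ (by norm_num))
    · refine ContinuousAt.continuousWithinAt ?_
      unfold heatQ gauss
      have : ContinuousAt (fun τ : ℂ => τ⁻¹) τ := continuousAt_inv₀ h0
      fun_prop

/-! ### The heat kernel at real times, and its concentration. -/

/-- The heat kernel at real times is concentrated near `ρ = 1`. -/
lemma heatK_tail {η : ℝ} (hη : 0 < η) : ∃ ε : ℝ → ℝ, Tendsto ε (𝓝[>] 0) (𝓝 0) ∧
    ∀ a : ℝ, 0 < a → a ≤ 1 → 0 ≤ ε a ∧ ∀ ρ : ℝ, 1 + η ≤ ρ → ‖heatK a ρ‖ ≤ ε a / ρ ^ 2 := by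
  obtain ⟨C, hC, hb⟩ := exp_neg_arcF_le (show (0 : ℝ) < 1 / 8 by norm_num) 3 (by norm_num)
  set f := arcF (1 + η) with hf
  have hf0 : 0 < f := by
    have h1 := log_sq_le_arcF (show 1 ≤ 1 + η by linarith)
    have h2 : 0 < Real.log (1 + η) := Real.log_pos (by linarith)
    have : 0 < Real.log (1 + η) ^ 2 := by positivity
    linarith
  refine ⟨fun a => (a⁻¹ ^ (3 / 2 : ℝ) * Real.exp (-(f / 8) * a⁻¹)) * (2 * C * Real.pi), ?_, ?_⟩
  · have h1 := tendsto_rpow_mul_exp_neg_mul_atTop_nhds_zero (3 / 2) (f / 8) (by positivity)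
    simpa using (h1.comp tendsto_inv_nhdsGT_zero).mul_const (2 * C * Real.pi)
  · intro a ha ha1
    refine ⟨by positivity, fun ρ hρ => ?_⟩
    have hq : ∀ x : ℝ, ‖heatQ a (ρ + x ^ 2)‖ ≤
        Real.exp (-(f / 8) * a⁻¹) * (2 * C) / ρ ^ 2 * (1 + x ^ 2)⁻¹ := by
      intro x
      have hσ : 1 + η ≤ ρ + x ^ 2 := by nlinarith
      have hσ0 : 0 < ρ + x ^ 2 := by linarith
      have h1 : f ≤ arcF (ρ + x ^ 2) :=
        arcF_mono (show 0 < 1 + η by linarith) hσ0 hσ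
      have hainv : 1 ≤ a⁻¹ := (one_le_inv₀ ha).2 ha1
      -- The exponent `arcF / (4 a)` is shared equally: one half is at least `f / (8 a)` and gives
      -- smallness as `a → 0`, the other is at least `arcF / 8` because `a ≤ 1` and gives decay in
      -- `ρ`.
      have h2 : ‖gauss a (ρ + x ^ 2)‖ ≤
          Real.exp (-(f / 8) * a⁻¹) * Real.exp (-(1 / 8) * arcF (ρ + x ^ 2)) := by
        rw [norm_gauss, ← Real.exp_add, Real.exp_le_exp, ← Complex.ofReal_inv, Complex.ofReal_re]
        nlinarith
      have h3 := hb _ hσ0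
      rw [Real.rpow_neg (by positivity)] at h3
      norm_num at h3
      have h4 : C * ((1 + (ρ + x ^ 2)) ^ 3)⁻¹ ≤ C / ρ ^ 2 * (1 + x ^ 2)⁻¹ := by
        rw [← div_eq_mul_inv]
        refine (div_add_sq_pow_le hC.le (by linarith) 2 x).trans ?_
        have : 0 < ρ := by linarith
        gcongr
        linarith
      rw [heatQ, norm_mul, Complex.norm_real, Real.norm_of_nonneg (arcE_nonneg hσ0.le)]
      calc _ ≤ 2 * (Real.exp (-(f / 8) * a⁻¹) * (C / ρ ^ 2 * (1 + x ^ 2)⁻¹)) := by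
            refine mul_le_mul (arcE_le hσ0.le) (h2.trans ?_) (norm_nonneg _) (by norm_num)
            gcongr
            norm_num
            exact h3.trans h4
        _ = _ := by ring
    have h5 : ‖∫ x : ℝ, heatQ a (ρ + x ^ 2)‖ ≤
        Real.exp (-(f / 8) * a⁻¹) * (2 * C) / ρ ^ 2 * Real.pi := by
      refine (norm_integral_le_of_norm_le (integrable_inv_one_add_sq.const_mul _)
        (Eventually.of_forall hq)).trans_eq ?_
      rw [integral_const_mul, integral_univ_inv_one_add_sq]
    have h6 : ‖heatC a‖ ≤ a⁻¹ ^ (3 / 2 : ℝ) := by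
      refine (norm_heatC_le (by simpa using ha.le) (by exact_mod_cast ha.ne')).trans_eq ?_
      rw [Complex.norm_real, Real.norm_of_nonneg ha.le, Real.rpow_neg ha.le, Real.inv_rpow ha.le]
    rw [heatK, norm_mul]
    calc _ ≤ a⁻¹ ^ (3 / 2 : ℝ) * (Real.exp (-(f / 8) * a⁻¹) * (2 * C) / ρ ^ 2 * Real.pi) :=
          mul_le_mul h6 h5 (norm_nonneg _) (by positivity)
      _ = _ := by ring

/-- The time dependent factor of the heat kernel at real times. -/
noncomputable def heatCReal (a : ℝ) : ℝ :=
  (4 * √2 * Real.pi ^ (3 / 2 : ℝ))⁻¹ * (a ^ (-(3 / 2) : ℝ) * Real.exp (-a / 4))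

lemma heatK_real {a : ℝ} (ha : 0 < a) (ρ : ℝ) : heatK a ρ =
    ((heatCReal a * ∫ x : ℝ, arcE (ρ + x ^ 2) * Real.exp (-arcF (ρ + x ^ 2) / 4 * a⁻¹) : ℝ) : ℂ) := by
  have h1 : heatC a = (heatCReal a : ℂ) := by
    rw [heatC, heatCReal]
    push_cast
    rw [Complex.ofReal_cpow ha.le]
    push_cast
    rfl
  have h2 : ∫ x : ℝ, heatQ a (ρ + x ^ 2) =
      ∫ x : ℝ, ((arcE (ρ + x ^ 2) * Real.exp (-arcF (ρ + x ^ 2) / 4 * a⁻¹) : ℝ) : ℂ) := by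
    congr with x
    rw [heatQ, gauss]
    push_cast
    rfl
  rw [heatK, h1, h2, integral_complex_ofReal]
  push_cast
  rfl

/-! ### Taylor expansion of the kernel in time. -/

/-- The second order Taylor estimate for a bounded holomorphic function. -/
lemma norm_sub_deriv_le_of_bounded {f : ℂ → ℂ} {c : ℂ} {R B : ℝ} (hR : 0 < R)
    (hf : DifferentiableOn ℂ f (Metric.ball c (4 * R))) (hB : ∀ z ∈ Metric.ball c (4 * R), ‖f z‖ ≤ B)
    {z : ℂ} (hz : ‖z - c‖ ≤ R) :
    ‖f z - f c - (z - c) * deriv f c‖ ≤ B / R ^ 2 * ‖z - c‖ ^ 2 ∧ ‖deriv f c‖ ≤ B / R := by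
  have hB0 : 0 ≤ B := (norm_nonneg _).trans (hB c (Metric.mem_ball_self (by positivity)))
  have h1 : ∀ w ∈ Metric.ball c (3 * R), ‖deriv f w‖ ≤ B / R := by
    intro w hw
    have hsub : Metric.closedBall w R ⊆ Metric.ball c (4 * R) := fun y hy => by
      rw [Metric.mem_ball] at *; rw [Metric.mem_closedBall] at hy
      have := dist_triangle y w c
      linarith
    refine Complex.norm_deriv_le_of_forall_mem_sphere_norm_le hR ?_ fun y hy =>
      hB y (hsub (Metric.sphere_subset_closedBall hy))
    refine (hf.mono ?_).diffContOnCl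
    rw [closure_ball _ hR.ne']
    exact hsub
  have hd : DifferentiableOn ℂ (deriv f) (Metric.ball c (4 * R)) := hf.deriv Metric.isOpen_ball
  have h2 : ∀ w ∈ Metric.ball c (2 * R), ‖deriv (deriv f) w‖ ≤ B / R ^ 2 := by
    intro w hw
    have hsub : Metric.closedBall w R ⊆ Metric.ball c (3 * R) := fun y hy => by
      rw [Metric.mem_ball] at *; rw [Metric.mem_closedBall] at hy
      have := dist_triangle y w c
      linarith
    refine (Complex.norm_deriv_le_of_forall_mem_sphere_norm_le (C := B / R) hR ?_ fun y hy =>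
      h1 y (hsub (Metric.sphere_subset_closedBall hy))).trans_eq (by field_simp)
    refine (hd.mono ?_).diffContOnCl
    rw [closure_ball _ hR.ne']
    exact hsub.trans (Metric.ball_subset_ball (by linarith))
  refine ⟨?_, h1 c (Metric.mem_ball_self (by positivity))⟩
  have hcl : Metric.closedBall c ‖z - c‖ ⊆ Metric.ball c (2 * R) := fun y hy => by
    rw [Metric.mem_ball]; rw [Metric.mem_closedBall] at hy; linarith
  have hsub42 : Metric.ball c (2 * R) ⊆ Metric.ball c (4 * R) :=
    Metric.ball_subset_ball (by linarith)
  have hzm : z ∈ Metric.closedBall c ‖z - c‖ := by simp [dist_eq_norm]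
  have hcm : c ∈ Metric.closedBall c ‖z - c‖ := by simp
  have hat : ∀ w ∈ Metric.closedBall c ‖z - c‖, Metric.ball c (4 * R) ∈ 𝓝 w := fun w hw =>
    Metric.isOpen_ball.mem_nhds (hsub42 (hcl hw))
  have h3 : ∀ w ∈ Metric.closedBall c ‖z - c‖, ‖deriv f w - deriv f c‖ ≤ B / R ^ 2 * ‖z - c‖ := by
    intro w hw
    have := (convex_closedBall c ‖z - c‖).norm_image_sub_le_of_norm_deriv_le
      (f := deriv f) (C := B / R ^ 2)
      (fun y hy => hd.differentiableAt (hat y hy)) (fun y hy => h2 y (hcl hy)) hcm hw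
    refine this.trans ?_
    gcongr
    simpa [dist_eq_norm] using hw
  have h4 := (convex_closedBall c ‖z - c‖).norm_image_sub_le_of_norm_hasDerivWithin_le
    (f := fun w => f w - (w - c) * deriv f c) (f' := fun w => deriv f w - deriv f c)
    (C := B / R ^ 2 * ‖z - c‖)
    (fun w hw => ?_) h3 hcm hzm
  · refine le_trans (le_of_eq ?_) (h4.trans_eq (by ring))
    congr 1
    ring
  · have := ((hf.differentiableAt (hat w hw)).hasDerivAt.fun_sub
      (((hasDerivAt_id w).sub_const c).mul_const (deriv f c))).hasDerivWithinAt
      (s := Metric.closedBall c ‖z - c‖)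
    simpa using this

/-- The time derivative of `heatK` along the line `Re τ = const`, with a uniform remainder. -/
lemma heatK_taylor {τ : ℂ} (h : 0 < τ.re) : ∃ C R : ℝ, 0 < C ∧ 0 < R ∧
    (∀ ρ : ℝ, 1 ≤ ρ → ‖heatL τ ρ‖ ≤ C / ρ ^ 2) ∧ (∀ ρ : ℝ, 1 ≤ ρ → ‖heatK τ ρ‖ ≤ C / ρ ^ 2) ∧
    ∀ s : ℝ, |s| ≤ R → ∀ ρ : ℝ, 1 ≤ ρ →
      ‖heatK (τ + s * Complex.I) ρ - heatK τ ρ - s * (Complex.I * heatL τ ρ)‖ ≤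
        C * s ^ 2 / ρ ^ 2 := by
  obtain ⟨C, hC, hb⟩ := heatK_bound h 2
  obtain ⟨r, hr, hball⟩ := Metric.eventually_nhds_iff_ball.1 hb
  -- Two successive Cauchy estimates each use up a margin `R`: the function is bounded on the ball
  -- of radius `4 R`, its derivative on `3 R`, its second derivative on `2 R`.
  obtain ⟨R, hR, rfl⟩ : ∃ R, 0 < R ∧ r = 4 * R := ⟨r / 4, by positivity, by ring⟩
  have key : ∀ ρ : ℝ, 1 ≤ ρ → ∀ z : ℂ, ‖z - τ‖ ≤ R →
      ‖heatK z ρ - heatK τ ρ - (z - τ) * heatL τ ρ‖ ≤ C / ρ ^ 2 / R ^ 2 * ‖z - τ‖ ^ 2 ∧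
        ‖heatL τ ρ‖ ≤ C / ρ ^ 2 / R := by
    intro ρ hρ z hz
    have := norm_sub_deriv_le_of_bounded (f := fun τ => heatK τ ρ) hR
      (fun w hw => (hasDerivAt_heatK_time (hball w hw).1
        (by linarith)).differentiableAt.differentiableWithinAt)
      (fun w hw => (hball w hw).2 ρ hρ) hz
    rwa [(hasDerivAt_heatK_time h (by linarith : 0 < ρ)).deriv] at this
  refine ⟨C + C / R + C / R ^ 2, R, by positivity, hR, fun ρ hρ => ?_, fun ρ hρ => ?_,
    fun s hs ρ hρ => ?_⟩
  · refine (key ρ hρ τ (by simpa using hR.le)).2.trans ?_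
    rw [div_right_comm]
    gcongr
    have : 0 ≤ C / R ^ 2 := by positivity
    linarith
  · refine ((hball τ (Metric.mem_ball_self hr)).2 ρ hρ).trans ?_
    gcongr
    have : 0 ≤ C / R ^ 2 := by positivity
    have : 0 ≤ C / R := by positivity
    linarith
  · have hn : ‖τ + s * Complex.I - τ‖ = |s| := by simp
    have := (key ρ hρ (τ + s * Complex.I) (by rwa [hn])).1
    rw [hn, sq_abs] at this
    rw [← mul_assoc]
    simp only [add_sub_cancel_left] at this
    refine this.trans ?_
    rw [div_right_comm, div_mul_eq_mul_div]
    gcongr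
    have : 0 ≤ C / R := by positivity
    linarith

/-! ### Distance, isometries and area in the half-plane. -/

/-- The hyperbolic cosine of the distance. -/
noncomputable def coshDist (z w : ℍ) : ℝ := Real.cosh (dist z w)

lemma one_le_coshDist (z w : ℍ) : 1 ≤ coshDist z w := Real.one_le_cosh _

lemma coshDist_pos (z w : ℍ) : 0 < coshDist z w := Real.cosh_pos _

lemma coshDist_comm (z w : ℍ) : coshDist z w = coshDist w z := by
  rw [coshDist, coshDist, dist_comm]

lemma continuous_coshDist : Continuous fun p : ℍ × ℍ => coshDist p.1 p.2 :=
  Real.continuous_cosh.comp continuous_dist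

lemma coshDist_smul (g : Matrix.SpecialLinearGroup (Fin 2) ℝ) (z w : ℍ) :
    coshDist (g • z) (g • w) = coshDist z w := by
  rw [coshDist, dist_smul, coshDist]

lemma coshDist_eq (z w : ℍ) :
    coshDist z w = 1 + ((z.re - w.re) ^ 2 + (z.im - w.im) ^ 2) / (2 * z.im * w.im) := by
  rw [coshDist, cosh_dist, Complex.dist_eq, Complex.sq_norm, Complex.normSq_apply]
  simp [sq]

instance : SMulInvariantMeasure (Matrix.SpecialLinearGroup (Fin 2) ℝ) ℍ volume where
  measure_preimage_smul g s hs := by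
    exact measure_preimage_smul_of_nullMeasurableSet (μ := (volume : Measure ℍ))
      (c := (g : GL (Fin 2) ℝ)) hs.nullMeasurableSet

lemma measurePreserving_SL (g : Matrix.SpecialLinearGroup (Fin 2) ℝ) :
    MeasurePreserving (fun z : ℍ => g • z) volume volume :=
  measurePreserving_smul g volume

lemma measurableEmbedding_SL (g : Matrix.SpecialLinearGroup (Fin 2) ℝ) :
    MeasurableEmbedding (fun z : ℍ => g • z) :=
  (Homeomorph.smul g).measurableEmbedding

lemma coe_toSL2R_smul (z h : ℍ) : ((z.toSL2R • h : ℍ) : ℂ) = z.re + z.im * h := by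
  have : (√z.im : ℂ) ≠ 0 := by exact_mod_cast (Real.sqrt_pos.2 z.im_pos).ne'
  rw [specialLinearGroup_apply]
  simp
  field_simp
  rw [← Complex.ofReal_pow, Real.sq_sqrt z.im_pos.le]
  ring

/-- The hyperbolic area in the coordinates of the half-plane. -/
lemma map_coe_volume : (volume : Measure ℍ).map UpperHalfPlane.coe =
    ((volume : Measure ℂ).restrict {z | 0 < z.im}).withDensity
      fun z => ENNReal.ofReal (1 / z.im ^ 2) := by
  ext s hs
  rw [Measure.map_apply measurable_coe hs, volume_eq_lintegral, Set.image_preimage_eq_inter_range,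
    withDensity_apply _ hs, Measure.restrict_restrict hs]
  have : Set.range UpperHalfPlane.coe = {z : ℂ | 0 < z.im} := by
    ext z
    exact ⟨by rintro ⟨w, rfl⟩; exact w.im_pos, fun h => ⟨⟨z, h⟩, rfl⟩⟩
  rw [this]
  refine lintegral_congr fun z => ?_
  rw [← ENNReal.ofReal_coe_nnreal]
  congr 1
  simp

lemma lintegral_upperHalfPlane {f : ℂ → ENNReal} (hf : Measurable f) :
    ∫⁻ z : ℍ, f z = ∫⁻ z in {z : ℂ | 0 < z.im}, ENNReal.ofReal (1 / z.im ^ 2) * f z := by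
  rw [← lintegral_map hf measurable_coe, map_coe_volume,
    lintegral_withDensity_eq_lintegral_mul _ (by fun_prop) hf]
  rfl

lemma integral_upperHalfPlane (f : ℂ → ℂ) :
    ∫ z : ℍ, f z = ∫ z in {z : ℂ | 0 < z.im}, ((1 / z.im ^ 2 : ℝ) : ℂ) * f z := by
  rw [← measurableEmbedding_coe.integral_map, map_coe_volume,
    integral_withDensity_eq_integral_toReal_smul (by fun_prop) (by simp)]
  refine integral_congr_ae (Eventually.of_forall fun z => ?_)
  simp only
  rw [ENNReal.toReal_ofReal (by positivity)]
  rfl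

lemma lintegral_eq_mul_lintegral_comp_mul {c : ℝ} (hc : 0 < c) (f : ℝ → ENNReal) :
    ∫⁻ x, f x = ENNReal.ofReal c * ∫⁻ x, f (c * x) := by
  have := lintegral_image_eq_lintegral_abs_deriv_mul (s := Set.univ) (f := fun x => c * x)
    (f' := fun _ => c) MeasurableSet.univ
    (fun x _ => (hasDerivAt_const_mul c).hasDerivWithinAt)
    (fun x _ y _ h => mul_left_cancel₀ hc.ne' h) f
  rw [Set.image_univ, (mul_left_surjective₀ hc.ne').range_eq, abs_of_pos hc,
    Measure.restrict_univ] at this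
  rw [this, lintegral_const_mul' _ _ ENNReal.ofReal_ne_top]

lemma lintegral_Ioi_eq_lintegral_exp (f : ℝ → ENNReal) :
    ∫⁻ y in Set.Ioi 0, f y = ∫⁻ s, ENNReal.ofReal (Real.exp s) * f (Real.exp s) := by
  have := lintegral_image_eq_lintegral_abs_deriv_mul (s := Set.univ) (f := Real.exp)
    (f' := Real.exp) MeasurableSet.univ
    (fun x _ => (Real.hasDerivAt_exp x).hasDerivWithinAt) Real.exp_injective.injOn f
  rw [Set.image_univ, Real.range_exp, Measure.restrict_univ] at this
  simpa [abs_of_pos, Real.exp_pos] using this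

lemma lintegral_sq_add_sq {f : ℝ → ENNReal} (hf : Measurable f) :
    ∫⁻ x : ℝ, ∫⁻ ξ : ℝ, f (x ^ 2 + ξ ^ 2) =
      ENNReal.ofReal (2 * Real.pi) * ∫⁻ r in Set.Ioi (0 : ℝ), ENNReal.ofReal r * f (r ^ 2) := by
  rw [← lintegral_prod (f := fun p : ℝ × ℝ => f (p.1 ^ 2 + p.2 ^ 2)) (by fun_prop)]
  rw [← Measure.volume_eq_prod, ← lintegral_comp_polarCoord_symm, polarCoord_target]
  have h1 : ∀ p : ℝ × ℝ, ENNReal.ofReal p.1 • f ((polarCoord.symm p).1 ^ 2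
      + (polarCoord.symm p).2 ^ 2) = ENNReal.ofReal p.1 * f (p.1 ^ 2) := by
    intro p
    rw [polarCoord_symm_apply, smul_eq_mul]
    congr 2
    simp only
    linear_combination p.1 ^ 2 * Real.sin_sq_add_cos_sq p.2
  simp_rw [h1]
  rw [Measure.volume_eq_prod, ← Measure.prod_restrict,
    lintegral_prod (f := fun p : ℝ × ℝ => ENNReal.ofReal p.1 * f (p.1 ^ 2)) (by fun_prop)]
  simp only [lintegral_const, Measure.restrict_apply MeasurableSet.univ, Set.univ_inter,
    Real.volume_Ioo]
  rw [lintegral_mul_const _ (by fun_prop), mul_comm]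
  congr 2
  ring

lemma coshDist_I (w : ℍ) : coshDist I w = (1 + w.re ^ 2 + w.im ^ 2) / (2 * w.im) := by
  have := w.im_pos
  rw [coshDist_eq, I_re, I_im]
  field_simp
  ring

lemma lintegral_coshDist_I (g : ℝ → ENNReal) (hg : Measurable g) :
    ∫⁻ w : ℍ, g (coshDist I w) = ∫⁻ y in Set.Ioi (0 : ℝ), ENNReal.ofReal (1 / y ^ 2) *
      ∫⁻ x : ℝ, g ((1 + x ^ 2 + y ^ 2) / (2 * y)) := by
  simp_rw [coshDist_I]
  have h1 := lintegral_upperHalfPlane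
    (f := fun z => g ((1 + z.re ^ 2 + z.im ^ 2) / (2 * z.im))) (by fun_prop)
  refine h1.trans ?_
  have h2 : {z : ℂ | 0 < z.im} =
      Complex.measurableEquivRealProd ⁻¹' (Set.univ ×ˢ Set.Ioi (0 : ℝ)) := by
    ext z; simp
  rw [h2]
  refine (Complex.volume_preserving_equiv_real_prod.setLIntegral_comp_preimage_emb
    Complex.measurableEquivRealProd.measurableEmbedding
    (fun p : ℝ × ℝ => ENNReal.ofReal (1 / p.2 ^ 2) * g ((1 + p.1 ^ 2 + p.2 ^ 2) / (2 * p.2)))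
    _).trans ?_
  rw [Measure.volume_eq_prod, ← Measure.prod_restrict, Measure.restrict_univ,
    lintegral_prod_symm' _ (by fun_prop)]
  refine lintegral_congr fun y => ?_
  dsimp only
  rw [lintegral_const_mul _ (by fun_prop)]

lemma coshDist_toSL2R_smul (z h : ℍ) : coshDist z (z.toSL2R • h) = coshDist I h := by
  calc coshDist z (z.toSL2R • h) = coshDist (z.toSL2R • I) (z.toSL2R • h) := by
        rw [toSL2R_smul_I]
    _ = _ := coshDist_smul _ _ _

/-- An isometry in `SL(2, ℝ)` carries `I` to `z` and preserves the area, so integrals of radial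
kernels do not depend on the centre. -/
lemma lintegral_coshDist (g : ℝ → ENNReal) (z : ℍ) :
    ∫⁻ w : ℍ, g (coshDist z w) = ∫⁻ w : ℍ, g (coshDist I w) := by
  rw [← (measurePreserving_SL z.toSL2R).lintegral_comp_emb (measurableEmbedding_SL _)]
  simp_rw [coshDist_toSL2R_smul]

/-- The factor `y ^ 2` in `cosh(d)^(-2)` cancels the area density, leaving `4 / (1 + |z| ^ 2) ^ 2`,
which is integrable over the whole plane. -/
lemma lintegral_coshDist_sq_lt_top : ∫⁻ w : ℍ, ENNReal.ofReal (1 / coshDist I w ^ 2) < ⊤ := by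
  have h1 : ∀ w : ℍ, ENNReal.ofReal (1 / coshDist I w ^ 2) =
      (fun z : ℂ => ENNReal.ofReal (4 * z.im ^ 2 / (1 + ‖z‖ ^ 2) ^ 2)) w := by
    intro w
    have := w.im_pos
    simp only [coshDist_I, Complex.sq_norm, Complex.normSq_apply, coe_im, coe_re]
    congr 1
    field_simp
    ring
  rw [lintegral_congr h1, lintegral_upperHalfPlane
    (f := fun z : ℂ => ENNReal.ofReal (4 * z.im ^ 2 / (1 + ‖z‖ ^ 2) ^ 2)) (by fun_prop)]
  have hi : Integrable fun z : ℂ => 4 * (1 + ‖z‖ ^ 2) ^ (-4 / 2 : ℝ) :=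
    (integrable_rpow_neg_one_add_norm_sq (by simp; norm_num)).const_mul 4
  refine lt_of_le_of_lt ?_ hi.lintegral_lt_top
  refine (setLIntegral_mono' (measurableSet_lt measurable_const Complex.measurable_im)
    fun z (hz : 0 < z.im) => ?_).trans
    (setLIntegral_le_lintegral {z : ℂ | 0 < z.im} _)
  rw [← ENNReal.ofReal_mul (by positivity)]
  refine ENNReal.ofReal_le_ofReal (le_of_eq ?_)
  rw [show (-4 / 2 : ℝ) = -((2 : ℕ) : ℝ) by norm_num, Real.rpow_neg (by positivity),
    Real.rpow_natCast]
  field_simp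

/-- The area integral of `1 / cosh(d)^2`. -/
noncomputable def areaConst : ℝ := (∫⁻ w : ℍ, ENNReal.ofReal (1 / coshDist I w ^ 2)).toReal

lemma areaConst_nonneg : 0 ≤ areaConst := ENNReal.toReal_nonneg

lemma lintegral_coshDist_sq (z : ℍ) :
    ∫⁻ w : ℍ, ENNReal.ofReal (1 / coshDist z w ^ 2) = ENNReal.ofReal areaConst := by
  rw [lintegral_coshDist (fun ρ => ENNReal.ofReal (1 / ρ ^ 2)), areaConst,
    ENNReal.ofReal_toReal lintegral_coshDist_sq_lt_top.ne]

/-! ### The heat kernel has total mass one. -/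

/-- Because `arcF' = 2 * arcE`, the integrand is the exact derivative of `-a * exp (-arcF (b + r ^
2) / (4 a))`. -/
lemma lintegral_gauss_profile {a b : ℝ} (ha : 0 < a) (hb : 1 ≤ b) :
    ∫⁻ r in Set.Ioi (0 : ℝ), ENNReal.ofReal r * ENNReal.ofReal (arcE (b + r ^ 2)
      * Real.exp (-arcF (b + r ^ 2) / 4 * a⁻¹)) = ENNReal.ofReal (a * Real.exp (-arcF b / 4 * a⁻¹)) := by
  have hd : ∀ x ∈ Set.Ici (0 : ℝ), HasDerivAt (fun r => -(a * Real.exp (-arcF (b + r ^ 2) / 4 * a⁻¹)))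
      (x * (arcE (b + x ^ 2) * Real.exp (-arcF (b + x ^ 2) / 4 * a⁻¹))) x := by
    intro x hx
    have hs : HasDerivAt (fun x : ℝ => b + x ^ 2) (2 * x) x := by
      simpa using (hasDerivAt_pow 2 x).const_add b
    have h1 := (((((hasDerivAt_arcF (show 0 < b + x ^ 2 by positivity)).comp x hs).neg.div_const
      4).mul_const a⁻¹).exp.const_mul a).neg
    refine h1.congr_deriv ?_
    simp only [Function.comp, Pi.neg_apply]
    field_simp
    ring
  have hpos : ∀ x ∈ Set.Ioi (0 : ℝ),
      0 ≤ x * (arcE (b + x ^ 2) * Real.exp (-arcF (b + x ^ 2) / 4 * a⁻¹)) := fun x hx => by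
    have hx : 0 < x := hx
    have := arcE_nonneg (show 0 ≤ b + x ^ 2 by positivity)
    positivity
  have hlim : Tendsto (fun r => -(a * Real.exp (-arcF (b + r ^ 2) / 4 * a⁻¹))) atTop (𝓝 0) := by
    obtain ⟨C, hC, hCb⟩ := exp_neg_arcF_le (show 0 < a⁻¹ / 4 by positivity) 1 (by norm_num)
    have h2 : Tendsto (fun r : ℝ => a * (C * r⁻¹)) atTop (𝓝 0) := by
      simpa using (tendsto_inv_atTop_zero.const_mul C).const_mul a
    refine squeeze_zero_norm' ?_ h2
    filter_upwards [eventually_ge_atTop 1] with r hr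
    have h3 := hCb (b + r ^ 2) (by positivity)
    rw [norm_neg, Real.norm_of_nonneg (by positivity)]
    gcongr
    calc _ = Real.exp (-(a⁻¹ / 4) * arcF (b + r ^ 2)) := by congr 1; ring
      _ ≤ _ := h3
      _ ≤ _ := by
        rw [Real.rpow_neg_one]
        gcongr
        nlinarith
  have h4 := integral_Ioi_of_hasDerivAt_of_nonneg' hd hpos hlim
  have h5 := integrableOn_Ioi_deriv_of_nonneg' hd hpos hlim
  have h6 : a * Real.exp (-arcF b / 4 * a⁻¹) = ∫ x in Set.Ioi (0 : ℝ),
      x * (arcE (b + x ^ 2) * Real.exp (-arcF (b + x ^ 2) / 4 * a⁻¹)) := by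
    rw [h4]; simp
  rw [h6, ofReal_integral_eq_lintegral_ofReal h5 ?_]
  · refine setLIntegral_congr_fun measurableSet_Ioi fun r hr => ?_
    have hr : 0 < r := hr
    exact (ENNReal.ofReal_mul hr.le).symm
  · filter_upwards [ae_restrict_mem measurableSet_Ioi] with x hx using hpos x hx

lemma measurable_arcE : Measurable arcE := by
  have : arcE = fun σ => ∫ x in Set.Ioi (0 : ℝ), x ^ 0 / (1 + 2 * σ * x + x ^ 2) ^ (0 + 1) := rfl
  rw [this]
  refine StronglyMeasurable.measurable (StronglyMeasurable.integral_prod_right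
    (f := fun σ x : ℝ => x ^ 0 / (1 + 2 * σ * x + x ^ 2) ^ (0 + 1)) ?_)
  exact Measurable.stronglyMeasurable (by simp only [Function.uncurry_def]; fun_prop)

lemma measurable_arcF : Measurable arcF := by
  have := measurable_arcE
  unfold arcF
  fun_prop

lemma integral_shifted_gauss {a : ℝ} (ha : 0 < a) :
    ∫⁻ s : ℝ, ENNReal.ofReal (Real.exp (-s ^ 2 / 4 * a⁻¹ - s / 2)) =
      ENNReal.ofReal (√(4 * Real.pi * a) * Real.exp (a / 4)) := by
  have h1 : ∀ s : ℝ, Real.exp (-s ^ 2 / 4 * a⁻¹ - s / 2) =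
      Real.exp (a / 4) * Real.exp (-(4 * a)⁻¹ * (s + a) ^ 2) := by
    intro s
    rw [← Real.exp_add]
    congr 1
    field_simp
    ring
  simp_rw [h1]
  have hi : Integrable fun s : ℝ => Real.exp (-(4 * a)⁻¹ * (s + a) ^ 2) :=
    (integrable_exp_neg_mul_sq (b := (4 * a)⁻¹) (by positivity)).comp_add_right a
  rw [← ofReal_integral_eq_lintegral_ofReal (hi.const_mul _)
    (Eventually.of_forall fun s => by positivity), integral_const_mul,
    integral_add_right_eq_self (fun s => Real.exp (-(4 * a)⁻¹ * s ^ 2)) a, integral_gaussian,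
    mul_comm]
  congr 4
  field_simp

/-- The heat kernel as a nonnegative real function. -/
noncomputable def heatKReal (a ρ : ℝ) : ℝ :=
  heatCReal a * ∫ x : ℝ, arcE (ρ + x ^ 2) * Real.exp (-arcF (ρ + x ^ 2) / 4 * a⁻¹)

lemma heatCReal_nonneg {a : ℝ} (ha : 0 < a) : 0 ≤ heatCReal a := by
  unfold heatCReal; positivity

lemma ofReal_heatKReal {a ρ : ℝ} (ha : 0 < a) (hρ : 1 ≤ ρ) : ENNReal.ofReal (heatKReal a ρ) =
    ENNReal.ofReal (heatCReal a) * ∫⁻ x : ℝ, ENNReal.ofReal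
      (arcE (ρ + x ^ 2) * Real.exp (-arcF (ρ + x ^ 2) / 4 * a⁻¹)) := by
  have hpos : ∀ x : ℝ, 0 ≤ arcE (ρ + x ^ 2) * Real.exp (-arcF (ρ + x ^ 2) / 4 * a⁻¹) := fun x =>
    mul_nonneg (arcE_nonneg (by positivity)) (Real.exp_pos _).le
  have hi : Integrable fun x : ℝ =>
      arcE (ρ + x ^ 2) * Real.exp (-arcF (ρ + x ^ 2) / 4 * a⁻¹) := by
    obtain ⟨C, hC, hb⟩ := heatQ_bound_self (τ := a) (by simpa using ha) 1
    have := (integrable_comp_add_sq (continuousOn_heatQ a) hC (N := 0)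
      (fun σ hσ => (hb σ hσ).1) (show 0 < ρ by linarith)).1.norm
    refine this.congr (Eventually.of_forall fun x => ?_)
    simp only [heatQ, norm_mul, norm_gauss, Complex.norm_real]
    rw [Real.norm_of_nonneg (arcE_nonneg (by positivity)), ← Complex.ofReal_inv, Complex.ofReal_re]
  rw [heatKReal, ENNReal.ofReal_mul (heatCReal_nonneg ha),
    ofReal_integral_eq_lintegral_ofReal hi (Eventually.of_forall hpos)]

/-- The heat kernel has mass one. -/
lemma lintegral_heatKReal {a : ℝ} (ha : 0 < a) :
    ∫⁻ w : ℍ, ENNReal.ofReal (heatKReal a (coshDist I w)) = 1 := by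
  have mE := measurable_arcE
  have mF := measurable_arcF
  set G : ℝ → ENNReal := fun σ => ENNReal.ofReal (arcE σ * Real.exp (-arcF σ / 4 * a⁻¹)) with hG
  have mG : Measurable G := by fun_prop
  have h1 : ∀ w : ℍ, ENNReal.ofReal (heatKReal a (coshDist I w)) =
      ENNReal.ofReal (heatCReal a) * ∫⁻ x : ℝ, G (coshDist I w + x ^ 2) := fun w =>
    ofReal_heatKReal ha (one_le_coshDist _ _)
  have mGi : Measurable fun ρ : ℝ => ∫⁻ x : ℝ, G (ρ + x ^ 2) :=
    Measurable.lintegral_prod_right' (f := fun p : ℝ × ℝ => G (p.1 + p.2 ^ 2)) (by fun_prop)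
  rw [lintegral_congr h1, lintegral_const_mul' _ _ ENNReal.ofReal_ne_top,
    lintegral_coshDist_I (fun ρ => ∫⁻ x : ℝ, G (ρ + x ^ 2)) mGi]
  have h2 : ∀ y ∈ Set.Ioi (0 : ℝ), ENNReal.ofReal (1 / y ^ 2) *
      ∫⁻ x : ℝ, ∫⁻ ξ : ℝ, G ((1 + x ^ 2 + y ^ 2) / (2 * y) + ξ ^ 2) =
      ENNReal.ofReal (1 / y ^ 2 * (√(2 * y) * (2 * Real.pi *
        (a * Real.exp (-arcF ((1 + y ^ 2) / (2 * y)) / 4 * a⁻¹))))) := by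
    intro y hy
    have hy : 0 < y := hy
    have hb : 1 ≤ (1 + y ^ 2) / (2 * y) := by
      rw [one_le_div (by positivity)]
      nlinarith [sq_nonneg (y - 1)]
    -- Rescaling `x` by `√(2 y)` makes the argument depend only on `x ^ 2 + ξ ^ 2`, so polar
    -- coordinates reduce the double integral to `lintegral_gauss_profile`.
    rw [lintegral_eq_mul_lintegral_comp_mul (show 0 < √(2 * y) by positivity)]
    have h3 : ∀ x ξ : ℝ, (1 + (√(2 * y) * x) ^ 2 + y ^ 2) / (2 * y) + ξ ^ 2 =
        (1 + y ^ 2) / (2 * y) + (x ^ 2 + ξ ^ 2) := by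
      intro x ξ
      rw [mul_pow, Real.sq_sqrt (by positivity)]
      field_simp
      ring
    simp_rw [h3]
    rw [lintegral_sq_add_sq (f := fun v => G ((1 + y ^ 2) / (2 * y) + v)) (by fun_prop),
      lintegral_gauss_profile ha hb, ← ENNReal.ofReal_mul (by positivity),
      ← ENNReal.ofReal_mul (by positivity), ← ENNReal.ofReal_mul (by positivity)]
  -- With `y = exp s` the remaining base value `(1 + y ^ 2) / (2 y)` is `cosh s`, where `arcF`
  -- equals `s ^ 2`. What is left is a shifted Gaussian.
  rw [setLIntegral_congr_fun measurableSet_Ioi h2, lintegral_Ioi_eq_lintegral_exp]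
  have h4 : ∀ s : ℝ, ENNReal.ofReal (Real.exp s) * ENNReal.ofReal (1 / Real.exp s ^ 2 *
      (√(2 * Real.exp s) * (2 * Real.pi *
        (a * Real.exp (-arcF ((1 + Real.exp s ^ 2) / (2 * Real.exp s)) / 4 * a⁻¹))))) =
      ENNReal.ofReal (√2 * (2 * Real.pi * a)) *
        ENNReal.ofReal (Real.exp (-s ^ 2 / 4 * a⁻¹ - s / 2)) := by
    intro s
    have h5 : (1 + Real.exp s ^ 2) / (2 * Real.exp s) = Real.cosh s := by
      rw [Real.cosh_eq, Real.exp_neg]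
      field_simp
      ring
    have h6 : √(2 * Real.exp s) = √2 * Real.exp (s / 2) := by
      rw [Real.sqrt_mul (by norm_num), Real.exp_half]
    have h7 : Real.exp (-s ^ 2 / 4 * a⁻¹ - s / 2) =
        Real.exp s * (1 / Real.exp s ^ 2) * Real.exp (s / 2) * Real.exp (-s ^ 2 / 4 * a⁻¹) := by
      rw [← Real.exp_nat_mul, one_div, ← Real.exp_neg, ← Real.exp_add, ← Real.exp_add,
        ← Real.exp_add]
      congr 1
      push_cast
      ring
    rw [h5, arcF_cosh, h6, h7, ← ENNReal.ofReal_mul (by positivity),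
      ← ENNReal.ofReal_mul (by positivity)]
    congr 1
    ring
  rw [lintegral_congr h4, lintegral_const_mul' _ _ ENNReal.ofReal_ne_top,
    integral_shifted_gauss ha, ← ENNReal.ofReal_mul (by positivity),
    ← ENNReal.ofReal_mul (heatCReal_nonneg ha)]
  have h8 : heatCReal a * (√2 * (2 * Real.pi * a) * (√(4 * Real.pi * a) * Real.exp (a / 4))) = 1 := by
    have e1 : a ^ (-(3 / 2) : ℝ) = (a * √a)⁻¹ := by
      rw [Real.rpow_neg ha.le, show (3 / 2 : ℝ) = 1 + 1 / 2 by norm_num, Real.rpow_add ha,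
        Real.rpow_one, Real.sqrt_eq_rpow]
    have e2 : Real.pi ^ (3 / 2 : ℝ) = Real.pi * √Real.pi := by
      rw [show (3 / 2 : ℝ) = 1 + 1 / 2 by norm_num, Real.rpow_add Real.pi_pos,
        Real.rpow_one, Real.sqrt_eq_rpow]
    have e3 : √(4 * Real.pi * a) = 2 * √Real.pi * √a := by
      rw [Real.sqrt_mul (by positivity), Real.sqrt_mul (by norm_num),
        show (4 : ℝ) = 2 ^ 2 by norm_num, Real.sqrt_sq (by norm_num)]
    have e4 : Real.exp (-a / 4) = (Real.exp (a / 4))⁻¹ := by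
      rw [← Real.exp_neg]; congr 1; ring
    have : 0 < √a := Real.sqrt_pos.2 ha
    have : 0 < √Real.pi := Real.sqrt_pos.2 Real.pi_pos
    have := Real.pi_pos
    rw [heatCReal, e1, e2, e3, e4]
    field_simp
    norm_num
  rw [h8, ENNReal.ofReal_one]

/-! ### Rotations about the origin and the average of a radial function. -/

/-- The rotation about the origin by the angle `2 θ`. -/
noncomputable def rot (θ : ℝ) : Matrix.SpecialLinearGroup (Fin 2) ℝ :=
  ⟨!![Real.cos θ, Real.sin θ; -Real.sin θ, Real.cos θ], by
    rw [Matrix.det_fin_two_of]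
    linear_combination Real.sin_sq_add_cos_sq θ⟩

lemma coe_rot_smul (θ : ℝ) (w : ℍ) : ((rot θ • w : ℍ) : ℂ) =
    (Real.cos θ * w + Real.sin θ) / (-Real.sin θ * w + Real.cos θ) := by
  rw [specialLinearGroup_apply]
  simp [rot]

lemma rot_smul_I (θ : ℝ) : rot θ • I = I := by
  apply UpperHalfPlane.ext
  rw [coe_rot_smul, coe_I]
  have h : (Real.cos θ : ℂ) ^ 2 + (Real.sin θ : ℂ) ^ 2 = 1 := by
    exact_mod_cast Real.cos_sq_add_sin_sq θ
  have hne : (-Real.sin θ * Complex.I + Real.cos θ : ℂ) ≠ 0 := by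
    intro h0
    have : (Real.cos θ : ℂ) ^ 2 + (Real.sin θ : ℂ) ^ 2 =
        (-Real.sin θ * Complex.I + Real.cos θ) * (Real.sin θ * Complex.I + Real.cos θ) := by
      linear_combination ((Real.sin θ : ℂ) ^ 2) * Complex.I_sq
    rw [h0, zero_mul, h] at this
    exact one_ne_zero this
  rw [div_eq_iff hne]
  linear_combination (Real.sin θ : ℂ) * Complex.I_sq

/-- The hyperbolic law of cosines in half-plane coordinates: the angle enters only through a linear
combination of `cos (2 θ)` and `sin (2 θ)`. -/
lemma coshDist_rot_smul (θ : ℝ) (z w : ℍ) : coshDist z (rot θ • w) = coshDist I z * coshDist I w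
    - (Real.cos (2 * θ) * (((z.re ^ 2 + z.im ^ 2 - 1) * (w.re ^ 2 + w.im ^ 2 - 1) / 2
        + 2 * z.re * w.re) / (2 * z.im * w.im))
      + Real.sin (2 * θ) * (((z.re ^ 2 + z.im ^ 2 - 1) * w.re
        - z.re * (w.re ^ 2 + w.im ^ 2 - 1)) / (2 * z.im * w.im))) := by
  set c := Real.cos θ with hc
  set s := Real.sin θ with hs
  have hcs : c ^ 2 + s ^ 2 = 1 := Real.cos_sq_add_sin_sq θ
  have hw := w.im_pos
  have hz := z.im_pos
  set x := w.re with hx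
  set y := w.im with hy
  set n := (c - s * x) ^ 2 + s ^ 2 * y ^ 2 with hn
  have hn0 : 0 < n := by
    rcases eq_or_ne s 0 with h | h
    · have : c ^ 2 = 1 := by rw [h] at hcs; linarith
      rw [hn, h]; nlinarith
    · have : 0 < s ^ 2 * y ^ 2 := by positivity
      nlinarith [sq_nonneg (c - s * x)]
  have hden : (-s * (w : ℂ) + c : ℂ) = ⟨c - s * x, -(s * y)⟩ := by
    apply Complex.ext
    · simp [hx]; ring
    · simp [hy]
  have hnum : (c * (w : ℂ) + s : ℂ) = ⟨c * x + s, c * y⟩ := by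
    apply Complex.ext
    · simp [hx]
    · simp [hy]
  have hns : Complex.normSq ⟨c - s * x, -(s * y)⟩ = n := by
    rw [Complex.normSq_mk, hn]; ring
  have hre : (rot θ • w).re = ((c * x + s) * (c - s * x) - c * s * y ^ 2) / n := by
    rw [← coe_re, coe_rot_smul, hnum, hden, Complex.div_re, hns]
    simp only
    field_simp
    ring
  have him : (rot θ • w).im = y / n := by
    rw [← coe_im, coe_rot_smul, hnum, hden, Complex.div_im, hns]
    simp only
    field_simp
    linear_combination hcs
  have hc2 : Real.cos (2 * θ) = c ^ 2 - s ^ 2 := by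
    rw [Real.cos_two_mul, ← hc]; linear_combination hcs
  have hs2 : Real.sin (2 * θ) = 2 * s * c := Real.sin_two_mul θ
  rw [coshDist_eq, hre, him, hc2, hs2, coshDist_I, coshDist_I]
  have key : (z.re - ((c * x + s) * (c - s * x) - c * s * y ^ 2) / n) ^ 2 + (z.im - y / n) ^ 2 =
      ((z.re ^ 2 + z.im ^ 2) * n - 2 * z.re * ((c * x + s) * (c - s * x) - c * s * y ^ 2)
        + ((c * x + s) ^ 2 + c ^ 2 * y ^ 2) - 2 * z.im * y) / n := by
    have h2 : ((c * x + s) * (c - s * x) - c * s * y ^ 2) ^ 2 + y ^ 2 =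
        n * ((c * x + s) ^ 2 + c ^ 2 * y ^ 2) := by
      rw [hn]
      linear_combination (-y ^ 2 * (c ^ 2 + s ^ 2 + 1)) * hcs
    field_simp
    linear_combination h2
  have key2 : (z.re ^ 2 + z.im ^ 2) * n - 2 * z.re * ((c * x + s) * (c - s * x) - c * s * y ^ 2)
        + ((c * x + s) ^ 2 + c ^ 2 * y ^ 2) = (1 + z.re ^ 2 + z.im ^ 2) * (1 + x ^ 2 + y ^ 2) / 2
      - ((c ^ 2 - s ^ 2) * ((z.re ^ 2 + z.im ^ 2 - 1) * (x ^ 2 + y ^ 2 - 1) / 2 + 2 * z.re * x)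
      + 2 * s * c * ((z.re ^ 2 + z.im ^ 2 - 1) * x - z.re * (x ^ 2 + y ^ 2 - 1))) := by
    rw [hn]
    linear_combination ((1 + z.re ^ 2 + z.im ^ 2) * (1 + x ^ 2 + y ^ 2) / 2) * hcs
  rw [key, key2]
  field_simp
  ring

/-- The two trigonometric coefficients form a complex number `u`, with phase `γ = arg u` and
amplitude `q = |u|`. Geometrically `q = sinh r sinh r'`; only `q ≤ cosh r cosh r'` is needed. -/
lemma exists_angle_coshDist_rot (z w : ℍ) : ∃ γ q : ℝ, 0 ≤ q ∧ q ≤ coshDist I z * coshDist I w ∧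
    ∀ θ : ℝ, coshDist z (rot (θ / 2) • w) =
      coshDist I z * coshDist I w - q * Real.cos (θ - γ) := by
  set u : ℂ := ⟨((z.re ^ 2 + z.im ^ 2 - 1) * (w.re ^ 2 + w.im ^ 2 - 1) / 2
        + 2 * z.re * w.re) / (2 * z.im * w.im), ((z.re ^ 2 + z.im ^ 2 - 1) * w.re
        - z.re * (w.re ^ 2 + w.im ^ 2 - 1)) / (2 * z.im * w.im)⟩ with hu
  have hz := z.im_pos
  have hw := w.im_pos
  refine ⟨u.arg, ‖u‖, norm_nonneg _, ?_, fun θ => ?_⟩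
  · refine abs_le_of_sq_le_sq' ?_ (mul_pos (coshDist_pos _ _) (coshDist_pos _ _)).le |>.2
    rw [Complex.sq_norm, Complex.normSq_mk, coshDist_I, coshDist_I]
    have e : ∀ A B D E : ℝ, A / D * (A / D) + B / D * (B / D) ≤ (E / D) ^ 2 ↔
        (A * A + B * B) / (D * D) ≤ E * E / (D * D) := fun A B D E => by
      rw [sq, div_mul_div_comm, div_mul_div_comm, div_mul_div_comm, ← add_div]
    have e2 : (1 + z.re ^ 2 + z.im ^ 2) / (2 * z.im) * ((1 + w.re ^ 2 + w.im ^ 2) / (2 * w.im)) =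
        ((1 + z.re ^ 2 + z.im ^ 2) * (1 + w.re ^ 2 + w.im ^ 2) / 2) / (2 * z.im * w.im) := by
      field_simp
    rw [e2, e]
    gcongr
    have h1 : (0 : ℝ) ≤ z.im ^ 2 := sq_nonneg _
    have h2 : (0 : ℝ) ≤ w.im ^ 2 := sq_nonneg _
    have h3 : (z.re ^ 2 + z.im ^ 2 - 1) ^ 2 + 4 * z.re ^ 2 ≤ (1 + z.re ^ 2 + z.im ^ 2) ^ 2 := by
      nlinarith
    have h4 : (w.re ^ 2 + w.im ^ 2 - 1) ^ 2 + 4 * w.re ^ 2 ≤ (1 + w.re ^ 2 + w.im ^ 2) ^ 2 := by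
      nlinarith
    have h5 := mul_le_mul h3 h4 (by positivity) (by positivity)
    linarith
  · rw [coshDist_rot_smul, Real.cos_sub]
    have h1 : ‖u‖ * Real.cos u.arg = u.re := Complex.norm_mul_cos_arg u
    have h2 : ‖u‖ * Real.sin u.arg = u.im := Complex.norm_mul_sin_arg u
    have h3 : 2 * (θ / 2) = θ := by ring
    rw [h3]
    have : u.re = ((z.re ^ 2 + z.im ^ 2 - 1) * (w.re ^ 2 + w.im ^ 2 - 1) / 2
        + 2 * z.re * w.re) / (2 * z.im * w.im) := rfl
    rw [← this, ← h1]
    have : u.im = ((z.re ^ 2 + z.im ^ 2 - 1) * w.re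
        - z.re * (w.re ^ 2 + w.im ^ 2 - 1)) / (2 * z.im * w.im) := rfl
    rw [← this, ← h2]
    ring

lemma intervalIntegrable_abs_rpow {δ : ℝ} (h1 : δ < 1) :
    IntervalIntegrable (fun θ : ℝ => (θ ^ 2 / Real.pi ^ 2) ^ (-(δ / 2))) volume
      (-Real.pi) Real.pi := by
  have hpos : IntervalIntegrable (fun θ : ℝ => (θ ^ 2 / Real.pi ^ 2) ^ (-(δ / 2))) volume
      0 Real.pi := by
    have := (intervalIntegral.intervalIntegrable_rpow' (r := -δ) (by linarith) (a := 0)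
      (b := Real.pi)).mul_const ((Real.pi ^ 2)⁻¹ ^ (-(δ / 2)))
    refine this.congr fun θ hθ => ?_
    rw [Set.uIoc_of_le Real.pi_pos.le] at hθ
    have h0 : 0 ≤ θ := hθ.1.le
    rw [div_eq_mul_inv (θ ^ 2), Real.mul_rpow (by positivity) (by positivity), ← Real.rpow_natCast θ 2,
      ← Real.rpow_mul h0]
    congr 2
    push_cast
    ring
  have hneg : IntervalIntegrable (fun θ : ℝ => (θ ^ 2 / Real.pi ^ 2) ^ (-(δ / 2))) volume
      (-Real.pi) 0 := by
    have := (IntervalIntegrable.iff_comp_neg (by simp)).1 hpos.symm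
    simpa using this
  exact hneg.trans hpos

lemma continuous_coshDist_rot (z : ℍ) :
    Continuous fun p : ℝ × ℍ => coshDist z (rot (p.1 / 2) • p.2) := by
  have h1 : Continuous fun p : ℝ × ℍ => p.2.re := continuous_re.comp continuous_snd
  have h2 : Continuous fun p : ℝ × ℍ => p.2.im := continuous_im.comp continuous_snd
  have h3 : Continuous fun p : ℝ × ℍ => coshDist I p.2 :=
    (continuous_coshDist.comp (Continuous.prodMk_right I)).comp continuous_snd
  have h4 : Continuous fun p : ℝ × ℍ => (2 * z.im * p.2.im)⁻¹ :=
    (continuous_const.mul h2).inv₀ fun p =>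
      mul_ne_zero (mul_ne_zero two_ne_zero z.im_ne_zero) p.2.im_ne_zero
  have h5 : Continuous fun p : ℝ × ℍ => Real.cos (2 * (p.1 / 2)) := by fun_prop
  have h6 : Continuous fun p : ℝ × ℍ => Real.sin (2 * (p.1 / 2)) := by fun_prop
  simp_rw [coshDist_rot_smul, div_eq_mul_inv] at h5 h6 ⊢
  refine (continuous_const.mul h3).sub ((h5.mul (Continuous.mul ?_ h4)).add
    (h6.mul (Continuous.mul ?_ h4)))
  · exact ((continuous_const.mul (((h1.pow 2).add (h2.pow 2)).sub continuous_const)).mul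
      continuous_const).add (continuous_const.mul h1)
  · exact (continuous_const.mul h1).sub
      (continuous_const.mul (((h1.pow 2).add (h2.pow 2)).sub continuous_const))

lemma exists_integral_coshDist_rot_le {δ : ℝ} (h0 : 0 < δ) (h1 : δ < 1) : ∃ C, 0 < C ∧ ∀ z w : ℍ,
    ∫ θ in (-Real.pi)..Real.pi, coshDist z (rot (θ / 2) • w) ^ (-(δ / 2)) ≤
      C * (coshDist I z ^ (-(δ / 2)) * coshDist I w ^ (-(δ / 2))) := by
  have hpi := Real.pi_pos
  have hnn : 0 ≤ ∫ θ in (-Real.pi)..Real.pi, (θ ^ 2 / Real.pi ^ 2) ^ (-(δ / 2)) :=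
    intervalIntegral.integral_nonneg (by linarith) fun θ _ => by positivity
  refine ⟨(∫ θ in (-Real.pi)..Real.pi, (θ ^ 2 / Real.pi ^ 2) ^ (-(δ / 2))) + 1, by linarith,
    fun z w => ?_⟩
  obtain ⟨γ, q, hq0, hq1, hq⟩ := exists_angle_coshDist_rot z w
  set X := coshDist I z * coshDist I w with hX
  have hX0 : 0 < X := mul_pos (coshDist_pos _ _) (coshDist_pos _ _)
  have hper : Function.Periodic (fun θ => (X - q * Real.cos θ) ^ (-(δ / 2))) (2 * Real.pi) :=
    fun θ => by simp only [Real.cos_periodic θ]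
  have e1 : ∫ θ in (-Real.pi)..Real.pi, coshDist z (rot (θ / 2) • w) ^ (-(δ / 2)) =
      ∫ θ in (-Real.pi)..Real.pi, (X - q * Real.cos θ) ^ (-(δ / 2)) := by
    simp_rw [hq]
    rw [intervalIntegral.integral_comp_sub_right (fun θ => (X - q * Real.cos θ) ^ (-(δ / 2))) γ]
    have := hper.intervalIntegral_add_eq (-Real.pi - γ) (-Real.pi)
    rwa [show -Real.pi - γ + 2 * Real.pi = Real.pi - γ by ring,
      show -Real.pi + 2 * Real.pi = Real.pi by ring] at this
  have hle : ∀ θ ∈ Set.Icc (-Real.pi) Real.pi, θ ≠ 0 → (X - q * Real.cos θ) ^ (-(δ / 2)) ≤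
      X ^ (-(δ / 2)) * (θ ^ 2 / Real.pi ^ 2) ^ (-(δ / 2)) := by
    intro θ hθ hne
    have hcos := Real.cos_le_one_sub_mul_cos_sq (abs_le.2 hθ)
    have hc1 : Real.cos θ ≤ 1 := Real.cos_le_one θ
    have hpos : 0 < θ ^ 2 / Real.pi ^ 2 := by positivity
    have hb : X * (θ ^ 2 / Real.pi ^ 2) ≤ X - q * Real.cos θ := by
      have h2 : θ ^ 2 / Real.pi ^ 2 ≤ (1 - Real.cos θ) / 2 := by
        have : 2 / Real.pi ^ 2 * θ ^ 2 = 2 * (θ ^ 2 / Real.pi ^ 2) := by ring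
        linarith
      -- If `cos θ ≥ 0`, `q ≤ X` gives even `X (1 - cos θ)`. If `cos θ ≤ 0`, the right side is at
      -- least `X`, and `(1 - cos θ) / 2 ≤ 1`.
      have h3 : X * ((1 - Real.cos θ) / 2) ≤ X - q * Real.cos θ := by
        rcases le_total 0 (Real.cos θ) with h | h
        · nlinarith [mul_le_mul_of_nonneg_right hq1 h]
        · nlinarith [mul_nonneg hq0 (neg_nonneg.2 h), Real.neg_one_le_cos θ]
      exact (mul_le_mul_of_nonneg_left h2 hX0.le).trans h3
    rw [← Real.mul_rpow hX0.le hpos.le]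
    exact Real.rpow_le_rpow_of_nonpos (by positivity) hb (by linarith)
  have hint : IntervalIntegrable (fun θ => coshDist z (rot (θ / 2) • w) ^ (-(δ / 2))) volume
      (-Real.pi) Real.pi := by
    refine Continuous.intervalIntegrable ?_ _ _
    exact ((continuous_coshDist_rot z).comp (Continuous.prodMk_left w)).rpow_const
      fun θ => Or.inl (coshDist_pos _ _).ne'
  have hint2 : IntervalIntegrable (fun θ => (X - q * Real.cos θ) ^ (-(δ / 2))) volume
      (-Real.pi) Real.pi := by
    refine Continuous.intervalIntegrable ?_ _ _
    refine Continuous.rpow_const (by fun_prop) fun θ => Or.inl ?_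
    have := hq (θ + γ)
    rw [add_sub_cancel_right] at this
    rw [← this]
    exact (coshDist_pos _ _).ne'
  rw [e1]
  have e2 : ∫ θ in (-Real.pi)..Real.pi, (X - q * Real.cos θ) ^ (-(δ / 2)) ≤
      ∫ θ in (-Real.pi)..Real.pi, X ^ (-(δ / 2)) * (θ ^ 2 / Real.pi ^ 2) ^ (-(δ / 2)) := by
    refine intervalIntegral.integral_mono_ae_restrict (by linarith) hint2
      ((intervalIntegrable_abs_rpow h1).const_mul _) ?_
    have : ∀ᵐ θ ∂(volume.restrict (Set.Icc (-Real.pi) Real.pi)), θ ≠ 0 :=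
      ae_restrict_of_ae (Measure.ae_ne volume 0)
    filter_upwards [this, ae_restrict_mem measurableSet_Icc] with θ h2 h3 using hle θ h3 h2
  rw [intervalIntegral.integral_const_mul, Real.mul_rpow (coshDist_pos _ _).le
    (coshDist_pos _ _).le, mul_comm] at e2
  refine e2.trans ?_
  have : 0 ≤ coshDist I z ^ (-(δ / 2)) * coshDist I w ^ (-(δ / 2)) := by
    have := coshDist_pos I z
    have := coshDist_pos I w
    positivity
  exact mul_le_mul_of_nonneg_right (by linarith) this

/-- Averaging over the rotations: the basic inequality for radial functions. -/
lemma exists_integral_radial_le {δ : ℝ} (h0 : 0 < δ) (h1 : δ < 1) : ∃ C, 0 < C ∧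
    ∀ φ : ℍ → ℂ, Integrable φ → IsRadial φ → ∀ z : ℍ,
      ∫ w, coshDist z w ^ (-(δ / 2)) * ‖φ w‖ ≤
        C * coshDist I z ^ (-(δ / 2)) * ∫ w, coshDist I w ^ (-(δ / 2)) * ‖φ w‖ := by
  obtain ⟨C, hC, hCb⟩ := exists_integral_coshDist_rot_le h0 h1
  refine ⟨C, hC, fun φ hφ hrad z => ?_⟩
  have hpi := Real.pi_pos
  have hle1 : ∀ u v : ℍ, ‖coshDist u v ^ (-(δ / 2))‖ ≤ 1 := fun u v => by
    rw [Real.norm_of_nonneg (Real.rpow_nonneg (coshDist_pos _ _).le _)]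
    exact Real.rpow_le_one_of_one_le_of_nonpos (one_le_coshDist _ _) (by linarith)
  obtain ⟨f, hf⟩ := hrad
  -- Rotations preserve the area and fix the origin, hence leave a radial `φ` unchanged almost
  -- everywhere and can be moved entirely onto the kernel.
  have hrot : ∀ θ : ℝ, ∫ w, coshDist z w ^ (-(δ / 2)) * ‖φ w‖ =
      ∫ w, coshDist z (rot (θ / 2) • w) ^ (-(δ / 2)) * ‖φ w‖ := by
    intro θ
    rw [← (measurePreserving_SL (rot (θ / 2))).integral_comp (measurableEmbedding_SL _)]
    refine integral_congr_ae ?_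
    have h2 := (measurePreserving_SL (rot (θ / 2))).quasiMeasurePreserving.ae_eq_comp hf
    filter_upwards [hf, h2] with w hw1 hw2
    have h3 : radius (rot (θ / 2) • w) = radius w := by
      rw [radius]
      conv_lhs => rw [← rot_smul_I (θ / 2)]
      rw [dist_smul, radius]
    simp only [Function.comp] at hw2
    rw [hw2, h3, ← hw1]
  have hcont : Continuous fun p : ℝ × ℍ => coshDist z (rot (p.1 / 2) • p.2) ^ (-(δ / 2)) :=
    (continuous_coshDist_rot z).rpow_const fun θ => Or.inl (coshDist_pos _ _).ne'
  set ν := volume.restrict (Set.Ioc (-Real.pi) Real.pi) with hν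
  have hprod : Integrable (fun p : ℝ × ℍ => coshDist z (rot (p.1 / 2) • p.2) ^ (-(δ / 2)) * ‖φ p.2‖)
      (ν.prod volume) := by
    refine Integrable.bdd_mul (c := 1) ?_ hcont.aestronglyMeasurable
      (Eventually.of_forall fun p => hle1 _ _)
    exact hφ.norm.comp_snd ν
  have e1 : (2 * Real.pi) * ∫ w, coshDist z w ^ (-(δ / 2)) * ‖φ w‖ =
      ∫ w, (∫ θ in (-Real.pi)..Real.pi, coshDist z (rot (θ / 2) • w) ^ (-(δ / 2))) * ‖φ w‖ := by
    calc _ = ∫ θ, (∫ w, coshDist z w ^ (-(δ / 2)) * ‖φ w‖) ∂ν := by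
          rw [integral_const, hν]
          simp [Measure.real]
          left
          rw [ENNReal.toReal_ofReal (by linarith)]
          ring
      _ = ∫ θ, (∫ w, coshDist z (rot (θ / 2) • w) ^ (-(δ / 2)) * ‖φ w‖) ∂ν :=
          integral_congr_ae (Eventually.of_forall hrot)
      _ = ∫ w, (∫ θ, coshDist z (rot (θ / 2) • w) ^ (-(δ / 2)) * ‖φ w‖ ∂ν) :=
          integral_integral_swap hprod
      _ = _ := by
          refine integral_congr_ae (Eventually.of_forall fun w => ?_)
          simp only
          rw [integral_mul_const, intervalIntegral.integral_of_le (by linarith)]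
  have hci : Integrable fun w => coshDist I w ^ (-(δ / 2)) * ‖φ w‖ := by
    refine Integrable.bdd_mul (c := 1) hφ.norm ?_ (Eventually.of_forall fun p => hle1 _ _)
    refine Continuous.aestronglyMeasurable ?_
    exact (continuous_coshDist.comp (Continuous.prodMk_right I)).rpow_const
      fun θ => Or.inl (coshDist_pos _ _).ne'
  have e2 : (2 * Real.pi) * ∫ w, coshDist z w ^ (-(δ / 2)) * ‖φ w‖ ≤
      ∫ w, (C * coshDist I z ^ (-(δ / 2))) * (coshDist I w ^ (-(δ / 2)) * ‖φ w‖) := by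
    rw [e1]
    refine integral_mono_of_nonneg (Eventually.of_forall fun w => ?_) (hci.const_mul _)
      (Eventually.of_forall fun w => ?_)
    · refine mul_nonneg (intervalIntegral.integral_nonneg (by linarith) fun θ _ => ?_)
        (norm_nonneg _)
      exact Real.rpow_nonneg (coshDist_pos _ _).le _
    · calc _ ≤ (C * (coshDist I z ^ (-(δ / 2)) * coshDist I w ^ (-(δ / 2)))) * ‖φ w‖ :=
          mul_le_mul_of_nonneg_right (hCb z w) (norm_nonneg _)
        _ = _ := by ring
  rw [integral_const_mul] at e2
  have h3 : 0 ≤ ∫ w, coshDist z w ^ (-(δ / 2)) * ‖φ w‖ :=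
    integral_nonneg fun w => mul_nonneg (Real.rpow_nonneg (coshDist_pos _ _).le _) (norm_nonneg _)
  nlinarith [Real.pi_gt_three]

/-! ### Convolution with radial kernels on `L¹`, and its values in `L²`. -/

/-- The operator with kernel `k (cosh d(z, w))`. -/
noncomputable def conv (k : ℝ → ℂ) (φ : ℍ → ℂ) (z : ℍ) : ℂ := ∫ w, k (coshDist z w) * φ w

/-- Bounded continuous radial kernels. -/
structure IsBddKernel (k : ℝ → ℂ) (B : ℝ) : Prop where
  cont : ContinuousOn k (Set.Ici 1)
  bound : ∀ ρ, 1 ≤ ρ → ‖k ρ‖ ≤ B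

/-- Continuous radial kernels with quadratic decay. -/
structure IsKernel (k : ℝ → ℂ) (M : ℝ) : Prop where
  cont : ContinuousOn k (Set.Ici 1)
  bound : ∀ ρ, 1 ≤ ρ → ‖k ρ‖ ≤ M / ρ ^ 2

lemma IsKernel.nonneg {k : ℝ → ℂ} {M : ℝ} (hk : IsKernel k M) : 0 ≤ M := by
  have := (norm_nonneg _).trans (hk.bound 1 le_rfl)
  simpa using this

lemma IsKernel.isBddKernel {k : ℝ → ℂ} {M : ℝ} (hk : IsKernel k M) : IsBddKernel k M where
  cont := hk.cont
  bound ρ hρ := (hk.bound ρ hρ).trans (div_le_self hk.nonneg (one_le_pow₀ hρ))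

lemma continuous_kernel {k : ℝ → ℂ} (hk : ContinuousOn k (Set.Ici 1)) :
    Continuous fun p : ℍ × ℍ => k (coshDist p.1 p.2) :=
  hk.comp_continuous continuous_coshDist fun p => one_le_coshDist p.1 p.2

lemma IsBddKernel.integrable_mul {k : ℝ → ℂ} {B : ℝ} (hk : IsBddKernel k B) {φ : ℍ → ℂ}
    (hφ : Integrable φ) (z : ℍ) : Integrable fun w => k (coshDist z w) * φ w :=
  hφ.bdd_mul (c := B)
    ((continuous_kernel hk.cont).comp (Continuous.prodMk_right z)).aestronglyMeasurable
    (Eventually.of_forall fun w => hk.bound _ (one_le_coshDist z w))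

lemma IsBddKernel.norm_conv_le {k : ℝ → ℂ} {B : ℝ} (hk : IsBddKernel k B) {φ : ℍ → ℂ}
    (hφ : Integrable φ) (z : ℍ) : ‖conv k φ z‖ ≤ B * ∫ w, ‖φ w‖ := by
  rw [← integral_const_mul]
  refine norm_integral_le_of_norm_le (hφ.norm.const_mul B) (Eventually.of_forall fun w => ?_)
  rw [norm_mul]
  exact mul_le_mul_of_nonneg_right (hk.bound _ (one_le_coshDist z w)) (norm_nonneg _)

lemma IsBddKernel.continuous_conv {k : ℝ → ℂ} {B : ℝ} (hk : IsBddKernel k B) {φ : ℍ → ℂ}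
    (hφ : Integrable φ) : Continuous (conv k φ) := by
  refine continuous_of_dominated (bound := fun w => B * ‖φ w‖)
    (fun z => (hk.integrable_mul hφ z).aestronglyMeasurable)
    (fun z => Eventually.of_forall fun w => ?_) (hφ.norm.const_mul B)
    (Eventually.of_forall fun w => ?_)
  · rw [norm_mul]
    exact mul_le_mul_of_nonneg_right (hk.bound _ (one_le_coshDist z w)) (norm_nonneg _)
  · exact ((continuous_kernel hk.cont).comp (Continuous.prodMk_left w)).mul continuous_const

/-- The kernel is symmetric in its two points, so Fubini makes the operator its own transpose for
the bilinear pairing. -/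
lemma IsBddKernel.integral_conv_mul {k : ℝ → ℂ} {B : ℝ} (hk : IsBddKernel k B) {φ ψ : ℍ → ℂ}
    (hφ : Integrable φ) (hψ : Integrable ψ) :
    ∫ z, conv k φ z * ψ z = ∫ z, φ z * conv k ψ z := by
  have hprod : Integrable (fun p : ℍ × ℍ => k (coshDist p.1 p.2) * (ψ p.1 * φ p.2))
      (volume.prod volume) :=
    (hψ.mul_prod hφ).bdd_mul (c := B) (continuous_kernel hk.cont).aestronglyMeasurable
      (Eventually.of_forall fun p => hk.bound _ (one_le_coshDist p.1 p.2))
  have e1 : ∀ z, conv k φ z * ψ z = ∫ w, k (coshDist z w) * (ψ z * φ w) := fun z => by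
    rw [conv, ← integral_mul_const]
    congr with w
    ring
  have e2 : ∀ w, φ w * conv k ψ w = ∫ z, k (coshDist z w) * (ψ z * φ w) := fun w => by
    rw [conv, ← integral_const_mul]
    congr with z
    rw [coshDist_comm]
    ring
  simp_rw [e1, e2]
  exact integral_integral_swap hprod

lemma integrable_one_div_coshDist_sq (z : ℍ) : Integrable (fun w => 1 / coshDist z w ^ 2) ∧
    ∫ w, 1 / coshDist z w ^ 2 = areaConst := by
  have hc : Continuous fun w => 1 / coshDist z w ^ 2 :=
    continuous_const.div ((continuous_coshDist.comp (Continuous.prodMk_right z)).pow 2)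
      fun w => pow_ne_zero _ (coshDist_pos z w).ne'
  have h0 : ∀ w, 0 ≤ 1 / coshDist z w ^ 2 := fun w => by positivity
  have hi : Integrable (fun w => 1 / coshDist z w ^ 2) := by
    refine ⟨hc.aestronglyMeasurable, ?_⟩
    rw [hasFiniteIntegral_iff_ofReal (Eventually.of_forall h0), lintegral_coshDist_sq]
    exact ENNReal.ofReal_lt_top
  refine ⟨hi, ?_⟩
  rw [integral_eq_lintegral_of_nonneg_ae (Eventually.of_forall h0) hc.aestronglyMeasurable,
    lintegral_coshDist_sq, ENNReal.toReal_ofReal areaConst_nonneg]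

lemma IsKernel.integrable_kernel {k : ℝ → ℂ} {M : ℝ} (hk : IsKernel k M) (w : ℍ) :
    Integrable (fun z => k (coshDist z w)) ∧ ∫ z, ‖k (coshDist z w)‖ ≤ M * areaConst := by
  obtain ⟨h1, h2⟩ := integrable_one_div_coshDist_sq w
  have hle : ∀ z, ‖k (coshDist z w)‖ ≤ M * (1 / coshDist w z ^ 2) := fun z => by
    rw [mul_one_div, coshDist_comm w z]
    exact hk.bound _ (one_le_coshDist z w)
  have hi : Integrable (fun z => k (coshDist z w)) :=
    (h1.const_mul M).mono'
      ((continuous_kernel hk.cont).comp (Continuous.prodMk_left w)).aestronglyMeasurable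
      (Eventually.of_forall hle)
  refine ⟨hi, ?_⟩
  calc _ ≤ ∫ z, M * (1 / coshDist w z ^ 2) := integral_mono hi.norm (h1.const_mul M) hle
    _ = _ := by rw [integral_const_mul, h2]

lemma IsKernel.integrable_prod {k : ℝ → ℂ} {M : ℝ} (hk : IsKernel k M) {φ : ℍ → ℂ}
    (hφ : Integrable φ) :
    Integrable (fun p : ℍ × ℍ => k (coshDist p.1 p.2) * φ p.2) (volume.prod volume) := by
  have hm : AEStronglyMeasurable (fun p : ℍ × ℍ => k (coshDist p.1 p.2) * φ p.2)
      (volume.prod volume) :=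
    (continuous_kernel hk.cont).aestronglyMeasurable.mul hφ.aestronglyMeasurable.comp_snd
  have hle : ∀ w : ℍ, ∫ z, ‖k (coshDist z w) * φ w‖ ≤ M * areaConst * ‖φ w‖ := fun w => by
    simp_rw [norm_mul]
    rw [integral_mul_const]
    exact mul_le_mul_of_nonneg_right (hk.integrable_kernel w).2 (norm_nonneg _)
  have hm2 : AEStronglyMeasurable (fun w : ℍ => ∫ z, ‖k (coshDist z w) * φ w‖) volume :=
    AEStronglyMeasurable.integral_prod_right' (f := fun q : ℍ × ℍ => ‖k (coshDist q.2 q.1) * φ q.1‖)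
      (AEStronglyMeasurable.prod_swap hm.norm)
  have h1 : ∀ w : ℍ, Integrable fun z => k (coshDist z w) * φ w := fun w =>
    (hk.integrable_kernel w).1.mul_const _
  have h2 : Integrable fun w : ℍ => ∫ z, ‖k (coshDist z w) * φ w‖ := by
    refine (hφ.norm.const_mul (M * areaConst)).mono' hm2 (Eventually.of_forall fun w => ?_)
    rw [Real.norm_of_nonneg (integral_nonneg fun z => norm_nonneg _)]
    exact hle w
  exact (integrable_prod_iff' hm).2 ⟨Eventually.of_forall h1, h2⟩

lemma IsKernel.integrable_conv {k : ℝ → ℂ} {M : ℝ} (hk : IsKernel k M) {φ : ℍ → ℂ}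
    (hφ : Integrable φ) : Integrable (conv k φ) :=
  (hk.integrable_prod hφ).integral_prod_left

lemma IsKernel.integral_norm_conv_le {k : ℝ → ℂ} {M : ℝ} (hk : IsKernel k M) {φ : ℍ → ℂ}
    (hφ : Integrable φ) : ∫ z, ‖conv k φ z‖ ≤ M * areaConst * ∫ w, ‖φ w‖ := by
  have hp := (hk.integrable_prod hφ).norm
  calc ∫ z, ‖conv k φ z‖ ≤ ∫ z, ∫ w, ‖k (coshDist z w) * φ w‖ :=
        integral_mono (hk.integrable_conv hφ).norm hp.integral_prod_left
          fun z => norm_integral_le_integral_norm _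
    _ = ∫ w, ∫ z, ‖k (coshDist z w) * φ w‖ := integral_integral_swap hp
    _ ≤ ∫ w, M * areaConst * ‖φ w‖ := by
        refine integral_mono hp.integral_prod_right (hφ.norm.const_mul _) fun w => ?_
        simp only
        simp_rw [norm_mul]
        rw [integral_mul_const]
        exact mul_le_mul_of_nonneg_right (hk.integrable_kernel w).2 (norm_nonneg _)
    _ = _ := integral_const_mul _ _

/-- From `|g| ^ 2 ≤ A |g|`. With the sup and `L¹` bounds for convolutions it puts them in `L²`, with
a norm linear in the decay constant of the kernel. -/
lemma eLpNorm_two_le_of_bounded {g : ℍ → ℂ} {A B : ℝ} (hg : Integrable g)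
    (hA : ∀ z, ‖g z‖ ≤ A) (hB : ∫ z, ‖g z‖ ≤ B) :
    eLpNorm g 2 volume ≤ ENNReal.ofReal (√(A * B)) := by
  have hA0 : 0 ≤ A := (norm_nonneg _).trans (hA I)
  rw [eLpNorm_eq_lintegral_rpow_enorm_toReal two_ne_zero ENNReal.ofNat_ne_top]
  have h1 : ∫⁻ z, ‖g z‖ₑ ^ (2 : ENNReal).toReal ≤ ENNReal.ofReal (A * B) := by
    calc _ ≤ ∫⁻ z, ENNReal.ofReal A * ‖g z‖ₑ := by
          refine lintegral_mono fun z => ?_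
          simp only [ENNReal.toReal_ofNat, ENNReal.rpow_ofNat, sq]
          gcongr
          rw [← ofReal_norm]
          exact ENNReal.ofReal_le_ofReal (hA z)
      _ = ENNReal.ofReal A * ENNReal.ofReal (∫ z, ‖g z‖) := by
          rw [lintegral_const_mul' _ _ ENNReal.ofReal_ne_top, ofReal_integral_norm_eq_lintegral_enorm hg]
      _ ≤ _ := by
          rw [ENNReal.ofReal_mul hA0]
          gcongr
  calc _ ≤ (ENNReal.ofReal (A * B)) ^ (1 / (2 : ENNReal).toReal) := by gcongr
    _ = _ := by
        have h2 : 0 ≤ A * B :=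
          mul_nonneg hA0 ((integral_nonneg fun z => norm_nonneg _).trans hB)
        rw [ENNReal.ofReal_rpow_of_nonneg h2 (by norm_num), Real.sqrt_eq_rpow]
        norm_num

lemma IsKernel.eLpNorm_conv_le {k : ℝ → ℂ} {M : ℝ} (hk : IsKernel k M) {φ : ℍ → ℂ}
    (hφ : Integrable φ) :
    eLpNorm (conv k φ) 2 volume ≤ ENNReal.ofReal (M * (√areaConst * ∫ w, ‖φ w‖)) := by
  refine (eLpNorm_two_le_of_bounded (hk.integrable_conv hφ) (hk.isBddKernel.norm_conv_le hφ)
    (hk.integral_norm_conv_le hφ)).trans_eq ?_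
  congr 1
  have h0 : 0 ≤ ∫ w, ‖φ w‖ := integral_nonneg fun w => norm_nonneg _
  rw [show M * (∫ w, ‖φ w‖) * (M * areaConst * ∫ w, ‖φ w‖) =
    (M * ∫ w, ‖φ w‖) ^ 2 * areaConst by ring, Real.sqrt_mul (sq_nonneg _),
    Real.sqrt_sq (mul_nonneg hk.nonneg h0)]
  ring

lemma IsKernel.memLp_conv {k : ℝ → ℂ} {M : ℝ} (hk : IsKernel k M) {φ : ℍ → ℂ}
    (hφ : Integrable φ) : MemLp (conv k φ) 2 volume :=
  ⟨(hk.integrable_conv hφ).aestronglyMeasurable,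
    (hk.eLpNorm_conv_le hφ).trans_lt ENNReal.ofReal_lt_top⟩

open Classical in
/-- `conv k φ` as an element of `L²`. -/
noncomputable def convLp (k : ℝ → ℂ) (φ : ℍ → ℂ) : Lp ℂ 2 (volume : Measure ℍ) :=
  if h : MemLp (conv k φ) 2 volume then h.toLp else 0

lemma IsKernel.convLp_ae {k : ℝ → ℂ} {M : ℝ} (hk : IsKernel k M) {φ : ℍ → ℂ}
    (hφ : Integrable φ) : convLp k φ =ᵐ[volume] conv k φ := by
  rw [convLp, dif_pos (hk.memLp_conv hφ)]
  exact MemLp.coeFn_toLp _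

lemma IsKernel.norm_convLp_le {k : ℝ → ℂ} {M : ℝ} (hk : IsKernel k M) {φ : ℍ → ℂ}
    (hφ : Integrable φ) : ‖convLp k φ‖ ≤ M * (√areaConst * ∫ w, ‖φ w‖) := by
  rw [Lp.norm_def, eLpNorm_congr_ae (hk.convLp_ae hφ)]
  refine ENNReal.toReal_le_of_le_ofReal ?_ (hk.eLpNorm_conv_le hφ)
  exact mul_nonneg hk.nonneg (mul_nonneg (Real.sqrt_nonneg _) (integral_nonneg fun w => norm_nonneg _))

lemma IsKernel.sub {k k' : ℝ → ℂ} {M M' : ℝ} (hk : IsKernel k M) (hk' : IsKernel k' M') :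
    IsKernel (fun ρ => k ρ - k' ρ) (M + M') where
  cont := hk.cont.sub hk'.cont
  bound ρ hρ := (norm_sub_le _ _).trans (by
    rw [add_div]; exact add_le_add (hk.bound ρ hρ) (hk'.bound ρ hρ))

lemma IsKernel.const_mul {k : ℝ → ℂ} {M : ℝ} (hk : IsKernel k M) (c : ℂ) :
    IsKernel (fun ρ => c * k ρ) (‖c‖ * M) where
  cont := continuousOn_const.mul hk.cont
  bound ρ hρ := by
    rw [norm_mul, mul_div_assoc]
    exact mul_le_mul_of_nonneg_left (hk.bound ρ hρ) (norm_nonneg _)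

lemma IsBddKernel.conv_sub {k k' : ℝ → ℂ} {M M' : ℝ} (hk : IsBddKernel k M)
    (hk' : IsBddKernel k' M') {φ : ℍ → ℂ} (hφ : Integrable φ) (z : ℍ) :
    conv (fun ρ => k ρ - k' ρ) φ z = conv k φ z - conv k' φ z := by
  rw [conv, conv, conv, ← integral_sub (hk.integrable_mul hφ z) (hk'.integrable_mul hφ z)]
  congr with w
  ring

lemma conv_const_mul (c : ℂ) (k : ℝ → ℂ) (φ : ℍ → ℂ) (z : ℍ) :
    conv (fun ρ => c * k ρ) φ z = c * conv k φ z := by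
  rw [conv, conv, ← integral_const_mul]
  congr with w
  ring

lemma IsKernel.convLp_sub {k k' : ℝ → ℂ} {M M' : ℝ} (hk : IsKernel k M)
    (hk' : IsKernel k' M') {φ : ℍ → ℂ} (hφ : Integrable φ) :
    convLp (fun ρ => k ρ - k' ρ) φ = convLp k φ - convLp k' φ := by
  refine Lp.ext ?_
  filter_upwards [(hk.sub hk').convLp_ae hφ, hk.convLp_ae hφ, hk'.convLp_ae hφ,
    Lp.coeFn_sub (convLp k φ) (convLp k' φ)] with z h1 h2 h3 h4
  rw [h1, h4, Pi.sub_apply, h2, h3, hk.isBddKernel.conv_sub hk'.isBddKernel hφ]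

lemma IsKernel.convLp_const_mul {k : ℝ → ℂ} {M : ℝ} (hk : IsKernel k M) (c : ℂ) {φ : ℍ → ℂ}
    (hφ : Integrable φ) : convLp (fun ρ => c * k ρ) φ = c • convLp k φ := by
  refine Lp.ext ?_
  filter_upwards [(hk.const_mul c).convLp_ae hφ, hk.convLp_ae hφ,
    Lp.coeFn_smul c (convLp k φ)] with z h1 h2 h3
  rw [h1, h3, Pi.smul_apply, h2, conv_const_mul, smul_eq_mul]

lemma exists_isKernel_heat {τ : ℂ} (h : 0 < τ.re) :
    ∃ C, IsKernel (heatK τ) C ∧ IsKernel (heatL τ) C := by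
  obtain ⟨C, R, hC, hR, h1, h2, h3⟩ := heatK_taylor h
  have hsub : Set.Ici (1 : ℝ) ⊆ Set.Ioi 0 := fun x hx => lt_of_lt_of_le (show (0 : ℝ) < 1 from one_pos) hx
  exact ⟨C, ⟨(continuousOn_heatK h).mono hsub, h2⟩, ⟨(continuousOn_heatL h).mono hsub, h1⟩⟩

/-- The evolution `r ↦ exp ((a + i r) Δ) φ` is differentiable in `L²`. -/
lemma hasDerivAt_convLp_heatK {a : ℝ} (ha : 0 < a) {φ : ℍ → ℂ} (hφ : Integrable φ) (r : ℝ) :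
    HasDerivAt (fun r : ℝ => convLp (heatK (a + r * Complex.I)) φ)
      (Complex.I • convLp (heatL (a + r * Complex.I)) φ) r := by
  have hre : ∀ r : ℝ, 0 < ((a : ℂ) + r * Complex.I).re := fun r => by simpa using ha
  obtain ⟨C, R, hC, hR, h1, h2, h3⟩ := heatK_taylor (hre r)
  rw [hasDerivAt_iff_isLittleO_nhds_zero]
  -- The remainder is itself a convolution, whose kernel has decay constant `C * s ^ 2` by
  -- `heatK_taylor`; linearity of `norm_convLp_le` in that constant makes it quadratic in `L²`.
  have hO : (fun s : ℝ => convLp (heatK (a + (r + s : ℝ) * Complex.I)) φ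
      - convLp (heatK (a + r * Complex.I)) φ
      - s • (Complex.I • convLp (heatL (a + r * Complex.I)) φ)) =O[𝓝 0] fun s : ℝ => s ^ 2 := by
    refine Asymptotics.IsBigO.of_bound (C * (√areaConst * ∫ w, ‖φ w‖)) ?_
    filter_upwards [Metric.closedBall_mem_nhds (0 : ℝ) hR] with s hs
    have hs : |s| ≤ R := by simpa using hs
    obtain ⟨C1, k1, -⟩ := exists_isKernel_heat (hre (r + s))
    obtain ⟨C2, k2, k3⟩ := exists_isKernel_heat (hre r)
    have k4 := k3.const_mul (s * Complex.I : ℂ)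
    have e : convLp (heatK (a + (r + s : ℝ) * Complex.I)) φ
        - convLp (heatK (a + r * Complex.I)) φ
        - s • (Complex.I • convLp (heatL (a + r * Complex.I)) φ) =
        convLp (fun ρ => heatK (a + (r + s : ℝ) * Complex.I) ρ - heatK (a + r * Complex.I) ρ
          - s * Complex.I * heatL (a + r * Complex.I) ρ) φ := by
      rw [(k1.sub k2).convLp_sub k4 hφ, k1.convLp_sub k2 hφ, k3.convLp_const_mul _ hφ, mul_smul]
      rfl
    have k5 : IsKernel (fun ρ => heatK (a + (r + s : ℝ) * Complex.I) ρ - heatK (a + r * Complex.I) ρ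
          - s * Complex.I * heatL (a + r * Complex.I) ρ) (C * s ^ 2) := by
      refine ⟨((k1.sub k2).sub k4).cont, fun ρ hρ => ?_⟩
      have := h3 s hs ρ hρ
      convert! this using 2
      push_cast
      ring_nf
    rw [e]
    refine (k5.norm_convLp_le hφ).trans_eq ?_
    rw [Real.norm_of_nonneg (sq_nonneg s)]
    ring
  exact hO.trans_isLittleO (by simpa using Asymptotics.isLittleO_pow_id (𝕜 := ℝ) one_lt_two)

/-! ### Test functions, Green's formula and radial kernels. -/

lemma isOpen_im_pos : IsOpen {z : ℂ | 0 < z.im} := isOpen_lt continuous_const Complex.continuous_im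

lemma isCompact_preimage_coe {K : Set ℂ} (hK : IsCompact K) (hU : K ⊆ {z : ℂ | 0 < z.im}) :
    IsCompact (UpperHalfPlane.coe ⁻¹' K) := by
  refine isEmbedding_coe.isInducing.isCompact_preimage' hK fun z hz => ⟨⟨z, hU hz⟩, rfl⟩

lemma hasCompactSupport_coe {g : ℂ → ℂ} (hg : HasCompactSupport g)
    (hU : tsupport g ⊆ {z : ℂ | 0 < z.im}) : HasCompactSupport fun z : ℍ => g z :=
  HasCompactSupport.of_support_subset_isCompact (isCompact_preimage_coe hg hU)
    fun _ hz => subset_tsupport g hz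

/-- First and second derivatives of a smooth function in the direction `v`. -/
lemma contDiff_lineDeriv_facts {ψ : ℂ → ℂ} (hψ : ContDiff ℝ ∞ ψ) (v : ℂ) :
    (∀ w, HasLineDerivAt ℝ ψ (fderiv ℝ ψ w v) w v) ∧
    (∀ w, HasLineDerivAt ℝ (fun w => fderiv ℝ ψ w v) (iteratedFDeriv ℝ 2 ψ w ![v, v]) w v) ∧
    Continuous (fun w => fderiv ℝ ψ w v) ∧
    Continuous (fun w => iteratedFDeriv ℝ 2 ψ w ![v, v]) := by
  have hs : ContDiff ℝ ∞ (fderiv ℝ ψ) := hψ.fderiv_right (m := ∞) (by simp)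
  refine ⟨fun w => ((hψ.differentiable (by simp)) w).hasFDerivAt.hasLineDerivAt v, fun w => ?_,
    (hs.clm_apply contDiff_const).continuous, ?_⟩
  · have h1 := (hs.differentiable (by simp)) w
    have h2 : HasFDerivAt (fun w => fderiv ℝ ψ w v)
        ((ContinuousLinearMap.apply ℝ ℂ v).comp (fderiv ℝ (fderiv ℝ ψ) w)) w :=
      (ContinuousLinearMap.apply ℝ ℂ v).hasFDerivAt.comp w h1.hasFDerivAt
    have := h2.hasLineDerivAt v
    simpa [iteratedFDeriv_two_apply] using this
  · have : (fun w => iteratedFDeriv ℝ 2 ψ w ![v, v]) = fun w => fderiv ℝ (fderiv ℝ ψ) w v v := by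
      funext w
      simp [iteratedFDeriv_two_apply]
    rw [this]
    have h2 : Continuous (fderiv ℝ (fderiv ℝ ψ)) := (hs.fderiv_right (m := ∞) (by simp)).continuous
    fun_prop

/-- Integration by parts against a test function, twice in the direction `v`. -/
lemma IsTestFunction.integral_mul_iteratedFDeriv {ψ : ℂ → ℂ} (hψ : IsTestFunction ψ) (v : ℂ)
    {f f' f'' : ℂ → ℂ} (hf : ∀ w, 0 < w.im → HasLineDerivAt ℝ f (f' w) w v)
    (hf' : ∀ w, 0 < w.im → HasLineDerivAt ℝ f' (f'' w) w v)
    (cf : ContinuousOn f {z | 0 < z.im}) (cf' : ContinuousOn f' {z | 0 < z.im})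
    (cf'' : ContinuousOn f'' {z | 0 < z.im}) :
    Integrable (fun w => f w * iteratedFDeriv ℝ 2 ψ w ![v, v]) ∧
    Integrable (fun w => f'' w * ψ w) ∧
    ∫ w, f w * iteratedFDeriv ℝ 2 ψ w ![v, v] = ∫ w, f'' w * ψ w := by
  have hint : ∀ {h g : ℂ → ℂ}, ContinuousOn h {z | 0 < z.im} → Continuous g →
      tsupport g ⊆ tsupport ψ → Integrable fun w => h w * g w := by
    intro h g hh hg hs
    have hcs : HasCompactSupport g := HasCompactSupport.of_support_subset_isCompact hψ.compact
      ((subset_tsupport g).trans hs)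
    refine Continuous.integrable_of_hasCompactSupport ?_ hcs.mul_left
    refine continuous_of_tsupport fun x hx => ?_
    have hx' : x ∈ tsupport g := tsupport_mul_subset_right hx
    exact (hh.continuousAt (isOpen_im_pos.mem_nhds (hψ.support_subset (hs hx')))).mul
      hg.continuousAt
  set ψ' : ℂ → ℂ := fun w => fderiv ℝ ψ w v with hψ'
  set ψ'' : ℂ → ℂ := fun w => iteratedFDeriv ℝ 2 ψ w ![v, v] with hψ''
  obtain ⟨l1, l2, c', c''⟩ := contDiff_lineDeriv_facts hψ.smooth v
  have t1 : tsupport ψ' ⊆ tsupport ψ := tsupport_fderiv_apply_subset ℝ v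
  have t2 : tsupport ψ'' ⊆ tsupport ψ := by
    refine closure_minimal (fun w hw => ?_) (isClosed_tsupport ψ)
    refine support_iteratedFDeriv_subset (𝕜 := ℝ) 2 fun h0 => hw ?_
    simp [hψ'', h0]
  have i0 := hint cf c' t1
  have i1 := hint cf c'' t2
  have i2 := hint cf' c' t1
  have i3 := hint cf' hψ.smooth.continuous subset_rfl
  have i4 := hint cf'' hψ.smooth.continuous subset_rfl
  refine ⟨i1, i4, ?_⟩
  have e1 := integral_bilinear_hasLineDerivAt_right_eq_neg_left_of_integrable
    (B := ContinuousLinearMap.mul ℝ ℂ) (μ := volume) (f := f) (f' := f') (g := ψ') (g' := ψ'')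
    (v := v) i2 i1 i0 (fun w hw => hf w (hψ.support_subset (t1 hw))) (fun w _ => l2 w)
  have e2 := integral_bilinear_hasLineDerivAt_right_eq_neg_left_of_integrable
    (B := ContinuousLinearMap.mul ℝ ℂ) (μ := volume) (f := f') (f' := f'') (g := ψ) (g' := ψ')
    (v := v) i4 i2 i3 (fun w hw => hf' w (hψ.support_subset hw)) (fun w _ => l1 w)
  simp only [ContinuousLinearMap.mul_apply'] at e1 e2
  rw [e1, e2, neg_neg]

lemma hypLaplacian_eq (ψ : ℂ → ℂ) (z : ℍ) : hypLaplacian ψ z = ((z.im ^ 2 : ℝ) : ℂ) *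
    (iteratedFDeriv ℝ 2 ψ z ![1, 1] + iteratedFDeriv ℝ 2 ψ z ![Complex.I, Complex.I]) := by
  rw [hypLaplacian, InnerProductSpace.laplacian_eq_iteratedFDeriv_complexPlane]

/-- The factor `y ^ 2` of the hyperbolic Laplacian cancels the area density, so integrations by
parts can be carried out in the Euclidean plane. -/
lemma integral_upperHalfPlane_of_support {g : ℂ → ℂ} (hg : ∀ w, g w ≠ 0 → 0 < w.im) :
    ∫ z : ℍ, ((z.im ^ 2 : ℝ) : ℂ) * g z = ∫ w, g w := by
  have h1 := integral_upperHalfPlane fun w : ℂ => ((w.im ^ 2 : ℝ) : ℂ) * g w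
  calc _ = _ := h1
    _ = ∫ w in {w : ℂ | 0 < w.im}, g w := by
        refine setIntegral_congr_fun isOpen_im_pos.measurableSet fun w hw => ?_
        have hw : (w.im : ℂ) ≠ 0 := by exact_mod_cast (show 0 < w.im from hw).ne'
        push_cast
        field_simp
    _ = _ := by
        refine setIntegral_eq_integral_of_forall_compl_eq_zero fun w hw => ?_
        by_contra h
        exact hw (hg w h)

lemma IsTestFunction.iteratedFDeriv_eq_zero {ψ : ℂ → ℂ} (hψ : IsTestFunction ψ) {w : ℂ}
    (hw : ¬ 0 < w.im) : iteratedFDeriv ℝ 2 ψ w = 0 := by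
  by_contra h
  exact hw (hψ.support_subset (support_iteratedFDeriv_subset (𝕜 := ℝ) 2 h))

/-- Green's formula for a test function and a function of class `C²`. -/
lemma IsTestFunction.integral_mul_hypLaplacian {ψ : ℂ → ℂ} (hψ : IsTestFunction ψ)
    {f : ℂ → ℂ} {f' f'' : ℂ → ℂ → ℂ}
    (hf : ∀ v w, 0 < w.im → HasLineDerivAt ℝ f (f' v w) w v)
    (hf' : ∀ v w, 0 < w.im → HasLineDerivAt ℝ (f' v) (f'' v w) w v)
    (cf : ContinuousOn f {z | 0 < z.im}) (cf' : ∀ v, ContinuousOn (f' v) {z | 0 < z.im})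
    (cf'' : ∀ v, ContinuousOn (f'' v) {z | 0 < z.im}) :
    ∫ z : ℍ, f z * hypLaplacian ψ z =
      ∫ z : ℍ, ((z.im ^ 2 : ℝ) : ℂ) * (f'' 1 z + f'' Complex.I z) * ψ z := by
  obtain ⟨a1, a2, a3⟩ := hψ.integral_mul_iteratedFDeriv 1 (hf 1) (hf' 1) cf (cf' 1) (cf'' 1)
  obtain ⟨b1, b2, b3⟩ := hψ.integral_mul_iteratedFDeriv Complex.I (hf Complex.I)
    (hf' Complex.I) cf (cf' Complex.I) (cf'' Complex.I)
  have e1 := integral_upperHalfPlane_of_support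
    (g := fun w => f w * (iteratedFDeriv ℝ 2 ψ w ![1, 1]) +
      f w * (iteratedFDeriv ℝ 2 ψ w ![Complex.I, Complex.I])) fun w hw => by
        by_contra hcon
        simp [hψ.iteratedFDeriv_eq_zero hcon] at hw
  have e2 := integral_upperHalfPlane_of_support
    (g := fun w => f'' 1 w * ψ w + f'' Complex.I w * ψ w) fun w hw => by
        by_contra hcon
        have : ψ w = 0 := by
          by_contra h
          exact hcon (hψ.support_subset (subset_tsupport ψ h))
        simp [this] at hw
  rw [integral_add a1 b1, a3, b3] at e1
  rw [integral_add a2 b2] at e2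
  calc _ = _ := by
        congr with z
        rw [hypLaplacian_eq]
        ring
    _ = _ := e1
    _ = _ := e2.symm
    _ = _ := by
        congr with z
        ring

/-- Symmetry of the Laplacian on test functions. -/
lemma IsTestFunction.integral_mul_hypLaplacian_comm {ψ η : ℂ → ℂ} (hψ : IsTestFunction ψ)
    (hη : IsTestFunction η) :
    ∫ z : ℍ, η z * hypLaplacian ψ z = ∫ z : ℍ, hypLaplacian η z * ψ z := by
  have h := fun v => contDiff_lineDeriv_facts hη.smooth v
  rw [hψ.integral_mul_hypLaplacian (f' := fun v w => fderiv ℝ η w v)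
    (f'' := fun v w => iteratedFDeriv ℝ 2 η w ![v, v]) (fun v w _ => (h v).1 w)
    (fun v w _ => (h v).2.1 w) hη.smooth.continuous.continuousOn
    (fun v => (h v).2.2.1.continuousOn) (fun v => (h v).2.2.2.continuousOn)]
  congr with z
  rw [hypLaplacian_eq]

/-- `cosh d(z, ·)` extended to the plane. -/
noncomputable def coshDistExt (z : ℍ) (w : ℂ) : ℝ :=
  ((z.re - w.re) ^ 2 + z.im ^ 2 + w.im ^ 2) / (2 * z.im * w.im)

lemma coshDistExt_coe (z w : ℍ) : coshDistExt z w = coshDist z w := by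
  rw [coshDist_eq, coshDistExt]
  have h1 := z.im_ne_zero
  have h2 := w.im_ne_zero
  simp only [coe_re, coe_im]
  field_simp
  ring

lemma coshDistExt_pos (z : ℍ) {w : ℂ} (hw : 0 < w.im) : 0 < coshDistExt z w := by
  have h1 := z.im_pos
  rw [coshDistExt]
  positivity

/-- The first derivative of `cosh d(z, ·)` in the direction `v`. -/
noncomputable def coshDistExt1 (z : ℍ) (v w : ℂ) : ℝ :=
  v.re * ((w.re - z.re) / (z.im * w.im)) +
    v.im * ((1 - ((z.re - w.re) ^ 2 + z.im ^ 2) / w.im ^ 2) / (2 * z.im))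

/-- The second derivative of `cosh d(z, ·)` in the direction `v`. -/
noncomputable def coshDistExt2 (z : ℍ) (v w : ℂ) : ℝ :=
  v.re ^ 2 * (1 / (z.im * w.im)) - 2 * v.re * v.im * ((w.re - z.re) / (z.im * w.im ^ 2)) +
    v.im ^ 2 * (((z.re - w.re) ^ 2 + z.im ^ 2) / (z.im * w.im ^ 3))

lemma hasLineDerivAt_coshDistExt (z : ℍ) (v : ℂ) {w : ℂ} (hw : 0 < w.im) :
    HasLineDerivAt ℝ (coshDistExt z) (coshDistExt1 z v w) w v := by
  have h1 := z.im_ne_zero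
  have h2 := hw.ne'
  have hx : HasDerivAt (fun t : ℝ => w.re + t * v.re) v.re 0 := by
    simpa using ((hasDerivAt_id (0 : ℝ)).mul_const v.re).const_add w.re
  have hy : HasDerivAt (fun t : ℝ => w.im + t * v.im) v.im 0 := by
    simpa using ((hasDerivAt_id (0 : ℝ)).mul_const v.im).const_add w.im
  have := ((((hx.const_sub z.re).pow 2).add_const (z.im ^ 2)).add (hy.pow 2)).div
    (hy.const_mul (2 * z.im)) (by simpa using ⟨h1, h2⟩)
  rw [HasLineDerivAt]
  convert! this using 1
  · funext t
    simp [coshDistExt]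
  · simp only [coshDistExt1, zero_mul, add_zero]
    simp
    field_simp
    ring

lemma hasLineDerivAt_coshDistExt1 (z : ℍ) (v : ℂ) {w : ℂ} (hw : 0 < w.im) :
    HasLineDerivAt ℝ (coshDistExt1 z v) (coshDistExt2 z v w) w v := by
  have h1 := z.im_ne_zero
  have h2 := hw.ne'
  have hx : HasDerivAt (fun t : ℝ => w.re + t * v.re) v.re 0 := by
    simpa using ((hasDerivAt_id (0 : ℝ)).mul_const v.re).const_add w.re
  have hy : HasDerivAt (fun t : ℝ => w.im + t * v.im) v.im 0 := by
    simpa using ((hasDerivAt_id (0 : ℝ)).mul_const v.im).const_add w.im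
  have i1 := ((hx.sub_const z.re).div (hy.const_mul z.im) (by simpa using ⟨h1, h2⟩)).const_mul v.re
  have i2 := ((((((hx.const_sub z.re).pow 2).add_const (z.im ^ 2)).div (hy.pow 2)
    (by simpa using h2)).const_sub 1).div_const (2 * z.im)).const_mul v.im
  have := i1.add i2
  rw [HasLineDerivAt]
  convert! this using 1
  · funext t
    simp [coshDistExt1]
  · simp only [coshDistExt2, zero_mul, add_zero]
    simp
    field_simp
    ring

/-- This and `coshDistExt_laplacian` give the coefficients of the radial Laplacian in `ρ = cosh d`:
`(ρ ^ 2 - 1) k'' + 2 ρ k'`. -/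
lemma coshDistExt_grad (z : ℍ) {w : ℂ} (hw : 0 < w.im) :
    w.im ^ 2 * (coshDistExt1 z 1 w ^ 2 + coshDistExt1 z Complex.I w ^ 2) =
      coshDistExt z w ^ 2 - 1 := by
  have h1 := z.im_ne_zero
  have h2 := hw.ne'
  simp only [coshDistExt1, coshDistExt, Complex.one_re, Complex.one_im, Complex.I_re, Complex.I_im]
  field_simp
  ring

lemma coshDistExt_laplacian (z : ℍ) {w : ℂ} (hw : 0 < w.im) :
    w.im ^ 2 * (coshDistExt2 z 1 w + coshDistExt2 z Complex.I w) = 2 * coshDistExt z w := by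
  have h1 := z.im_ne_zero
  have h2 := hw.ne'
  simp only [coshDistExt2, coshDistExt, Complex.one_re, Complex.one_im, Complex.I_re, Complex.I_im]
  field_simp
  ring

lemma continuousOn_coshDistExt (z : ℍ) (v : ℂ) :
    ContinuousOn (coshDistExt z) {w | 0 < w.im} ∧
    ContinuousOn (coshDistExt1 z v) {w | 0 < w.im} ∧
    ContinuousOn (coshDistExt2 z v) {w | 0 < w.im} := by
  have h1 := z.im_ne_zero
  have cr : ContinuousOn (fun w : ℂ => w.re) {w : ℂ | 0 < w.im} := Complex.continuous_re.continuousOn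
  have ci : ContinuousOn (fun w : ℂ => w.im) {w : ℂ | 0 < w.im} := Complex.continuous_im.continuousOn
  have hne : ∀ w ∈ {w : ℂ | 0 < w.im}, w.im ≠ 0 := fun w hw => (show 0 < w.im from hw).ne'
  refine ⟨?_, ?_, ?_⟩
  · unfold coshDistExt
    refine ContinuousOn.div (by fun_prop) (by fun_prop) fun w hw => ?_
    have := hne w hw
    positivity
  · unfold coshDistExt1
    refine ContinuousOn.add (continuousOn_const.mul (ContinuousOn.div (by fun_prop) (by fun_prop)
      fun w hw => ?_)) (continuousOn_const.mul (ContinuousOn.div_const (continuousOn_const.sub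
      (ContinuousOn.div (by fun_prop) (by fun_prop) fun w hw => ?_)) _))
    · have := hne w hw
      positivity
    · have := hne w hw
      positivity
  · unfold coshDistExt2
    refine ContinuousOn.add (ContinuousOn.sub (continuousOn_const.mul (ContinuousOn.div
      (by fun_prop) (by fun_prop) fun w hw => ?_)) (continuousOn_const.mul (ContinuousOn.div
      (by fun_prop) (by fun_prop) fun w hw => ?_))) (continuousOn_const.mul (ContinuousOn.div
      (by fun_prop) (by fun_prop) fun w hw => ?_))
    all_goals
      have := hne w hw
      positivity

/-- Green's formula for a radial kernel of class `C²`. -/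
lemma IsTestFunction.conv_hypLaplacian {ψ : ℂ → ℂ} (hψ : IsTestFunction ψ) {k k1 k2 : ℝ → ℂ}
    (h1 : ∀ ρ, 0 < ρ → HasDerivAt k (k1 ρ) ρ) (h2 : ∀ ρ, 0 < ρ → HasDerivAt k1 (k2 ρ) ρ)
    (c2 : ContinuousOn k2 (Set.Ioi 0)) (z : ℍ) :
    conv k (hypLaplacian ψ) z =
      conv (fun ρ => ((ρ : ℂ) ^ 2 - 1) * k2 ρ + 2 * ρ * k1 ρ) (fun w => ψ w) z := by
  have maps : Set.MapsTo (coshDistExt z) {w | 0 < w.im} (Set.Ioi 0) :=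
    fun w hw => coshDistExt_pos z hw
  have c0 : ContinuousOn k (Set.Ioi 0) := fun ρ hρ => (h1 ρ hρ).continuousAt.continuousWithinAt
  have c1 : ContinuousOn k1 (Set.Ioi 0) := fun ρ hρ => (h2 ρ hρ).continuousAt.continuousWithinAt
  have key := hψ.integral_mul_hypLaplacian (f := fun w => k (coshDistExt z w))
    (f' := fun v w => (coshDistExt1 z v w : ℂ) * k1 (coshDistExt z w))
    (f'' := fun v w => (coshDistExt2 z v w : ℂ) * k1 (coshDistExt z w) +
      (coshDistExt1 z v w : ℂ) * ((coshDistExt1 z v w : ℂ) * k2 (coshDistExt z w)))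
    (fun v w hw => ?_) (fun v w hw => ?_) ?_ (fun v => ?_) (fun v => ?_)
  · calc _ = ∫ w : ℍ, k (coshDistExt z w) * hypLaplacian ψ w := by
          rw [HypSchrodinger.conv]
          simp_rw [coshDistExt_coe]
      _ = _ := key
      _ = _ := by
          rw [conv]
          congr with w
          have hw : 0 < (w : ℂ).im := w.im_pos
          have g1 := congrArg (fun x : ℝ => (x : ℂ)) (coshDistExt_grad z hw)
          have g2 := congrArg (fun x : ℝ => (x : ℂ)) (coshDistExt_laplacian z hw)
          rw [coshDistExt_coe] at g1 g2 ⊢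
          push_cast [coe_im] at g1 g2 ⊢
          linear_combination (k2 (coshDist z w) * ψ w) * g1 + (k1 (coshDist z w) * ψ w) * g2
  · have a1 := hasLineDerivAt_coshDistExt z v hw
    have a2 : HasDerivAt k (k1 (coshDistExt z w)) (coshDistExt z (w + (0 : ℝ) • v)) := by
      simpa using h1 _ (coshDistExt_pos z hw)
    exact a2.scomp (0 : ℝ) a1
  · have a1 := hasLineDerivAt_coshDistExt z v hw
    have a2 : HasDerivAt k1 (k2 (coshDistExt z w)) (coshDistExt z (w + (0 : ℝ) • v)) := by
      simpa using h2 _ (coshDistExt_pos z hw)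
    have a3 : HasLineDerivAt ℝ (fun w => (coshDistExt1 z v w : ℂ)) (coshDistExt2 z v w : ℂ) w v :=
      HasDerivAt.ofReal_comp (hasLineDerivAt_coshDistExt1 z v hw)
    have := HasDerivAt.mul a3 (a2.scomp (0 : ℝ) a1)
    rw [HasLineDerivAt]
    convert! this using 1
    simp
  · exact c0.comp (continuousOn_coshDistExt z 1).1 maps
  · exact (Complex.continuous_ofReal.comp_continuousOn (continuousOn_coshDistExt z v).2.1).mul
      (c1.comp (continuousOn_coshDistExt z 1).1 maps)
  · have j1 := Complex.continuous_ofReal.comp_continuousOn (continuousOn_coshDistExt z v).2.1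
    have j2 := Complex.continuous_ofReal.comp_continuousOn (continuousOn_coshDistExt z v).2.2
    exact (j2.mul (c1.comp (continuousOn_coshDistExt z 1).1 maps)).add
      (j1.mul (j1.mul (c2.comp (continuousOn_coshDistExt z 1).1 maps)))

lemma IsTestFunction.continuous_coe {ψ : ℂ → ℂ} (hψ : IsTestFunction ψ) :
    Continuous fun z : ℍ => ψ z :=
  hψ.smooth.continuous.comp UpperHalfPlane.continuous_coe

lemma IsTestFunction.hasCompactSupport_coe {ψ : ℂ → ℂ} (hψ : IsTestFunction ψ) :
    HasCompactSupport fun z : ℍ => ψ z :=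
  HypSchrodinger.hasCompactSupport_coe hψ.compact hψ.support_subset

lemma IsTestFunction.integrable {ψ : ℂ → ℂ} (hψ : IsTestFunction ψ) :
    Integrable fun z : ℍ => ψ z :=
  hψ.continuous_coe.integrable_of_hasCompactSupport hψ.hasCompactSupport_coe

lemma IsTestFunction.continuous_hypLaplacian {ψ : ℂ → ℂ} (hψ : IsTestFunction ψ) :
    Continuous (hypLaplacian ψ) := by
  have h1 := (contDiff_lineDeriv_facts hψ.smooth 1).2.2.2.comp UpperHalfPlane.continuous_coe
  have h2 := (contDiff_lineDeriv_facts hψ.smooth Complex.I).2.2.2.comp UpperHalfPlane.continuous_coe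
  have h3 : hypLaplacian ψ = fun z => _ := funext fun z => hypLaplacian_eq ψ z
  rw [h3]
  exact (Complex.continuous_ofReal.comp (continuous_im.pow 2)).mul (h1.add h2)

lemma IsTestFunction.hasCompactSupport_hypLaplacian {ψ : ℂ → ℂ} (hψ : IsTestFunction ψ) :
    HasCompactSupport (hypLaplacian ψ) := by
  refine HasCompactSupport.of_support_subset_isCompact
    (isCompact_preimage_coe hψ.compact hψ.support_subset) fun z hz => ?_
  refine support_iteratedFDeriv_subset (𝕜 := ℝ) 2 fun h => hz ?_
  simp [hypLaplacian_eq, h]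

lemma IsTestFunction.integrable_hypLaplacian {ψ : ℂ → ℂ} (hψ : IsTestFunction ψ) :
    Integrable (hypLaplacian ψ) :=
  hψ.continuous_hypLaplacian.integrable_of_hasCompactSupport hψ.hasCompactSupport_hypLaplacian

/-! ### Convolutions of test functions are test functions. -/

/-- The fundamental lemma of the calculus of variations on the hyperbolic plane. -/
lemma ae_eq_of_forall_isTestFunction {f g : ℍ → ℂ} (hf : LocallyIntegrable f)
    (hg : LocallyIntegrable g)
    (h : ∀ ψ, IsTestFunction ψ → ∫ z : ℍ, f z * ψ z = ∫ z : ℍ, g z * ψ z) : f =ᵐ[volume] g := by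
  have hd : LocallyIntegrable (fun z => f z - g z) := hf.sub hg
  have hloc : LocallyIntegrableOn ((fun z => f z - g z) ∘ ofComplex) {z : ℂ | 0 < z.im}
      ((volume : Measure ℍ).map UpperHalfPlane.coe) := by
    intro x hx
    obtain ⟨V, hV, hi⟩ := hd ⟨x, hx⟩
    refine ⟨UpperHalfPlane.coe '' V, mem_nhdsWithin_of_mem_nhds
      (isOpenEmbedding_coe.isOpenMap.image_mem_nhds hV), ?_⟩
    rw [measurableEmbedding_coe.integrableOn_map_iff,
      Set.preimage_image_eq _ isOpenEmbedding_coe.injective]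
    refine hi.congr (Eventually.of_forall fun z => ?_)
    simp
  have hz := isOpen_im_pos.ae_eq_zero_of_integral_contDiff_smul_eq_zero hloc
    fun χ h1 h2 h3 => by
      have hs : tsupport (fun z => (χ z : ℂ)) ⊆ tsupport χ :=
        closure_mono fun z hz => by simpa using hz
      have ht : IsTestFunction fun z => (χ z : ℂ) :=
        ⟨Complex.ofRealCLM.contDiff.comp h1,
          HasCompactSupport.of_support_subset_isCompact h2 ((subset_tsupport _).trans hs),
          hs.trans h3⟩
      have hc := ht.continuous_coe
      have i1 : Integrable (fun z : ℍ => f z * (χ z : ℂ)) := by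
        simpa only [smul_eq_mul, mul_comm] using
          hf.integrable_smul_left_of_hasCompactSupport hc ht.hasCompactSupport_coe
      have i2 : Integrable (fun z : ℍ => g z * (χ z : ℂ)) := by
        simpa only [smul_eq_mul, mul_comm] using
          hg.integrable_smul_left_of_hasCompactSupport hc ht.hasCompactSupport_coe
      rw [measurableEmbedding_coe.integral_map]
      have := sub_eq_zero.2 (h _ ht)
      rw [← integral_sub i1 i2] at this
      rw [← this]
      congr with z
      simp
      ring
  rw [measurableEmbedding_coe.ae_map_iff] at hz
  filter_upwards [hz] with z h0
  have := h0 z.im_pos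
  simpa [sub_eq_zero] using this

/-- The isometry `h ↦ x + y h` moves the dependence on `z` from the kernel to `ψ`. Smoothness of the
convolution then comes from `ψ`, with nothing asked of the kernel beyond integrability. -/
lemma conv_eq_integral_translate (k : ℝ → ℂ) (ψ : ℂ → ℂ) (z : ℍ) :
    conv k (fun w => ψ w) z = ∫ h : ℍ, k (coshDist I h) * ψ (z.re + z.im * h) := by
  rw [conv, ← (measurePreserving_SL z.toSL2R).integral_comp (measurableEmbedding_SL _)]
  simp_rw [coshDist_toSL2R_smul, coe_toSL2R_smul]

/-- The convolution of a test function, as a function on the plane. -/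
noncomputable def convExt (k : ℝ → ℂ) (ψ : ℂ → ℂ) (z : ℂ) : ℂ :=
  if h : 0 < z.im then conv k (fun w => ψ w) ⟨z, h⟩ else 0

lemma convExt_coe (k : ℝ → ℂ) (ψ : ℂ → ℂ) (z : ℍ) :
    convExt k ψ z = conv k (fun w => ψ w) z := by
  rw [convExt, dif_pos (show 0 < (z : ℂ).im from z.im_pos)]

lemma IsKernel.contDiffOn_convExt {k : ℝ → ℂ} {M : ℝ} (hk : IsKernel k M) {ψ : ℂ → ℂ}
    (hψ : IsTestFunction ψ) : ContDiffOn ℝ ∞ (convExt k ψ) {z | 0 < z.im} := by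
  set μ := (volume : Measure ℍ).map UpperHalfPlane.coe
  have hf : Integrable (fun t => k (coshDistExt I t)) μ := by
    rw [measurableEmbedding_coe.integrable_map_iff]
    refine (hk.integrable_kernel I).1.congr (Eventually.of_forall fun z => ?_)
    simp only [Function.comp, coshDistExt_coe, coshDist_comm]
  obtain ⟨B, hB⟩ := hψ.compact.isBounded.exists_norm_le
  intro z₀ (hz₀ : 0 < z₀.im)
  set s : Set ℂ := {z | z₀.im / 2 < z.im ∧ ‖z‖ < ‖z₀‖ + 1} with hs
  have ho : IsOpen s := (isOpen_lt continuous_const Complex.continuous_im).inter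
    (isOpen_lt continuous_norm continuous_const)
  have hmem : z₀ ∈ s := ⟨half_lt_self hz₀, lt_add_one _⟩
  -- A convolution depending on the parameter `p`, evaluated at the point `0`: its second factor is
  -- taken at `-t`, and the minus sign in `g` restores `p.re + p.im * t`. The set `s` keeps `Im p`
  -- away from `0`, so the supports stay in one ball.
  have key := contDiffOn_convolution_right_with_param_comp (𝕜 := ℝ) (n := (⊤ : ℕ∞)) (μ := μ)
    (ContinuousLinearMap.mul ℝ ℂ) (s := s) (v := fun _ => (0 : ℂ)) contDiffOn_const
    (f := fun t => k (coshDistExt I t)) (g := fun p x => ψ (p.re - p.im * x))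
    (k := Metric.closedBall 0 ((B + (‖z₀‖ + 1)) / (z₀.im / 2))) ho
    (isCompact_closedBall _ _) (fun p x hp hx => ?_) hf.locallyIntegrable ?_
  · refine ((key.contDiffAt (ho.mem_nhds hmem)).congr_of_eventuallyEq ?_).contDiffWithinAt
    filter_upwards [isOpen_im_pos.mem_nhds hz₀] with z hz
    rw [convExt, dif_pos hz, conv_eq_integral_translate, MeasureTheory.convolution_def,
      measurableEmbedding_coe.integral_map]
    congr with h
    simp [coshDistExt_coe]
  · by_contra hcon
    refine hx ?_
    have h1 := hB _ (subset_tsupport ψ hcon)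
    have hp1 : z₀.im / 2 < p.im := hp.1
    have hp2 : ‖p‖ < ‖z₀‖ + 1 := hp.2
    rw [mem_closedBall_zero_iff, le_div_iff₀ (by positivity)]
    calc ‖x‖ * (z₀.im / 2) ≤ ‖x‖ * p.im := by gcongr
      _ = ‖(p.im : ℂ) * x‖ := by
          rw [norm_mul, Complex.norm_of_nonneg ((half_pos hz₀).trans hp1).le, mul_comm]
      _ = ‖(p.re : ℂ) - (p.re - p.im * x)‖ := by ring_nf
      _ ≤ ‖(p.re : ℂ)‖ + ‖(p.re : ℂ) - p.im * x‖ := norm_sub_le _ _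
      _ ≤ _ := by
          rw [Complex.norm_real]
          have := (Complex.abs_re_le_norm p)
          rw [Real.norm_eq_abs]
          linarith
  · refine (hψ.smooth.comp ?_).contDiffOn
    have h1 : ContDiff ℝ ∞ fun p : ℂ × ℂ => ((p.1.re : ℝ) : ℂ) :=
      Complex.ofRealCLM.contDiff.comp (Complex.reCLM.contDiff.comp contDiff_fst)
    have h2 : ContDiff ℝ ∞ fun p : ℂ × ℂ => ((p.1.im : ℝ) : ℂ) :=
      Complex.ofRealCLM.contDiff.comp (Complex.imCLM.contDiff.comp contDiff_fst)
    exact h1.sub (h2.mul contDiff_snd)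

lemma dist_lt_coshDist (z w : ℍ) : dist z w < coshDist z w :=
  (Real.self_le_sinh_iff.2 dist_nonneg).trans_lt (Real.sinh_lt_cosh _)

/-- Convolution with a compactly supported radial kernel preserves test functions. -/
lemma IsKernel.isTestFunction_convExt {k : ℝ → ℂ} {M R : ℝ} (hk : IsKernel k M)
    (hR : ∀ ρ, R ≤ ρ → k ρ = 0) {ψ : ℂ → ℂ} (hψ : IsTestFunction ψ) :
    IsTestFunction (convExt k ψ) := by
  obtain ⟨r, hr⟩ := hψ.hasCompactSupport_coe.isBounded.subset_closedBall I
  set K : Set ℂ := UpperHalfPlane.coe '' Metric.closedBall I (R + r) with hKdef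
  have hK : IsCompact K := (isCompact_closedBall _ _).image continuous_coe
  have hKU : K ⊆ {z : ℂ | 0 < z.im} := by
    rintro _ ⟨w, -, rfl⟩
    exact w.im_pos
  have hsupp : Function.support (convExt k ψ) ⊆ K := by
    intro z hz
    rw [Function.mem_support, convExt] at hz
    split_ifs at hz with h
    · refine ⟨⟨z, h⟩, ?_, rfl⟩
      by_contra hfar
      refine hz (integral_eq_zero_of_ae (Eventually.of_forall fun w => ?_))
      by_cases hw : ψ w = 0
      · simp [hw]
      · have h1 : dist w I ≤ r := hr (subset_tsupport (fun z : ℍ => ψ z) hw)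
        have h2 := dist_lt_coshDist ⟨z, h⟩ w
        have h3 := dist_triangle ⟨z, h⟩ w I
        rw [Metric.mem_closedBall] at hfar
        simp only [Pi.zero_apply]
        rw [hR _ (by linarith), zero_mul]
    · exact absurd rfl hz
  have htsupp : tsupport (convExt k ψ) ⊆ K := closure_minimal hsupp hK.isClosed
  refine ⟨contDiff_iff_contDiffAt.2 fun z => ?_,
    HasCompactSupport.of_support_subset_isCompact hK hsupp, htsupp.trans hKU⟩
  by_cases hz : 0 < z.im
  · exact (hk.contDiffOn_convExt hψ).contDiffAt (isOpen_im_pos.mem_nhds hz)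
  · have : convExt k ψ =ᶠ[𝓝 z] fun _ => 0 := by
      filter_upwards [hK.isClosed.isOpen_compl.mem_nhds fun h => hz (hKU h)] with w hw
      by_contra h
      exact hw (hsupp h)
    exact contDiffAt_const.congr_of_eventuallyEq this

/-- The Laplacian commutes with radial convolutions. -/
lemma hypLaplacian_convExt {k k1 k2 : ℝ → ℂ} {M M' R : ℝ} (hk : IsKernel k M)
    (hR : ∀ ρ, R ≤ ρ → k ρ = 0) (h1 : ∀ ρ, 0 < ρ → HasDerivAt k (k1 ρ) ρ)
    (h2 : ∀ ρ, 0 < ρ → HasDerivAt k1 (k2 ρ) ρ) (c2 : ContinuousOn k2 (Set.Ioi 0))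
    (hL : IsKernel (fun ρ => ((ρ : ℂ) ^ 2 - 1) * k2 ρ + 2 * ρ * k1 ρ) M')
    {ψ : ℂ → ℂ} (hψ : IsTestFunction ψ) :
    hypLaplacian (convExt k ψ) =ᵐ[volume]
      conv (fun ρ => ((ρ : ℂ) ^ 2 - 1) * k2 ρ + 2 * ρ * k1 ρ) fun w => ψ w := by
  have hW := hk.isTestFunction_convExt hR hψ
  refine ae_eq_of_forall_isTestFunction hW.continuous_hypLaplacian.locallyIntegrable
    (hL.isBddKernel.continuous_conv hψ.integrable).locallyIntegrable fun η hη => ?_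
  -- Tested against `η`, the Laplacian is moved onto `η`, the convolution onto `hypLaplacian η`,
  -- Green's formula puts the derivatives on the kernel, and the new convolution is moved back to
  -- `ψ`.
  calc ∫ z : ℍ, hypLaplacian (convExt k ψ) z * η z
      = ∫ z : ℍ, convExt k ψ z * hypLaplacian η z := (hη.integral_mul_hypLaplacian_comm hW).symm
    _ = ∫ z : ℍ, conv k (fun w => ψ w) z * hypLaplacian η z := by simp_rw [convExt_coe]
    _ = ∫ z : ℍ, ψ z * conv k (hypLaplacian η) z :=
        hk.isBddKernel.integral_conv_mul hψ.integrable hη.integrable_hypLaplacian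
    _ = ∫ z : ℍ, ψ z * conv (fun ρ => ((ρ : ℂ) ^ 2 - 1) * k2 ρ + 2 * ρ * k1 ρ)
          (fun w => η w) z := by simp_rw [hη.conv_hypLaplacian h1 h2 c2]
    _ = _ := (hL.isBddKernel.integral_conv_mul hψ.integrable hη.integrable).symm

/-! ### The heat semigroup as an approximation of the identity. -/

lemma heatKReal_nonneg {a ρ : ℝ} (ha : 0 < a) (hρ : 1 ≤ ρ) : 0 ≤ heatKReal a ρ :=
  mul_nonneg (heatCReal_nonneg ha) (integral_nonneg fun x =>
    mul_nonneg (arcE_nonneg (by nlinarith [sq_nonneg x])) (Real.exp_pos _).le)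

lemma heatK_eq_ofReal {a : ℝ} (ha : 0 < a) (ρ : ℝ) : heatK a ρ = (heatKReal a ρ : ℂ) :=
  heatK_real ha ρ

lemma norm_heatK_ofReal {a ρ : ℝ} (ha : 0 < a) (hρ : 1 ≤ ρ) : ‖heatK a ρ‖ = heatKReal a ρ := by
  rw [heatK_eq_ofReal ha, Complex.norm_of_nonneg (heatKReal_nonneg ha hρ)]

lemma exists_isKernel_heatK_ofReal {a : ℝ} (ha : 0 < a) : ∃ C, IsKernel (heatK a) C := by
  obtain ⟨C, h, -⟩ := exists_isKernel_heat (τ := (a : ℂ)) (by simpa using ha)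
  exact ⟨C, h⟩

/-- The heat kernel has mass one. -/
lemma integral_norm_heatK {a : ℝ} (ha : 0 < a) (z : ℍ) :
    ∫ w, ‖heatK a (coshDist w z)‖ = 1 := by
  obtain ⟨C, hk⟩ := exists_isKernel_heatK_ofReal ha
  have h1 : ∀ w, ENNReal.ofReal ‖heatK a (coshDist w z)‖ =
      ENNReal.ofReal (heatKReal a (coshDist z w)) := fun w => by
    rw [norm_heatK_ofReal ha (one_le_coshDist _ _), coshDist_comm]
  rw [integral_eq_lintegral_of_nonneg_ae (Eventually.of_forall fun w => norm_nonneg _)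
    (hk.integrable_kernel z).1.aestronglyMeasurable.norm, lintegral_congr h1,
    lintegral_coshDist (fun ρ => ENNReal.ofReal (heatKReal a ρ)) z, lintegral_heatKReal ha]
  rfl

lemma integral_heatK {a : ℝ} (ha : 0 < a) (z : ℍ) :
    ∫ w, heatK a (coshDist z w) = 1 := by
  have h1 : ∀ w, heatK a (coshDist z w) = (‖heatK a (coshDist w z)‖ : ℂ) := fun w => by
    rw [norm_heatK_ofReal ha (one_le_coshDist _ _), coshDist_comm, heatK_eq_ofReal ha]
  simp_rw [h1]
  rw [integral_complex_ofReal, integral_norm_heatK ha, Complex.ofReal_one]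

/-- Positivity and unit mass make the heat semigroup a contraction for the sup norm, and likewise in
`L¹` in `integral_norm_conv_heatK_le`. -/
lemma norm_conv_heatK_le {a : ℝ} (ha : 0 < a) {φ : ℍ → ℂ} {A : ℝ} (hA : ∀ z, ‖φ z‖ ≤ A) (z : ℍ) :
    ‖conv (heatK a) φ z‖ ≤ A := by
  obtain ⟨C, hk⟩ := exists_isKernel_heatK_ofReal ha
  refine (norm_integral_le_of_norm_le (g := fun w => ‖heatK a (coshDist w z)‖ * A)
    ((hk.integrable_kernel z).1.norm.mul_const A) (Eventually.of_forall fun w => ?_)).trans_eq ?_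
  · rw [norm_mul, coshDist_comm]
    exact mul_le_mul_of_nonneg_left (hA w) (norm_nonneg _)
  · rw [integral_mul_const, integral_norm_heatK ha, one_mul]

lemma integral_norm_conv_heatK_le {a : ℝ} (ha : 0 < a) {φ : ℍ → ℂ} (hφ : Integrable φ) :
    ∫ z, ‖conv (heatK a) φ z‖ ≤ ∫ w, ‖φ w‖ := by
  obtain ⟨C, hk⟩ := exists_isKernel_heatK_ofReal ha
  have hp := (hk.integrable_prod hφ).norm
  calc ∫ z, ‖conv (heatK a) φ z‖ ≤ ∫ z, ∫ w, ‖heatK a (coshDist z w) * φ w‖ :=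
        integral_mono (hk.integrable_conv hφ).norm hp.integral_prod_left
          fun z => norm_integral_le_integral_norm _
    _ = ∫ w, ∫ z, ‖heatK a (coshDist z w) * φ w‖ := integral_integral_swap hp
    _ = ∫ w, ‖φ w‖ := by
        congr with w
        simp_rw [norm_mul]
        rw [integral_mul_const, integral_norm_heatK ha, one_mul]

lemma tendsto_conv_heatK_of_continuous {φ : ℍ → ℂ} (hc : Continuous φ) (hs : HasCompactSupport φ) :
    Tendsto (fun a : ℝ => ∫ z, ‖conv (heatK a) φ z - φ z‖) (𝓝[>] 0) (𝓝 0) := by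
  have hφ : Integrable φ := hc.integrable_of_hasCompactSupport hs
  obtain ⟨r, hr⟩ := hs.isBounded.subset_closedBall I
  set K := Metric.closedBall (I : ℍ) (r + 1) with hK
  have hKm : MeasurableSet K := Metric.isClosed_closedBall.measurableSet
  have hKf : volume K ≠ ⊤ := (isCompact_closedBall _ _).measure_lt_top.ne
  set V := volume.real K with hV
  have hV0 : 0 ≤ V := measureReal_nonneg
  rw [Metric.tendsto_nhds]
  intro ε hε
  set ε' := ε / 2 / (V + 1) with hε'
  have hε'0 : 0 < ε' := by positivity
  obtain ⟨d, hd0, hd⟩ := Metric.uniformContinuous_iff.1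
    (hs.uniformContinuous_of_continuous hc) ε' hε'0
  set d' := min d 1 with hd'
  have hd'0 : 0 < d' := lt_min hd0 one_pos
  have hη : 0 < Real.cosh d' - 1 := by linarith [Real.one_lt_cosh.2 hd'0.ne']
  obtain ⟨e, he, htail⟩ := heatK_tail hη
  set N := ∫ w, ‖φ w‖ with hN
  have hlim : Tendsto (fun a => e a * (2 * areaConst * N)) (𝓝[>] 0) (𝓝 0) := by
    simpa using he.mul_const (2 * areaConst * N)
  have hev : ∀ᶠ a : ℝ in 𝓝[>] 0, a ≤ 1 :=
    mem_nhdsWithin_of_mem_nhds (Iic_mem_nhds one_pos)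
  filter_upwards [self_mem_nhdsWithin, hev, hlim.eventually_lt_const (half_pos hε)]
    with a (ha : 0 < a) ha1 hsmall
  obtain ⟨he0, htail⟩ := htail a ha ha1
  obtain ⟨C, hk⟩ := exists_isKernel_heatK_ofReal ha
  have hq : IsKernel (fun ρ : ℝ => ((1 / ρ ^ 2 : ℝ) : ℂ)) 1 := by
    refine ⟨?_, fun ρ hρ => ?_⟩
    · refine Complex.continuous_ofReal.comp_continuousOn
        (continuousOn_const.div (by fun_prop) fun ρ (hρ : 1 ≤ ρ) => ?_)
      have : ρ ≠ 0 := by linarith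
      positivity
    · rw [Complex.norm_of_nonneg (by positivity)]
  have hqr := fun z => integrable_one_div_coshDist_sq z
  have hqφ : ∀ z, Integrable (fun w => 1 / coshDist z w ^ 2 * ‖φ w‖) := fun z => by
    refine (hq.isBddKernel.integrable_mul hφ z).norm.congr (Eventually.of_forall fun w => ?_)
    simp only
    rw [norm_mul, Complex.norm_of_nonneg (by positivity)]
  have hqp := (hq.integrable_prod hφ).norm
  have hsw : Integrable (fun z => ∫ w, 1 / coshDist z w ^ 2 * ‖φ w‖) ∧
      ∫ z, ∫ w, 1 / coshDist z w ^ 2 * ‖φ w‖ = areaConst * N := by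
    have e1 : (fun p : ℍ × ℍ => ‖((1 / coshDist p.1 p.2 ^ 2 : ℝ) : ℂ) * φ p.2‖) =
        fun p : ℍ × ℍ => 1 / coshDist p.1 p.2 ^ 2 * ‖φ p.2‖ := by
      funext p
      rw [norm_mul, Complex.norm_of_nonneg (by positivity)]
    rw [e1] at hqp
    refine ⟨hqp.integral_prod_left, (integral_integral_swap hqp).trans ?_⟩
    rw [hN, ← integral_const_mul]
    congr with w
    simp_rw [coshDist_comm _ w]
    rw [integral_mul_const, (hqr w).2]
  -- Within distance `d'` uniform continuity bounds the increment by `ε'`, and it vanishes unless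
  -- `z` lies in the enlarged support `K`. Farther away the tail is at most `e a / cosh(d)^2`. Both
  -- terms are integrable in `z`.
  have hpt : ∀ z, ‖conv (heatK a) φ z - φ z‖ ≤ ε' * K.indicator 1 z +
      e a * ((∫ w, 1 / coshDist z w ^ 2 * ‖φ w‖) + areaConst * ‖φ z‖) := by
    intro z
    have i1 := (hk.integrable_kernel z).1
    have i1' : Integrable fun w => heatK a (coshDist z w) := by simpa only [coshDist_comm] using i1
    have e1 : conv (heatK a) φ z - φ z = ∫ w, heatK a (coshDist z w) * (φ w - φ z) := by
      simp_rw [mul_sub]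
      rw [integral_sub (hk.isBddKernel.integrable_mul hφ z) (i1'.mul_const _), integral_mul_const,
        integral_heatK ha, one_mul, conv]
    have i2 : Integrable (fun w => ‖heatK a (coshDist w z)‖ * (ε' * K.indicator 1 z)) :=
      i1.norm.mul_const _
    have i3 : Integrable (fun w => e a * (1 / coshDist z w ^ 2 * ‖φ w‖ +
        1 / coshDist z w ^ 2 * ‖φ z‖)) :=
      ((hqφ z).add ((hqr z).1.mul_const ‖φ z‖)).const_mul (e a)
    rw [e1]
    refine (norm_integral_le_of_norm_le (i2.add i3)
      (Eventually.of_forall fun w => ?_)).trans_eq ?_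
    · have hmain : ‖heatK a (coshDist z w)‖ * ‖φ w - φ z‖ ≤
          ‖heatK a (coshDist z w)‖ * (ε' * K.indicator 1 z) +
          e a * (1 / coshDist z w ^ 2 * ‖φ w‖ + 1 / coshDist z w ^ 2 * ‖φ z‖) := by
        have hsec : 0 ≤ e a * (1 / coshDist z w ^ 2 * ‖φ w‖ + 1 / coshDist z w ^ 2 * ‖φ z‖) := by
          positivity
        have hind : 0 ≤ ε' * K.indicator (1 : ℍ → ℝ) z :=
          mul_nonneg hε'0.le (Set.indicator_nonneg (fun _ _ => zero_le_one) _)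
        rcases lt_or_ge (coshDist z w) (Real.cosh d') with hlt | hge
        · have hdist : dist z w < d' := by
            rw [coshDist, Real.cosh_lt_cosh, abs_of_nonneg dist_nonneg,
              abs_of_nonneg hd'0.le] at hlt
            exact hlt
          refine le_add_of_le_of_nonneg (mul_le_mul_of_nonneg_left ?_ (norm_nonneg _)) hsec
          by_cases hz : z ∈ K
          · rw [Set.indicator_of_mem hz, Pi.one_apply, mul_one, ← dist_eq_norm]
            refine (hd ?_).le
            rw [dist_comm]
            exact hdist.trans_le (min_le_left _ _)
          · have hz' : r + 1 < dist z I := not_le.1 hz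
            have h0 : ∀ y, r < dist y I → φ y = 0 := fun y hy => by
              by_contra hcon
              exact absurd (hr (subset_tsupport φ hcon)) (not_le.2 hy)
            have hw : r < dist w I := by
              have := dist_triangle z w I
              have := min_le_right d 1
              linarith
            rw [h0 z (by linarith), h0 w hw]
            simpa using hind
        · have ht := htail (coshDist z w) (by linarith)
          refine le_add_of_nonneg_of_le (mul_nonneg (norm_nonneg _) hind) ?_
          calc _ ≤ e a / coshDist z w ^ 2 * (‖φ w‖ + ‖φ z‖) :=
                mul_le_mul ht (norm_sub_le _ _) (norm_nonneg _) (by positivity)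
            _ = _ := by ring
      rw [norm_mul]
      simpa only [Pi.add_apply, coshDist_comm w z] using hmain
    · simp only [Pi.add_apply]
      rw [integral_add i2 i3, integral_mul_const, integral_norm_heatK ha,
        one_mul, integral_const_mul, integral_add (hqφ z) ((hqr z).1.mul_const _), integral_mul_const, (hqr z).2]
  have j1 : Integrable (fun z => ε' * K.indicator (1 : ℍ → ℝ) z) :=
    ((integrable_indicator_iff hKm).2 (integrableOn_const hKf)).const_mul ε'
  have j2 : Integrable (fun z => e a * ((∫ w, 1 / coshDist z w ^ 2 * ‖φ w‖) +
      areaConst * ‖φ z‖)) := (hsw.1.add (hφ.norm.const_mul areaConst)).const_mul (e a)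
  rw [dist_zero_right, Real.norm_of_nonneg (integral_nonneg fun z => norm_nonneg _)]
  calc ∫ z, ‖conv (heatK a) φ z - φ z‖ ≤ _ :=
        integral_mono ((hk.integrable_conv hφ).sub hφ).norm (j1.add j2) hpt
    _ = ε' * V + e a * (2 * areaConst * N) := by
        simp only [Pi.add_apply]
        rw [integral_add j1 j2, integral_const_mul, integral_const_mul, integral_add hsw.1 (hφ.norm.const_mul areaConst), hsw.2, integral_const_mul,
          integral_indicator_one hKm]
        ring
    _ < ε / 2 + ε / 2 := by
        refine add_lt_add_of_le_of_lt ?_ hsmall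
        rw [hε', div_mul_eq_mul_div, div_le_iff₀ (by positivity)]
        nlinarith
    _ = ε := add_halves ε

/-- The heat semigroup is an approximation of the identity in `L¹`. -/
lemma tendsto_conv_heatK {φ : ℍ → ℂ} (hφ : Integrable φ) :
    Tendsto (fun a : ℝ => ∫ z, ‖conv (heatK a) φ z - φ z‖) (𝓝[>] 0) (𝓝 0) := by
  rw [Metric.tendsto_nhds]
  intro ε hε
  obtain ⟨g, gs, hg, gc, gi⟩ := hφ.exists_hasCompactSupport_integral_sub_le
    (show 0 < ε / 4 by positivity)
  filter_upwards [self_mem_nhdsWithin,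
    (tendsto_conv_heatK_of_continuous gc gs).eventually_lt_const (half_pos hε)] with a ha hlt
  have ha : 0 < a := ha
  obtain ⟨C, hk⟩ := exists_isKernel_heatK_ofReal ha
  rw [dist_zero_right, Real.norm_of_nonneg (integral_nonneg fun z => norm_nonneg _)]
  have hd : Integrable fun z => φ z - g z := hφ.sub gi
  have i1 := (hk.integrable_conv hd).norm
  have i2 : Integrable fun z => ‖conv (heatK a) g z - g z‖ := ((hk.integrable_conv gi).sub gi).norm
  have i3 := hd.norm
  have i4 : Integrable fun z => ‖conv (heatK a) (fun z => φ z - g z) z‖ +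
    ‖conv (heatK a) g z - g z‖ := i1.add i2
  have hpt : ∀ z, ‖conv (heatK a) φ z - φ z‖ ≤
      ‖conv (heatK a) (fun z => φ z - g z) z‖ + ‖conv (heatK a) g z - g z‖ + ‖φ z - g z‖ := by
    intro z
    have : conv (heatK a) (fun z => φ z - g z) z = conv (heatK a) φ z - conv (heatK a) g z := by
      rw [conv, conv, conv, ← integral_sub (hk.isBddKernel.integrable_mul hφ z)
        (hk.isBddKernel.integrable_mul gi z)]
      congr with w
      ring
    calc _ = ‖conv (heatK a) (fun z => φ z - g z) z + (conv (heatK a) g z - g z) -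
          (φ z - g z)‖ := by rw [this]; ring_nf
      _ ≤ _ := (norm_sub_le _ _).trans (by gcongr; exact norm_add_le _ _)
  calc _ ≤ ∫ z, (‖conv (heatK a) (fun z => φ z - g z) z‖ + ‖conv (heatK a) g z - g z‖ +
        ‖φ z - g z‖) := integral_mono ((hk.integrable_conv hφ).sub hφ).norm (i4.add i3) hpt
    _ = (∫ z, ‖conv (heatK a) (fun z => φ z - g z) z‖) + (∫ z, ‖conv (heatK a) g z - g z‖) +
        ∫ z, ‖φ z - g z‖ := by
        rw [integral_add i4 i3, integral_add i1 i2]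
    _ < ε := by
        have := integral_norm_conv_heatK_le ha hd
        linarith

/-! ### Compactly supported approximations of the heat kernel. -/

lemma heatK_bounds {τ : ℂ} (h : 0 < τ.re) (N : ℕ) : ∃ C : ℝ, 0 < C ∧ ∀ ρ : ℝ, 1 ≤ ρ →
    ‖heatK τ ρ‖ ≤ C / ρ ^ N ∧ ‖heatK1 τ ρ‖ ≤ C / ρ ^ N ∧ ‖heatK2 τ ρ‖ ≤ C / ρ ^ N := by
  obtain ⟨C, hC, hb⟩ := heatQ_bound_self h (N + 1)
  have key : ∀ g : ℝ → ℂ, ContinuousOn g (Set.Ioi 0) →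
      (∀ σ, 0 < σ → ‖g σ‖ ≤ C / (1 + σ) ^ (N + 1)) → ∀ ρ : ℝ, 1 ≤ ρ →
      ‖heatC τ * ∫ x : ℝ, g (ρ + x ^ 2)‖ ≤ (‖heatC τ‖ + 1) * (C * Real.pi + 1) / ρ ^ N := by
    intro g hg hgb ρ hρ
    have := (integrable_comp_add_sq hg hC hgb (show 0 < ρ by linarith)).2
    rw [norm_mul, mul_div_assoc]
    refine mul_le_mul (by linarith) (this.trans ?_) (norm_nonneg _) (by positivity)
    gcongr <;> linarith
  exact ⟨(‖heatC τ‖ + 1) * (C * Real.pi + 1), by positivity, fun ρ hρ =>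
    ⟨key _ (continuousOn_heatQ τ) (fun σ hσ => (hb σ hσ).1) ρ hρ,
    key _ (continuousOn_heatQ1 τ) (fun σ hσ => (hb σ hσ).2.1) ρ hρ,
    key _ (continuousOn_heatQ2 τ) (fun σ hσ => (hb σ hσ).2.2.1) ρ hρ⟩⟩

lemma exists_bound_deriv_smoothTransition : ∃ B : ℝ, 0 < B ∧ ∀ x : ℝ,
    |deriv Real.smoothTransition x| ≤ B ∧ |deriv (deriv Real.smoothTransition) x| ≤ B := by
  have hs : ContDiff ℝ ∞ Real.smoothTransition := Real.smoothTransition.contDiff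
  have hs1 : ContDiff ℝ ∞ (deriv Real.smoothTransition) := hs.deriv'
  have hs2 : ContDiff ℝ ∞ (deriv (deriv Real.smoothTransition)) := hs1.deriv'
  have hc : HasCompactSupport (deriv Real.smoothTransition) := by
    refine HasCompactSupport.of_support_subset_isCompact (isCompact_Icc (a := (0 : ℝ)) (b := 1))
      fun x hx => ?_
    by_contra hcon
    refine hx ?_
    rcases lt_or_ge x 0 with h | h
    · have : Real.smoothTransition =ᶠ[𝓝 x] fun _ => 0 := by
        filter_upwards [Iio_mem_nhds h] with y hy
        exact Real.smoothTransition.zero_of_nonpos (le_of_lt hy)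
      rw [this.deriv_eq, deriv_const]
    · have h1 : 1 < x := by
        by_contra h2
        exact hcon ⟨h, not_lt.1 h2⟩
      have : Real.smoothTransition =ᶠ[𝓝 x] fun _ => 1 := by
        filter_upwards [Ioi_mem_nhds h1] with y hy
        exact Real.smoothTransition.one_of_one_le (le_of_lt hy)
      rw [this.deriv_eq, deriv_const]
  obtain ⟨B1, h1⟩ := hs1.continuous.bounded_above_of_compact_support hc
  obtain ⟨B2, h2⟩ := hs2.continuous.bounded_above_of_compact_support hc.deriv
  refine ⟨max (max B1 B2) 1, by positivity, fun x => ⟨?_, ?_⟩⟩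
  · exact (h1 x).trans ((le_max_left _ _).trans (le_max_left _ _))
  · exact (h2 x).trans ((le_max_right _ _).trans (le_max_left _ _))

/-- Smooth cutoff functions at scale `R`. -/
lemma exists_cutoff : ∃ B : ℝ, 0 < B ∧ ∀ R : ℝ, 1 ≤ R → ∃ c c1 c2 : ℝ → ℂ,
    (∀ ρ, HasDerivAt c (c1 ρ) ρ) ∧ (∀ ρ, HasDerivAt c1 (c2 ρ) ρ) ∧ Continuous c2 ∧
    (∀ ρ, 2 * R ≤ ρ → c ρ = 0) ∧ (∀ ρ, 1 ≤ ρ → ‖c ρ - 1‖ ≤ ρ / R) ∧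
    ∀ ρ, ‖c1 ρ‖ ≤ B / R ∧ ‖c2 ρ‖ ≤ B / R := by
  obtain ⟨B, hB, hb⟩ := exists_bound_deriv_smoothTransition
  have hs : ContDiff ℝ ∞ Real.smoothTransition := Real.smoothTransition.contDiff
  have hs1 : ContDiff ℝ ∞ (deriv Real.smoothTransition) := hs.deriv'
  have hs2 : ContDiff ℝ ∞ (deriv (deriv Real.smoothTransition)) := hs1.deriv'
  refine ⟨B, hB, fun R hR => ?_⟩
  have hR0 : 0 < R := by linarith
  have hin : ∀ ρ : ℝ, HasDerivAt (fun ρ : ℝ => 2 - ρ / R) (-(1 / R)) ρ := fun ρ =>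
    ((hasDerivAt_id ρ).div_const R).const_sub 2
  have hd : ∀ g : ℝ → ℝ, ContDiff ℝ ∞ g → ∀ ρ,
      HasDerivAt (fun ρ => g (2 - ρ / R)) (deriv g (2 - ρ / R) * -(1 / R)) ρ := fun g hg ρ =>
    HasDerivAt.comp ρ ((hg.differentiable (by simp)) _).hasDerivAt (hin ρ)
  refine ⟨fun ρ => (Real.smoothTransition (2 - ρ / R) : ℝ),
    fun ρ => (deriv Real.smoothTransition (2 - ρ / R) * -(1 / R) : ℝ),
    fun ρ => (deriv (deriv Real.smoothTransition) (2 - ρ / R) * -(1 / R) * -(1 / R) : ℝ),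
    fun ρ => (hd _ hs ρ).ofReal_comp, fun ρ => ((hd _ hs1 ρ).mul_const _).ofReal_comp,
    ?_, fun ρ hρ => ?_, fun ρ hρ => ?_, fun ρ => ⟨?_, ?_⟩⟩
  · have := hs2.continuous
    fun_prop
  · have : 2 - ρ / R ≤ 0 := by
      rw [sub_nonpos, le_div_iff₀ hR0]
      exact hρ
    simp [Real.smoothTransition.zero_of_nonpos this]
  · rw [← Complex.ofReal_one, ← Complex.ofReal_sub, Complex.norm_real, Real.norm_eq_abs,
      abs_sub_comm, abs_of_nonneg (sub_nonneg.2 (Real.smoothTransition.le_one _))]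
    rcases le_or_gt ρ R with h | h
    · have : 1 ≤ 2 - ρ / R := by
        have := (div_le_one hR0).2 h
        linarith
      rw [Real.smoothTransition.one_of_one_le this, sub_self]
      positivity
    · have h1 := (one_le_div hR0).2 h.le
      have h2 := Real.smoothTransition.nonneg (2 - ρ / R)
      linarith
  · rw [Complex.norm_real, Real.norm_eq_abs, abs_mul, abs_neg, abs_of_pos (by positivity : 0 < 1 / R),
      mul_one_div]
    gcongr
    exact (hb _).1
  · rw [Complex.norm_real, Real.norm_eq_abs, abs_mul, abs_mul, abs_neg,
      abs_of_pos (by positivity : 0 < 1 / R)]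
    have h1 : 1 / R ≤ 1 := (div_le_one hR0).2 hR
    calc _ ≤ B * (1 / R) * 1 := by
          gcongr
          exact (hb _).2
      _ = _ := by ring

/-- Approximation of the heat kernel by compactly supported kernels. -/
lemma exists_truncation {τ : ℂ} (h : 0 < τ.re) : ∃ C : ℝ, 0 < C ∧ ∀ R : ℝ, 1 ≤ R →
    ∃ k k1 k2 : ℝ → ℂ, (∀ ρ, 0 < ρ → HasDerivAt k (k1 ρ) ρ) ∧
    (∀ ρ, 0 < ρ → HasDerivAt k1 (k2 ρ) ρ) ∧ ContinuousOn k2 (Set.Ioi 0) ∧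
    (∀ ρ, 2 * R ≤ ρ → k ρ = 0) ∧ IsKernel (fun ρ => k ρ - heatK τ ρ) (C / R) ∧
    IsKernel (fun ρ => (((ρ : ℂ) ^ 2 - 1) * k2 ρ + 2 * ρ * k1 ρ) - heatL τ ρ) (C / R) := by
  obtain ⟨B, hB, hcut⟩ := exists_cutoff
  -- Five powers of decay: two pay for the coefficient `ρ ^ 2` of the Laplacian, one for the cutoff
  -- error `ρ / R`, and two are the decay required of the result.
  obtain ⟨A, hA, hb⟩ := heatK_bounds h 5
  refine ⟨3 * A + 5 * A * B, by positivity, fun R hR => ?_⟩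
  have hR0 : 0 < R := by linarith
  obtain ⟨c, c1, c2, d0, d1, hc2, hz, h0, hbd⟩ := hcut R hR
  have hc : Continuous c := continuous_iff_continuousAt.2 fun ρ => (d0 ρ).continuousAt
  have hc1 : Continuous c1 := continuous_iff_continuousAt.2 fun ρ => (d1 ρ).continuousAt
  have e0 := continuousOn_heatK h
  have e1 := continuousOn_heatK1 h
  have e2 := continuousOn_heatK2 h
  have eL := continuousOn_heatL h
  have hsub : Set.Ici (1 : ℝ) ⊆ Set.Ioi 0 := fun x (hx : 1 ≤ x) => one_pos.trans_le hx
  have ck2 : ContinuousOn (fun ρ => (heatK2 τ ρ * c ρ + heatK1 τ ρ * c1 ρ) +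
      (heatK1 τ ρ * c1 ρ + heatK τ ρ * c2 ρ)) (Set.Ioi 0) :=
    ((e2.mul hc.continuousOn).add (e1.mul hc1.continuousOn)).add
      ((e1.mul hc1.continuousOn).add (e0.mul hc2.continuousOn))
  refine ⟨fun ρ => heatK τ ρ * c ρ, fun ρ => heatK1 τ ρ * c ρ + heatK τ ρ * c1 ρ,
    fun ρ => (heatK2 τ ρ * c ρ + heatK1 τ ρ * c1 ρ) + (heatK1 τ ρ * c1 ρ + heatK τ ρ * c2 ρ),
    fun ρ hρ => (hasDerivAt_heatK h hρ).mul (d0 ρ),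
    fun ρ hρ => ((hasDerivAt_heatK1 h hρ).mul (d0 ρ)).add ((hasDerivAt_heatK h hρ).mul (d1 ρ)),
    ck2, fun ρ hρ => by simp [hz ρ hρ], ⟨?_, fun ρ hρ => ?_⟩, ⟨?_, fun ρ hρ => ?_⟩⟩
  · exact ((e0.mul hc.continuousOn).sub e0).mono hsub
  · obtain ⟨b0, -, -⟩ := hb ρ hρ
    have hρ0 : 0 < ρ := by linarith
    calc ‖heatK τ ρ * c ρ - heatK τ ρ‖ = ‖heatK τ ρ‖ * ‖c ρ - 1‖ := by
          rw [← norm_mul]; ring_nf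
      _ ≤ A / ρ ^ 5 * (ρ / R) := by
          gcongr
          exact h0 ρ hρ
      _ = A / R / ρ ^ 2 / ρ ^ 2 := by field_simp
      _ ≤ A / R / ρ ^ 2 := div_le_self (by positivity) (one_le_pow₀ hρ)
      _ ≤ _ := by
          gcongr
          nlinarith [mul_pos hA hB]
  · refine ContinuousOn.sub (ContinuousOn.add (ContinuousOn.mul (by fun_prop) (ck2.mono hsub))
      (ContinuousOn.mul (by fun_prop) ?_)) (eL.mono hsub)
    exact ((e1.mul hc.continuousOn).add (e0.mul hc1.continuousOn)).mono hsub
  · obtain ⟨b0, b1, b2⟩ := hb ρ hρ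
    obtain ⟨m1, m2⟩ := hbd ρ
    have m0 := h0 ρ hρ
    have hρ0 : 0 < ρ := by linarith
    have n1 : ‖(ρ : ℂ) ^ 2 - 1‖ ≤ ρ ^ 2 := by
      rw [← Complex.ofReal_pow, ← Complex.ofReal_one, ← Complex.ofReal_sub, Complex.norm_real,
        Real.norm_of_nonneg (by nlinarith)]
      linarith
    have n2 : ‖(2 * ρ : ℂ)‖ = 2 * ρ := by
      rw [norm_mul, Complex.norm_of_nonneg hρ0.le]
      simp
    have hL : ‖heatL τ ρ‖ ≤ 3 * ρ ^ 2 * (A / ρ ^ 5) := by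
      calc ‖heatL τ ρ‖ ≤ ‖(ρ : ℂ) ^ 2 - 1‖ * ‖heatK2 τ ρ‖ + ‖(2 * ρ : ℂ)‖ * ‖heatK1 τ ρ‖ := by
            rw [heatL, ← norm_mul, ← norm_mul]
            exact norm_add_le _ _
        _ ≤ ρ ^ 2 * (A / ρ ^ 5) + 2 * ρ ^ 2 * (A / ρ ^ 5) := by
            rw [n2]
            gcongr
            nlinarith
        _ = _ := by ring
    have e : ((ρ : ℂ) ^ 2 - 1) * ((heatK2 τ ρ * c ρ + heatK1 τ ρ * c1 ρ) +
        (heatK1 τ ρ * c1 ρ + heatK τ ρ * c2 ρ)) +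
        2 * ρ * (heatK1 τ ρ * c ρ + heatK τ ρ * c1 ρ) - heatL τ ρ =
        heatL τ ρ * (c ρ - 1) + (((ρ : ℂ) ^ 2 - 1) * (heatK1 τ ρ * c1 ρ) +
        ((ρ : ℂ) ^ 2 - 1) * (heatK1 τ ρ * c1 ρ)) + ((ρ : ℂ) ^ 2 - 1) * (heatK τ ρ * c2 ρ) +
        2 * ρ * (heatK τ ρ * c1 ρ) := by
      rw [heatL]
      ring
    have hx : 2 * ρ ≤ 2 * ρ ^ 2 := by nlinarith
    have hy : ρ ^ 2 ≤ ρ ^ 3 := pow_le_pow_right₀ hρ (by norm_num)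
    simp only
    rw [e]
    calc _ ≤ ‖heatL τ ρ‖ * ‖c ρ - 1‖ + (‖(ρ : ℂ) ^ 2 - 1‖ * (‖heatK1 τ ρ‖ * ‖c1 ρ‖) +
          ‖(ρ : ℂ) ^ 2 - 1‖ * (‖heatK1 τ ρ‖ * ‖c1 ρ‖)) +
          ‖(ρ : ℂ) ^ 2 - 1‖ * (‖heatK τ ρ‖ * ‖c2 ρ‖) + ‖(2 * ρ : ℂ)‖ * (‖heatK τ ρ‖ * ‖c1 ρ‖) := by
          simp only [← norm_mul]
          refine (norm_add_le _ _).trans ?_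
          gcongr
          refine (norm_add_le _ _).trans ?_
          gcongr
          refine (norm_add_le _ _).trans ?_
          gcongr
          exact norm_add_le _ _
      _ ≤ 3 * ρ ^ 2 * (A / ρ ^ 5) * (ρ / R) + (ρ ^ 3 * (A / ρ ^ 5 * (B / R)) +
          ρ ^ 3 * (A / ρ ^ 5 * (B / R))) + ρ ^ 3 * (A / ρ ^ 5 * (B / R)) +
          2 * ρ ^ 3 * (A / ρ ^ 5 * (B / R)) := by
          have n1' := n1.trans hy
          have n2' : ‖(2 * ρ : ℂ)‖ ≤ 2 * ρ ^ 3 := by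
            rw [n2]
            linarith
          gcongr
      _ = (3 * A + 5 * A * B) / R / ρ ^ 2 := by
          field_simp
          ring

/-! ### Weak solutions paired with the regularized flow. -/

/-- Continuity of `u` and joint continuity of `P` make the derivatives converge uniformly near `s`,
so the weak equation survives strong limits of the tested functions `g n` and `l n`. -/
lemma hasDerivAt_apply₂_of_tendsto {E : Type*} [NormedAddCommGroup E] [NormedSpace ℂ E]
    (P : E →L[ℂ] E →L[ℂ] ℂ) {u : ℝ → E} (hu : Continuous u) {g l : ℕ → E} {g' l' : E}
    (hg : Tendsto g atTop (𝓝 g')) (hl : Tendsto l atTop (𝓝 l'))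
    (hd : ∀ n s, HasDerivAt (fun s => P (u s) (g n)) (Complex.I * P (u s) (l n)) s) (s : ℝ) :
    HasDerivAt (fun s => P (u s) g') (Complex.I * P (u s) l') s := by
  refine hasDerivAt_of_tendstoUniformlyOnFilter (l := atTop) (f := fun n s => P (u s) (g n))
    (f' := fun n s => Complex.I * P (u s) (l n)) (g' := fun s => Complex.I * P (u s) l') ?_
    (Eventually.of_forall fun q => hd q.1 q.2) (Eventually.of_forall fun y => ?_)
  · rw [tendstoUniformlyOnFilter_iff_tendsto]
    have h1 : Tendsto (fun q : ℕ × ℝ => Complex.I * P (u q.2) (l q.1)) (atTop ×ˢ 𝓝 s)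
        (𝓝 (Complex.I * P (u s) l')) := by
      refine tendsto_const_nhds.mul ?_
      exact (P.continuous₂.tendsto (u s, l')).comp
        (((hu.tendsto s).comp tendsto_snd).prodMk_nhds (hl.comp tendsto_fst))
    have h2 : Tendsto (fun q : ℕ × ℝ => Complex.I * P (u q.2) l') (atTop ×ˢ 𝓝 s)
        (𝓝 (Complex.I * P (u s) l')) := by
      refine tendsto_const_nhds.mul ?_
      exact (P.continuous₂.tendsto (u s, l')).comp
        (((hu.tendsto s).comp tendsto_snd).prodMk_nhds tendsto_const_nhds)
    exact (h2.prodMk_nhds h1).mono_right (nhds_le_uniformity _)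
  · exact ((P (u y)).continuous.tendsto g').comp hg

/-- A product rule in which `u` is only continuous and differentiable against the frozen vector `w
s`. The remaining difference quotient falls on `w`, where strong convergence of slopes and
continuity of `u` suffice. -/
lemma hasDerivAt_apply₂ {E : Type*} [NormedAddCommGroup E] [NormedSpace ℂ E]
    (P : E →L[ℂ] E →L[ℂ] ℂ) {u w : ℝ → E} {s : ℝ} (hu : ContinuousAt u s) {d : ℂ} {w' : E}
    (h1 : HasDerivAt (fun r => P (u r) (w s)) d s) (hw : HasDerivAt w w' s) :
    HasDerivAt (fun r => P (u r) (w r)) (d + P (u s) w') s := by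
  rw [hasDerivAt_iff_tendsto_slope] at *
  have h2 : Tendsto (fun r => P (u r) (slope w s r)) (𝓝[≠] s) (𝓝 (P (u s) w')) :=
    (P.continuous₂.tendsto (u s, w')).comp
      ((hu.tendsto.mono_left nhdsWithin_le_nhds).prodMk_nhds hw)
  refine (h1.add h2).congr fun r => ?_
  simp only [slope, vsub_eq_sub]
  rw [ContinuousLinearMap.map_smul_of_tower, map_sub]
  simp only [smul_sub]
  ring

/-- The bilinear pairing on `L²`. -/
noncomputable def pairing : Lp ℂ 2 (volume : Measure ℍ) →L[ℂ] Lp ℂ 2 (volume : Measure ℍ) →L[ℂ] ℂ :=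
  ContinuousLinearMap.lpPairing volume 2 2 (ContinuousLinearMap.mul ℂ ℂ)

lemma pairing_eq {f g : Lp ℂ 2 (volume : Measure ℍ)} {g' : ℍ → ℂ} (h : g =ᵐ[volume] g') :
    pairing f g = ∫ z, f z * g' z := by
  rw [pairing, ContinuousLinearMap.lpPairing_eq_integral]
  refine integral_congr_ae ?_
  filter_upwards [h] with z hz
  rw [hz, ContinuousLinearMap.mul_apply']

lemma IsKernel.add {k k' : ℝ → ℂ} {M M' : ℝ} (hk : IsKernel k M) (hk' : IsKernel k' M') :
    IsKernel (fun ρ => k ρ + k' ρ) (M + M') where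
  cont := hk.cont.add hk'.cont
  bound ρ hρ := (norm_add_le _ _).trans (by
    rw [add_div]; exact add_le_add (hk.bound ρ hρ) (hk'.bound ρ hρ))

lemma IsTestFunction.memLp {ψ : ℂ → ℂ} (hψ : IsTestFunction ψ) :
    MemLp (fun z : ℍ => ψ z) 2 volume :=
  hψ.continuous_coe.memLp_of_hasCompactSupport hψ.hasCompactSupport_coe

/-- The regularized propagator gives solutions of the Schrödinger equation. -/
lemma isL2Solution_heatK {a : ℝ} (ha : 0 < a) {φ : ℍ → ℂ} (hφ : Integrable φ) :
    IsL2Solution fun s : ℝ => convLp (heatK (a + s * Complex.I)) φ where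
  continuous := continuous_iff_continuousAt.2 fun s => (hasDerivAt_convLp_heatK ha hφ s).continuousAt
  weak_eq ψ hψ t := by
    have hre : 0 < ((a : ℂ) + t * Complex.I).re := by simpa using ha
    obtain ⟨C, k1, k2⟩ := exists_isKernel_heat hre
    have hΨ := hψ.memLp.coeFn_toLp
    have hd := ((pairing.flip hψ.memLp.toLp).restrictScalars ℝ).hasFDerivAt.comp_hasDerivAt t
      (hasDerivAt_convLp_heatK ha hφ t)
    have e1 : ∀ f : Lp ℂ 2 (volume : Measure ℍ), pairing f hψ.memLp.toLp = ∫ z, f z * ψ z :=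
      fun f => pairing_eq hΨ
    convert! hd using 1
    · funext s
      exact (e1 _).symm
    · change _ = pairing (Complex.I • convLp (heatL (a + t * Complex.I)) φ) hψ.memLp.toLp
      rw [map_smul, _root_.smul_apply, smul_eq_mul, e1]
      congr 1
      calc ∫ z : ℍ, convLp (heatK (a + t * Complex.I)) φ z * hypLaplacian ψ z
          = ∫ z : ℍ, conv (heatK (a + t * Complex.I)) φ z * hypLaplacian ψ z := by
            refine integral_congr_ae ?_
            filter_upwards [k1.convLp_ae hφ] with z hz
            rw [hz]
        _ = ∫ z : ℍ, φ z * conv (heatK (a + t * Complex.I)) (hypLaplacian ψ) z :=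
            k1.isBddKernel.integral_conv_mul hφ hψ.integrable_hypLaplacian
        _ = ∫ z : ℍ, φ z * conv (heatL (a + t * Complex.I)) (fun w => ψ w) z := by
            simp_rw [hψ.conv_hypLaplacian (fun ρ hρ => hasDerivAt_heatK hre hρ)
              (fun ρ hρ => hasDerivAt_heatK1 hre hρ) (continuousOn_heatK2 hre)]
            rfl
        _ = ∫ z : ℍ, conv (heatL (a + t * Complex.I)) φ z * ψ z :=
            (k2.isBddKernel.integral_conv_mul hφ hψ.integrable).symm
        _ = _ := by
            refine integral_congr_ae ?_
            filter_upwards [k2.convLp_ae hφ] with z hz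
            rw [hz]

/-- Every solution satisfies the weak equation against heat flows of test functions. -/
lemma IsL2Solution.hasDerivAt_pairing_heatK {u : ℝ → Lp ℂ 2 (volume : Measure ℍ)}
    (hu : IsL2Solution u) {τ : ℂ} (h : 0 < τ.re) {ψ : ℂ → ℂ} (hψ : IsTestFunction ψ) (s : ℝ) :
    HasDerivAt (fun s => pairing (u s) (convLp (heatK τ) fun w => ψ w))
      (Complex.I * pairing (u s) (convLp (heatL τ) fun w => ψ w)) s := by
  obtain ⟨C, hC, htr⟩ := exists_truncation h
  obtain ⟨M, hk, hL⟩ := exists_isKernel_heat h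
  have hR : ∀ n : ℕ, (1 : ℝ) ≤ (n : ℝ) + 1 := fun n => by simp
  choose k k1 k2 d1 d2 c2 hz e1 e2 using fun n : ℕ => htr ((n : ℝ) + 1) (hR n)
  have hφ := hψ.integrable
  have hk' : ∀ n, IsKernel (k n) (C / ((n : ℝ) + 1) + M) := fun n => by
    simpa using (e1 n).add hk
  have hL' : ∀ n, IsKernel (fun ρ => ((ρ : ℂ) ^ 2 - 1) * k2 n ρ + 2 * ρ * k1 n ρ)
      (C / ((n : ℝ) + 1) + M) := fun n => by simpa using (e2 n).add hL
  have hlim : Tendsto (fun n : ℕ => C / ((n : ℝ) + 1) * (√areaConst * ∫ w : ℍ, ‖ψ w‖)) atTop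
      (𝓝 0) := by
    have := tendsto_one_div_add_atTop_nhds_zero_nat.const_mul C
    simpa [div_eq_mul_inv] using this.mul_const (√areaConst * ∫ w : ℍ, ‖ψ w‖)
  refine hasDerivAt_apply₂_of_tendsto pairing hu.continuous
    (g := fun n => convLp (k n) fun w => ψ w)
    (l := fun n => convLp (fun ρ => ((ρ : ℂ) ^ 2 - 1) * k2 n ρ + 2 * ρ * k1 n ρ) fun w => ψ w)
    ?_ ?_ (fun n s => ?_) s
  · rw [tendsto_iff_norm_sub_tendsto_zero]
    refine squeeze_zero (fun n => norm_nonneg _) (fun n => ?_) hlim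
    rw [← (hk' n).convLp_sub hk hφ]
    exact (e1 n).norm_convLp_le hφ
  · rw [tendsto_iff_norm_sub_tendsto_zero]
    refine squeeze_zero (fun n => norm_nonneg _) (fun n => ?_) hlim
    rw [← (hL' n).convLp_sub hL hφ]
    exact (e2 n).norm_convLp_le hφ
  · have hw := hu.weak_eq _ ((hk' n).isTestFunction_convExt (hz n) hψ) s
    have hlap := hypLaplacian_convExt (hk' n) (hz n) (d1 n) (d2 n) (c2 n) (hL' n) hψ
    convert! hw using 1
    · funext r
      simp_rw [convExt_coe]
      exact pairing_eq ((hk' n).convLp_ae hφ)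
    · congr 1
      exact pairing_eq (((hL' n).convLp_ae hφ).trans hlap.symm)

/-- Duality between a solution and the regularized propagator. -/
lemma IsL2Solution.pairing_heatK_eq {u : ℝ → Lp ℂ 2 (volume : Measure ℍ)}
    (hu : IsL2Solution u) {a : ℝ} (ha : 0 < a) {ψ : ℂ → ℂ} (hψ : IsTestFunction ψ) (t : ℝ) :
    pairing (u t) (convLp (heatK a) fun w => ψ w) =
      pairing (u 0) (convLp (heatK (a + t * Complex.I)) fun w => ψ w) := by
  have hre : ∀ r : ℝ, 0 < ((a : ℂ) + r * Complex.I).re := fun r => by simpa using ha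
  -- The test vector runs backward in time as `t - s`, so its derivative cancels that of `u`. The
  -- ends `s = t` and `s = 0` of the constant function are the two sides of the identity.
  have hd : ∀ s : ℝ, HasDerivAt (fun s : ℝ => pairing (u s)
      (convLp (heatK (a + (t - s : ℝ) * Complex.I)) fun w => ψ w)) 0 s := by
    intro s
    have h1 := hu.hasDerivAt_pairing_heatK (hre (t - s)) hψ s
    have h2 := (hasDerivAt_convLp_heatK ha hψ.integrable (t - s)).scomp s
      ((hasDerivAt_id s).const_sub t)
    have := hasDerivAt_apply₂ pairing hu.continuous.continuousAt h1 h2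
    convert! this using 1
    simp
  have hc := is_const_of_deriv_eq_zero (fun s => (hd s).differentiableAt) (fun s => (hd s).deriv) t 0
  simpa using hc

lemma IsTestFunction.exists_norm_le {ψ : ℂ → ℂ} (hψ : IsTestFunction ψ) :
    ∃ A, ∀ z : ℍ, ‖ψ z‖ ≤ A :=
  hψ.continuous_coe.bounded_above_of_compact_support hψ.hasCompactSupport_coe

/-- The `L¹` convergence is upgraded to `L²` by the uniform sup bound `A + A` on the difference. -/
lemma tendsto_convLp_heatK {ψ : ℂ → ℂ} (hψ : IsTestFunction ψ) :
    Tendsto (fun a : ℝ => convLp (heatK a) fun w => ψ w) (𝓝[>] 0) (𝓝 hψ.memLp.toLp) := by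
  obtain ⟨A, hA⟩ := hψ.exists_norm_le
  have h1 := (tendsto_conv_heatK hψ.integrable).const_mul (A + A)
  have h2 := (Real.continuous_sqrt.tendsto _).comp h1
  rw [mul_zero, Real.sqrt_zero] at h2
  rw [tendsto_iff_norm_sub_tendsto_zero]
  refine squeeze_zero' (Eventually.of_forall fun a => norm_nonneg _) ?_ h2
  filter_upwards [self_mem_nhdsWithin] with a (ha : 0 < a)
  obtain ⟨C, hk⟩ := exists_isKernel_heatK_ofReal ha
  have hae : (convLp (heatK a) (fun w => ψ w) - hψ.memLp.toLp : Lp ℂ 2 (volume : Measure ℍ))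
      =ᵐ[volume] fun z => conv (heatK a) (fun w => ψ w) z - ψ z := by
    filter_upwards [Lp.coeFn_sub (convLp (heatK a) fun w => ψ w) hψ.memLp.toLp,
      hk.convLp_ae hψ.integrable, hψ.memLp.coeFn_toLp] with z h3 h4 h5
    rw [h3, Pi.sub_apply, h4, h5]
  rw [Lp.norm_def, eLpNorm_congr_ae hae]
  refine ENNReal.toReal_le_of_le_ofReal (Real.sqrt_nonneg _) ?_
  exact eLpNorm_two_le_of_bounded ((hk.integrable_conv hψ.integrable).sub hψ.integrable)
    (fun z => (norm_sub_le _ _).trans (add_le_add (norm_conv_heatK_le ha hA z) (hA z))) le_rfl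

lemma isBddKernel_heatK {δ C : ℝ} (h0 : 0 < δ)
    (hC : ∀ τ : ℂ, 0 ≤ τ.re → τ ≠ 0 → ∀ ρ : ℝ, 1 ≤ ρ →
      ‖heatK τ ρ‖ ≤ C * ‖τ‖ ^ (-(3 / 2) : ℝ) * ρ ^ (-(δ / 2))) (hC0 : 0 ≤ C)
    {τ : ℂ} (h : 0 ≤ τ.re) (hτ : τ ≠ 0) : IsBddKernel (heatK τ) (C * ‖τ‖ ^ (-(3 / 2) : ℝ)) where
  cont := continuousOn_heatK_Ici h
  bound ρ hρ := (hC τ h hτ ρ hρ).trans (mul_le_of_le_one_right (by positivity)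
    (Real.rpow_le_one_of_one_le_of_nonpos hρ (by linarith)))

/-- The dispersive estimate for solutions with integrable data. -/
lemma exists_norm_integral_solution_le : ∃ C : ℝ, ∀ t : ℝ, t ≠ 0 →
    ∀ u : ℝ → Lp ℂ 2 (volume : Measure ℍ), IsL2Solution u → Integrable (u 0) →
    ∀ ψ : ℂ → ℂ, IsTestFunction ψ →
      ‖∫ z : ℍ, u t z * ψ z‖ ≤ C * |t| ^ (-(3 / 2) : ℝ) * (∫ z : ℍ, ‖ψ z‖) * ∫ z, ‖u 0 z‖ := by
  -- Any `δ` in `(0, 1)` would do: only boundedness of the kernel by a multiple of `|t|^(-3/2)` is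
  -- used.
  obtain ⟨C, hC0, hC⟩ := heatK_dispersive (δ := 1 / 2) (by norm_num) (by norm_num)
  refine ⟨C, fun t ht u hu hu0 ψ hψ => ?_⟩
  have hlim := ((pairing (u t)).continuous.tendsto _).comp (tendsto_convLp_heatK hψ)
  rw [pairing_eq hψ.memLp.coeFn_toLp] at hlim
  refine le_of_tendsto hlim.norm ?_
  filter_upwards [self_mem_nhdsWithin] with a (ha : 0 < a)
  have hre : 0 < ((a : ℂ) + t * Complex.I).re := by simpa using ha
  have hne : (a : ℂ) + t * Complex.I ≠ 0 := fun h => by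
    rw [h] at hre
    exact lt_irrefl _ hre
  obtain ⟨M, hk, -⟩ := exists_isKernel_heat hre
  have hb := isBddKernel_heatK (by norm_num) hC hC0.le hre.le hne
  have hle : |t| ≤ ‖(a : ℂ) + t * Complex.I‖ := by
    simpa using Complex.abs_im_le_norm ((a : ℂ) + t * Complex.I)
  have hpow : ‖(a : ℂ) + t * Complex.I‖ ^ (-(3 / 2) : ℝ) ≤ |t| ^ (-(3 / 2) : ℝ) :=
    Real.rpow_le_rpow_of_nonpos (abs_pos.2 ht) hle (by norm_num)
  simp only [Function.comp]
  rw [hu.pairing_heatK_eq ha hψ, pairing_eq (hk.convLp_ae hψ.integrable),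
    ← integral_const_mul]
  refine norm_integral_le_of_norm_le (hu0.norm.const_mul _) (Eventually.of_forall fun z => ?_)
  rw [norm_mul, mul_comm]
  refine mul_le_mul_of_nonneg_right ((hb.norm_conv_le hψ.integrable z).trans ?_) (norm_nonneg _)
  gcongr

lemma IsL2Solution.sub {u u' : ℝ → Lp ℂ 2 (volume : Measure ℍ)} (hu : IsL2Solution u)
    (hu' : IsL2Solution u') : IsL2Solution fun s => u s - u' s where
  continuous := hu.continuous.sub hu'.continuous
  weak_eq ψ hψ t := by
    have hΔ : MemLp (hypLaplacian ψ) 2 volume :=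
      hψ.continuous_hypLaplacian.memLp_of_hasCompactSupport hψ.hasCompactSupport_hypLaplacian
    have e1 : ∀ f : Lp ℂ 2 (volume : Measure ℍ), ∫ z, f z * ψ z = pairing f hψ.memLp.toLp :=
      fun f => (pairing_eq hψ.memLp.coeFn_toLp).symm
    have e2 : ∀ f : Lp ℂ 2 (volume : Measure ℍ), ∫ z, f z * hypLaplacian ψ z = pairing f hΔ.toLp :=
      fun f => (pairing_eq hΔ.coeFn_toLp).symm
    have h1 := hu.weak_eq ψ hψ t
    have h2 := hu'.weak_eq ψ hψ t
    simp only [e1, e2] at h1 h2 ⊢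
    convert! h1.sub h2 using 1
    · funext s
      simp
    · simp [mul_sub]

lemma IsFreeEvolution.ae_eq {t : ℝ} (ht : t ≠ 0) {φ v v' : ℍ → ℂ} (hφ : AEStronglyMeasurable φ)
    (hv : IsFreeEvolution t φ v) (hv' : IsFreeEvolution t φ v') : v =ᵐ[volume] v' := by
  obtain ⟨hl, u, hu, h0, hψ⟩ := hv
  obtain ⟨hl', u', hu', h0', hψ'⟩ := hv'
  refine ae_eq_of_forall_isTestFunction hl hl' fun ψ ht' => ?_
  obtain ⟨C, hC⟩ := exists_norm_integral_solution_le
  have hd := fun n => (hu n).sub (hu' n)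
  have hE : Tendsto (fun n => eLpNorm (u n 0 - u' n 0 : Lp ℂ 2 (volume : Measure ℍ)) 1 volume)
      atTop (𝓝 0) := by
    refine tendsto_of_tendsto_of_tendsto_of_le_of_le tendsto_const_nhds
      (by simpa using h0.add h0') (fun n => zero_le) fun n => ?_
    have m1 : AEStronglyMeasurable (fun z => u n 0 z - φ z) volume :=
      (Lp.aestronglyMeasurable _).sub hφ
    have m2 : AEStronglyMeasurable (fun z => u' n 0 z - φ z) volume :=
      (Lp.aestronglyMeasurable _).sub hφ
    refine (eLpNorm_congr_ae ?_).trans_le (eLpNorm_sub_le m1 m2 le_rfl)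
    filter_upwards [Lp.coeFn_sub (u n 0) (u' n 0)] with z hz
    rw [hz, Pi.sub_apply, Pi.sub_apply]
    ring
  -- The data `u n 0` of an arbitrary evolution lie in `L²` only; it is their difference that is
  -- eventually integrable, since its `L¹` norm tends to zero.
  have hfin : ∀ᶠ n in atTop, eLpNorm (u n 0 - u' n 0 : Lp ℂ 2 (volume : Measure ℍ)) 1 volume < ⊤ :=
    hE.eventually_lt_const (by simp)
  have hint : ∀ᶠ n in atTop, ‖(∫ z : ℍ, u n t z * ψ z) - ∫ z : ℍ, u' n t z * ψ z‖ ≤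
      C * |t| ^ (-(3 / 2) : ℝ) * (∫ z : ℍ, ‖ψ z‖) *
        (eLpNorm (u n 0 - u' n 0 : Lp ℂ 2 (volume : Measure ℍ)) 1 volume).toReal := by
    filter_upwards [hfin] with n hn
    have hi : Integrable (u n 0 - u' n 0 : Lp ℂ 2 (volume : Measure ℍ)) :=
      memLp_one_iff_integrable.1 ⟨Lp.aestronglyMeasurable _, hn⟩
    have := hC t ht _ (hd n) hi ψ ht'
    have e1 : ∀ f : Lp ℂ 2 (volume : Measure ℍ), ∫ z, f z * ψ z = pairing f ht'.memLp.toLp :=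
      fun f => (pairing_eq ht'.memLp.coeFn_toLp).symm
    rw [e1, map_sub, _root_.sub_apply, ← e1, ← e1] at this
    rwa [eLpNorm_one_eq_lintegral_enorm, ← integral_norm_eq_lintegral_enorm hi.aestronglyMeasurable]
  have hlim : Tendsto (fun n => C * |t| ^ (-(3 / 2) : ℝ) * (∫ z : ℍ, ‖ψ z‖) *
      (eLpNorm (u n 0 - u' n 0 : Lp ℂ 2 (volume : Measure ℍ)) 1 volume).toReal) atTop (𝓝 0) := by
    have := ((ENNReal.tendsto_toReal ENNReal.zero_ne_top).comp hE).const_mul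
      (C * |t| ^ (-(3 / 2) : ℝ) * (∫ z : ℍ, ‖ψ z‖))
    simpa using this
  have hz := squeeze_zero_norm' hint hlim
  exact sub_eq_zero.1 (tendsto_nhds_unique ((hψ ψ ht').sub (hψ' ψ ht')) hz)

/-! ### Comparison of the weight with `cosh`. -/

lemma sinh_le_mul_cosh {r : ℝ} (hr : 0 ≤ r) : Real.sinh r ≤ r * Real.cosh r := by
  have hd : ∀ x : ℝ, HasDerivAt (fun x => x * Real.cosh x - Real.sinh x) (x * Real.sinh x) x :=
    fun x => by
      convert! ((hasDerivAt_id x).mul (Real.hasDerivAt_cosh x)).sub (Real.hasDerivAt_sinh x) using 1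
      simp
  have hm : MonotoneOn (fun x => x * Real.cosh x - Real.sinh x) (Set.Ici 0) := by
    refine monotoneOn_of_deriv_nonneg (convex_Ici 0)
      (fun x _ => (hd x).continuousAt.continuousWithinAt)
      (fun x _ => (hd x).differentiableAt.differentiableWithinAt) fun x hx => ?_
    rw [interior_Ici] at hx
    rw [(hd x).deriv]
    exact mul_nonneg (le_of_lt hx) (Real.sinh_nonneg_iff.2 (le_of_lt hx))
  have := hm Set.self_mem_Ici hr hr
  simp at this
  linarith

/-- The upper bound, from `sinh r ≤ r cosh r`, matches the weight with the decay of the averaged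
kernel. The lower bound keeps the reciprocal weight bounded, so the right side of the estimate is a
finite integral. -/
lemma weight_bounds {r : ℝ} (hr : 0 ≤ r) :
    1 / 2 ≤ weight r ∧ weight r ≤ Real.cosh r ^ (1 / 2 : ℝ) := by
  rw [weight]
  split_ifs with h
  · rw [h, Real.cosh_zero, Real.one_rpow]
    norm_num
  · have hr0 : 0 < r := lt_of_le_of_ne hr (Ne.symm h)
    have h1 : (1 / 2 : ℝ) ^ 2 ≤ Real.sinh r / (r * (1 + r)) := by
      rw [le_div_iff₀ (by positivity), Real.sinh_eq]
      have := Real.quadratic_le_exp_of_nonneg hr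
      have := Real.exp_le_one_iff.2 (neg_nonpos.2 hr)
      nlinarith
    have h2 : Real.sinh r / (r * (1 + r)) ≤ Real.cosh r := by
      rw [div_le_iff₀ (by positivity)]
      have := sinh_le_mul_cosh hr
      have := mul_pos (mul_pos hr0 hr0) (Real.cosh_pos r)
      nlinarith
    refine ⟨?_, Real.rpow_le_rpow ((sq_nonneg _).trans h1) h2 (by norm_num)⟩
    rw [← Real.sqrt_eq_rpow]
    exact Real.le_sqrt_of_sq_le h1

lemma weight_pos {r : ℝ} (hr : 0 ≤ r) : 0 < weight r := by linarith [(weight_bounds hr).1]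

lemma radius_nonneg (z : ℍ) : 0 ≤ radius z := dist_nonneg

lemma weight_rpow_le {δ : ℝ} (h : 0 ≤ δ) (z : ℍ) :
    weight (radius z) ^ δ ≤ coshDist I z ^ (δ / 2) := by
  calc weight (radius z) ^ δ ≤ (Real.cosh (radius z) ^ (1 / 2 : ℝ)) ^ δ :=
        Real.rpow_le_rpow (weight_pos (radius_nonneg z)).le (weight_bounds (radius_nonneg z)).2 h
    _ = _ := by
        rw [← Real.rpow_mul (Real.cosh_pos _).le, coshDist, radius]
        congr 1
        ring

lemma measurable_weight : Measurable weight := by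
  unfold weight
  refine Measurable.ite (measurableSet_singleton 0) measurable_const ?_
  fun_prop

lemma integrable_div_weight {δ : ℝ} (h0 : 0 ≤ δ) {φ : ℍ → ℂ} (hφ : Integrable φ) :
    Integrable fun z => ‖φ z‖ / weight (radius z) ^ δ := by
  have hm : Measurable fun z : ℍ => (weight (radius z) ^ δ)⁻¹ := by
    have : Continuous radius := continuous_const.dist continuous_id
    exact ((measurable_weight.comp this.measurable).pow_const δ).inv
  simp_rw [div_eq_mul_inv]
  refine hφ.norm.mul_bdd (c := 2 ^ δ) hm.aestronglyMeasurable (Eventually.of_forall fun z => ?_)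
  have hw := weight_pos (radius_nonneg z)
  rw [Real.norm_of_nonneg (by positivity), ← Real.inv_rpow hw.le]
  refine Real.rpow_le_rpow (inv_nonneg.2 hw.le) ?_ h0
  rw [inv_le_comm₀ hw two_pos]
  simpa using (weight_bounds (radius_nonneg z)).1

/-! ### Existence of the evolution and the weighted estimate. -/

/-- The Schrödinger propagator on `L¹` is given by the kernel `heatK (i t)`. -/
lemma isFreeEvolution_conv {t : ℝ} (ht : t ≠ 0) {φ : ℍ → ℂ} (hφ : Integrable φ) :
    Continuous (conv (heatK (t * Complex.I)) φ) ∧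
      IsFreeEvolution t φ (conv (heatK (t * Complex.I)) φ) := by
  obtain ⟨C, hC0, hC⟩ := heatK_dispersive (δ := 1 / 2) (by norm_num) (by norm_num)
  set B := C * |t| ^ (-(3 / 2) : ℝ) with hB
  have hker : ∀ a : ℝ, 0 ≤ a → IsBddKernel (heatK (a + t * Complex.I)) B := fun a ha => by
    have hne : (a : ℂ) + t * Complex.I ≠ 0 := fun h => by
      have := congrArg Complex.im h
      simp at this
      exact ht this
    have hb := isBddKernel_heatK (by norm_num) hC hC0.le (τ := a + t * Complex.I)
      (by simpa using ha) hne
    refine ⟨hb.cont, fun ρ hρ => (hb.bound ρ hρ).trans ?_⟩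
    have hle : |t| ≤ ‖(a : ℂ) + t * Complex.I‖ := by
      simpa using Complex.abs_im_le_norm ((a : ℂ) + t * Complex.I)
    exact mul_le_mul_of_nonneg_left
      (Real.rpow_le_rpow_of_nonpos (abs_pos.2 ht) hle (by norm_num)) hC0.le
  have hker0 : IsBddKernel (heatK (t * Complex.I)) B := by simpa using hker 0 le_rfl
  have hcont := hker0.continuous_conv hφ
  -- The regularized times `a n + i s` approach the imaginary axis from the right. The kernel bound
  -- `B` at time `t` does not depend on `a n`, which supplies the domination in both limits below.
  set a : ℕ → ℝ := fun n => 1 / ((n : ℝ) + 1) with ha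
  have ha0 : ∀ n, 0 < a n := fun n => by positivity
  have halim : Tendsto a atTop (𝓝 0) := tendsto_one_div_add_atTop_nhds_zero_nat
  have hk : ∀ (n : ℕ) (s : ℝ), ∃ M, IsKernel (heatK (a n + s * Complex.I)) M := fun n s => by
    obtain ⟨M, h, -⟩ := exists_isKernel_heat (τ := a n + s * Complex.I) (by simpa using ha0 n)
    exact ⟨M, h⟩
  refine ⟨hcont, hcont.locallyIntegrable,
    fun n s => convLp (heatK (a n + s * Complex.I)) φ, fun n => isL2Solution_heatK (ha0 n) hφ,
    ?_, fun ψ hψ => ?_⟩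
  · have h1 : Tendsto a atTop (𝓝[>] 0) :=
      tendsto_nhdsWithin_iff.2 ⟨halim, Eventually.of_forall ha0⟩
    have h2 := (ENNReal.continuous_ofReal.tendsto _).comp ((tendsto_conv_heatK hφ).comp h1)
    rw [ENNReal.ofReal_zero] at h2
    refine h2.congr fun n => ?_
    obtain ⟨M, hM⟩ := hk n 0
    have hae : (fun z => convLp (heatK (a n + (0 : ℝ) * Complex.I)) φ z - φ z) =ᵐ[volume]
        fun z => conv (heatK (a n)) φ z - φ z := by
      filter_upwards [hM.convLp_ae hφ] with z hz
      rw [hz]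
      simp
    obtain ⟨M', hM'⟩ := exists_isKernel_heatK_ofReal (ha0 n)
    have hi : Integrable fun z => conv (heatK (a n)) φ z - φ z := (hM'.integrable_conv hφ).sub hφ
    rw [eLpNorm_congr_ae hae, eLpNorm_one_eq_lintegral_enorm]
    exact ofReal_integral_norm_eq_lintegral_enorm hi
  · have e1 : ∀ n, ∫ z : ℍ, convLp (heatK (a n + t * Complex.I)) φ z * ψ z =
        ∫ z : ℍ, conv (heatK (a n + t * Complex.I)) φ z * ψ z := fun n => by
      obtain ⟨M, hM⟩ := hk n t
      refine integral_congr_ae ?_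
      filter_upwards [hM.convLp_ae hφ] with z hz
      rw [hz]
    simp_rw [e1]
    refine tendsto_integral_of_dominated_convergence (fun z => B * (∫ w, ‖φ w‖) * ‖ψ z‖)
      (fun n => ?_) (hψ.integrable.norm.const_mul _)
      (fun n => Eventually.of_forall fun z => ?_) (Eventually.of_forall fun z => ?_)
    · exact (((hker _ (ha0 n).le).continuous_conv hφ).mul hψ.continuous_coe).aestronglyMeasurable
    · rw [norm_mul]
      exact mul_le_mul_of_nonneg_right ((hker _ (ha0 n).le).norm_conv_le hφ z) (norm_nonneg _)
    · refine Tendsto.mul_const _ ?_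
      refine tendsto_integral_of_dominated_convergence (fun w => B * ‖φ w‖)
        (fun n => ((hker _ (ha0 n).le).integrable_mul hφ z).aestronglyMeasurable)
        (hφ.norm.const_mul _) (fun n => Eventually.of_forall fun w => ?_)
        (Eventually.of_forall fun w => ?_)
      · rw [norm_mul]
        exact mul_le_mul_of_nonneg_right ((hker _ (ha0 n).le).bound _ (one_le_coshDist z w))
          (norm_nonneg _)
      · refine Tendsto.mul_const _ ?_
        have hτ : (t * Complex.I : ℂ) ≠ 0 := by simpa using ht
        have hcw := continuousWithinAt_heatK (τ := t * Complex.I) (by simp) hτ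
          (one_le_coshDist z w)
        refine Tendsto.comp hcw (tendsto_nhdsWithin_iff.2 ⟨?_, Eventually.of_forall fun n => ?_⟩)
        · have := ((Complex.continuous_ofReal.tendsto 0).comp halim).add_const (t * Complex.I : ℂ)
          simpa using this
        · simpa using (ha0 n).le

/-- The weighted dispersive estimate for radial data. -/
lemma exists_weight_mul_norm_conv_le {δ : ℝ} (h0 : 0 < δ) (h1 : δ < 1) : ∃ C : ℝ, 0 < C ∧
    ∀ t : ℝ, t ≠ 0 → ∀ φ : ℍ → ℂ, Integrable φ → IsRadial φ → ∀ z : ℍ,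
      weight (radius z) ^ δ * ‖conv (heatK (t * Complex.I)) φ z‖ ≤
        C / |t| ^ (3 / 2 : ℝ) * ∫ w : ℍ, ‖φ w‖ / weight (radius w) ^ δ := by
  obtain ⟨C₁, hC₁, hker⟩ := heatK_dispersive h0 h1
  obtain ⟨C₂, hC₂, hrad⟩ := exists_integral_radial_le h0 h1
  refine ⟨C₁ * C₂, by positivity, fun t ht φ hφ hr z => ?_⟩
  set T := |t| ^ (-(3 / 2) : ℝ) with hT
  have hτ : (t * Complex.I : ℂ) ≠ 0 := by simpa using ht
  have hT' : ‖(t * Complex.I : ℂ)‖ ^ (-(3 / 2) : ℝ) = T := by simp [hT]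
  have hbk : IsBddKernel (fun ρ : ℝ => ((ρ ^ (-(δ / 2)) : ℝ) : ℂ)) 1 := by
    refine ⟨?_, fun ρ hρ => ?_⟩
    · refine Complex.continuous_ofReal.comp_continuousOn
        (continuousOn_id.rpow_const fun ρ (hρ : 1 ≤ ρ) => Or.inl ?_)
      exact (one_pos.trans_le hρ).ne'
    · have : 0 ≤ ρ := by linarith
      rw [Complex.norm_of_nonneg (by positivity)]
      exact Real.rpow_le_one_of_one_le_of_nonpos hρ (by linarith)
  have hint : ∀ z, Integrable fun w => coshDist z w ^ (-(δ / 2)) * ‖φ w‖ := fun z => by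
    refine (hbk.integrable_mul hφ z).norm.congr (Eventually.of_forall fun w => ?_)
    have := (coshDist_pos z w).le
    simp only
    rw [norm_mul, Complex.norm_of_nonneg (by positivity)]
  have hcz := coshDist_pos I z
  have e1 : ‖conv (heatK (t * Complex.I)) φ z‖ ≤
      C₁ * T * ∫ w, coshDist z w ^ (-(δ / 2)) * ‖φ w‖ := by
    rw [← integral_const_mul]
    refine norm_integral_le_of_norm_le ((hint z).const_mul _) (Eventually.of_forall fun w => ?_)
    rw [norm_mul, ← mul_assoc, ← hT']
    exact mul_le_mul_of_nonneg_right (hker _ (by simp) hτ _ (one_le_coshDist z w)) (norm_nonneg _)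
  have e2 : ∫ w, coshDist I w ^ (-(δ / 2)) * ‖φ w‖ ≤ ∫ w, ‖φ w‖ / weight (radius w) ^ δ := by
    refine integral_mono (hint I) (integrable_div_weight h0.le hφ) fun w => ?_
    have hw := Real.rpow_pos_of_pos (weight_pos (radius_nonneg w)) δ
    simp only
    rw [Real.rpow_neg (coshDist_pos I w).le, div_eq_inv_mul ‖φ w‖]
    exact mul_le_mul_of_nonneg_right (inv_anti₀ hw (weight_rpow_le h0.le w)) (norm_nonneg _)
  have hT0 : 0 ≤ T := by positivity
  -- The weight at `z`, bounded by `(cosh r)^(δ/2)`, exactly consumes the decay gained by averaging.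
  have e3 : coshDist I z ^ (δ / 2) * coshDist I z ^ (-(δ / 2)) = 1 := by
    rw [← Real.rpow_add hcz, add_neg_cancel, Real.rpow_zero]
  calc weight (radius z) ^ δ * ‖conv (heatK (t * Complex.I)) φ z‖
      ≤ coshDist I z ^ (δ / 2) * (C₁ * T * (C₂ * coshDist I z ^ (-(δ / 2)) *
          ∫ w, coshDist I w ^ (-(δ / 2)) * ‖φ w‖)) := by
        refine mul_le_mul (weight_rpow_le h0.le z) (e1.trans ?_) (norm_nonneg _) (by positivity)
        exact mul_le_mul_of_nonneg_left (hrad φ hφ hr z) (by positivity)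
    _ = C₁ * T * C₂ * ∫ w, coshDist I w ^ (-(δ / 2)) * ‖φ w‖ := by
        linear_combination (C₁ * T * C₂ * ∫ w, coshDist I w ^ (-(δ / 2)) * ‖φ w‖) * e3
    _ ≤ C₁ * T * C₂ * ∫ w, ‖φ w‖ / weight (radius w) ^ δ :=
        mul_le_mul_of_nonneg_left e2 (by positivity)
    _ = _ := by
        rw [hT, Real.rpow_neg (abs_nonneg t)]
        ring

end HypSchrodinger

theorem proposition3p3 (ε : ℝ) (hε₀ : 0 < ε) (hε₁ : ε < 1) :
    ∃ C : ℝ, 0 < C ∧ ∀ t : ℝ, t ≠ 0 → ∀ φ : UpperHalfPlane → ℂ,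
      MeasureTheory.Integrable φ MeasureTheory.volume → HypSchrodinger.IsRadial φ →
      ∃ v : UpperHalfPlane → ℂ, Continuous v ∧ HypSchrodinger.IsFreeEvolution t φ v ∧
        (∀ v' : UpperHalfPlane → ℂ, HypSchrodinger.IsFreeEvolution t φ v' →
          v' =ᵐ[MeasureTheory.volume] v) ∧
        ∀ z : UpperHalfPlane,
          HypSchrodinger.weight (HypSchrodinger.radius z) ^ (1 - ε) * ‖v z‖ ≤
            C / |t| ^ (3 / 2 : ℝ) *
              ∫ z' : UpperHalfPlane,
                ‖φ z'‖ / HypSchrodinger.weight (HypSchrodinger.radius z') ^ (1 - ε) := by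
  obtain ⟨C, hC, hest⟩ := HypSchrodinger.exists_weight_mul_norm_conv_le (δ := 1 - ε)
    (by linarith) (by linarith)
  refine ⟨C, hC, fun t ht φ hφ hr => ?_⟩
  obtain ⟨hc, hev⟩ := HypSchrodinger.isFreeEvolution_conv ht hφ
  exact ⟨_, hc, hev, fun v' hv' => hv'.ae_eq ht hφ.aestronglyMeasurable hev, hest t ht φ hφ hr⟩
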